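/- \textbf{Notation.} Let $L^2(\mathbb{R})^{ev}$ be the Hilbert space of even square integrable functions on $\mathbb{R}$, let $h_n$ ($n\ge 0$) be the normalized Hermite functions attached to $-\partial^2+(2\pi x)^2$, that is $h_n(x)=2^{1/4}(n!)^{-1/2}\,\mathrm{He}_n(2\sqrt{\pi}\,x)\,e^{-\pi x^2}$ with $\mathrm{He}_n$ the monic (probabilists') Hermite polynomials (so $h_0(x)=2^{1/4}e^{-\pi x^2}$), and let $L_\infty(z)=\pi^{-z/2}\Gamma(z/2)$. Let $$dm(s)=(2\pi)^{-3/2}\left|\Gamma\!\left(\tfrac14+\tfrac{is}{2}\right)\right|^2ds,\qquad \mathcal{P}_n(s)=\sqrt{(2n)!}\,\sum_{k=0}^{n}(-1)^k\,2^{3k-n}\,\frac{\prod_{j=0}^{k-1}\left(j-\frac{is}{2}+\frac14\right)}{(2k)!\,(n-k)!}.$$ Let $\mathcal{U}:L^2(\mathbb{R})^{ev}\to L^2(\mathbb{R})$ be the unitary given by $$\mathcal{U}(f)(s)=\pi^{-1/2}\int_0^\infty f(v)\,v^{\frac12-is}\,\frac{dv}{v}$$ for all $f\in L^2(\mathbb{R})^{ev}$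 for which the integral converges absolutely (part of the statement is that there is exactly one such unitary). Let $\mathbb{S}=-i(x\partial_x+\frac12)$ in $L^2(\mathbb{R})^{ev}$, on the domain of all $f$ for which $\mathbb{S}f$, taken in the sense of distributions, is square integrable. For $\lambda\in\mathbb{R}$ let $\mathbf{W}_\lambda=-\partial_q\big((\lambda^2-q^2)\partial_q\big)+(2\pi\lambda q)^2$ in $L^2(\mathbb{R})^{ev}$, on the domain of all $f$ such that the distributions $\partial_q(q^2\partial_q f)$ and $(-\partial_q^2+(2\pi q)^2)f$ are both square integrable. \textbf{Theorem.} \begin{enumerate} \item[(i)] $\mathcal{U}(h_0)(s)=2^{-3/4}\pi^{-1/2}L_\infty(\tfrac12-is)$. \item[(ii)] For every $n\ge0$, $\mathcal{U}(h_{2n})(s)=(-1)^n\mathcal{P}_n(s)\,\mathcal{U}(h_0)(s)$. The polynomial $\mathcal{P}_n$ has degree $n$ and the same parity as $n$; $dm$ is a probability measure on $\mathbb{R}$, and the $\mathcal{P}_n$ form an orthonormal basis of $L^2(\mathbb{R},dm)$. \item[(iii)] $\mathcal{M}(f)(s)=\mathcal{U}(h_0)(s)^{-1}f(s)$ defines a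 unitary isomorphism $\mathcal{M}:L^2(\mathbb{R})\to L^2(\mathbb{R},dm)$. \item[(iv)] The unitary $\mathcal{M}\circ\mathcal{U}:L^2(\mathbb{R})^{ev}\to L^2(\mathbb{R},dm)$ sends $h_{2n}$ to $(-1)^n\mathcal{P}_n$ for every $n\ge0$, and it transforms $\mathbb{S}$ into the operator of multiplication by $s$ with its maximal domain. \item[(v)] Let $N$ be the grading operator in $L^2(\mathbb{R},dm)$, diagonal in the basis $(\mathcal{P}_n)$ with $N\mathcal{P}_n=n\mathcal{P}_n$, on its maximal domain. For every $\lambda\in\mathbb{R}$ one has the equality of unbounded operators $$(\mathcal{M}\circ\mathcal{U})\circ\mathbf{W}_\lambda\circ(\mathcal{M}\circ\mathcal{U})^*=-s^2+2\pi\lambda^2(4N+1)-\tfrac14,$$ where $s^2$ is the operator of multiplication by $s^2$ with its maximal domain, and the right-hand side has as domain the intersection of the domains of $s^2$ and $N$. The domain of $\mathbf{W}_\lambda$ contains all even Schwartz functions, on which $\mathbf{W}_\lambda$ acts by the displayed differential expression. \end{enumerate} -/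

import Mathlib

open MeasureTheory Set Filter Topology
open scoped ENNReal SchwartzMap ComplexInnerProductSpace

noncomputable section

namespace HardyTitchmarsh

/-! ### The Hilbert space of even functions and the Mellin-type transform -/

/-- `L²(ℝ)^ev`, the closed subspace of (classes of) even functions in `L²(ℝ, dx)`. -/
def L2ev : Submodule ℂ (Lp ℂ 2 (volume : Measure ℝ)) where
  carrier := {f | ∀ᵐ x : ℝ, f (-x) = f x}
  zero_mem' := by
    have h := Lp.coeFn_zero ℂ 2 (volume : Measure ℝ)
    have h' := (Measure.measurePreserving_neg (volume : Measure ℝ)).quasiMeasurePreserving.ae h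
    filter_upwards [h, h'] with x hx hx'
    rw [hx, hx']; rfl
  add_mem' := by
    intro f g hf hg
    have h := Lp.coeFn_add f g
    have h' := (Measure.measurePreserving_neg (volume : Measure ℝ)).quasiMeasurePreserving.ae h
    change ∀ᵐ x : ℝ, (f + g : Lp ℂ 2 (volume : Measure ℝ)) (-x) = (f + g : Lp ℂ 2 _) x
    filter_upwards [h, h', hf, hg] with x hx hx' h1 h2
    rw [hx, hx', Pi.add_apply, Pi.add_apply, h1, h2]
  smul_mem' := by
    intro c f hf
    have h := Lp.coeFn_smul c f
    have h' := (Measure.measurePreserving_neg (volume : Measure ℝ)).quasiMeasurePreserving.ae h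
    change ∀ᵐ x : ℝ, (c • f : Lp ℂ 2 (volume : Measure ℝ)) (-x) = (c • f : Lp ℂ 2 _) x
    filter_upwards [h, h', hf] with x hx hx' h1
    rw [hx, hx', Pi.smul_apply, Pi.smul_apply, h1]

/-- The class in `L²(ℝ)^ev` of an even square integrable function. -/
def toL2ev (f : ℝ → ℂ) (hf : MemLp f 2 (volume : Measure ℝ)) (hev : ∀ x, f (-x) = f x) : L2ev :=
  ⟨hf.toLp f, by
    have h := hf.coeFn_toLp
    have h' := (Measure.measurePreserving_neg (volume : Measure ℝ)).quasiMeasurePreserving.ae h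
    change ∀ᵐ x : ℝ, hf.toLp f (-x) = hf.toLp f x
    filter_upwards [h, h'] with x hx hx'
    rw [hx, hx', hev]⟩

/-- `π^{-1/2} ∫_0^∞ f(v) v^{1/2 - is} dv/v`. -/
def mellinU (f : ℝ → ℂ) (s : ℝ) : ℂ :=
  ((Real.pi ^ (-(1 / 2) : ℝ) : ℝ) : ℂ) * mellin f (1 / 2 - Complex.I * s)

/-- `U` is given by the formula `U f (s) = π^{-1/2} ∫_0^∞ f(v) v^{1/2 - is} dv/v` on all `f` in
`L²(ℝ)^ev` for which this integral converges absolutely. -/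
def IsGivenByMellin (U : L2ev ≃ₗᵢ[ℂ] Lp ℂ 2 (volume : Measure ℝ)) : Prop :=
  ∀ f : L2ev, MellinConvergent (f : Lp ℂ 2 (volume : Measure ℝ)) (1 / 2) →
    ∀ᵐ s : ℝ, U f s = mellinU (f : Lp ℂ 2 (volume : Measure ℝ)) s

/-! ### Hermite functions -/

/-- The `n`-th normalized Hermite function, attached to the operator `-∂² + (2πx)²`:
`h_n(x) = 2^{1/4} (n!)^{-1/2} He_n(2 √π x) exp(-π x²)`, with `He_n` the (probabilists') Hermite
polynomial. -/
def hermiteFun (n : ℕ) (x : ℝ) : ℂ :=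
  (((2 : ℝ) ^ (1 / 4 : ℝ) / Real.sqrt n.factorial *
    Polynomial.aeval (2 * Real.sqrt Real.pi * x) (Polynomial.hermite n) *
      Real.exp (-Real.pi * x ^ 2) : ℝ) : ℂ)

theorem hermite_comp_neg (n : ℕ) :
    (Polynomial.hermite n).comp (-Polynomial.X) = (-1) ^ n * Polynomial.hermite n := by
  induction n with
  | zero => simp
  | succ n ih =>
    have h := congrArg Polynomial.derivative ih
    rw [Polynomial.derivative_comp] at h
    have h1 : Polynomial.derivative ((-1 : Polynomial ℤ) ^ n * Polynomial.hermite n)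
        = (-1) ^ n * Polynomial.derivative (Polynomial.hermite n) := by
      have : ((-1 : Polynomial ℤ) ^ n) = Polynomial.C ((-1) ^ n) := by simp
      rw [this, Polynomial.derivative_C_mul]
    rw [h1] at h
    simp only [Polynomial.derivative_neg, Polynomial.derivative_X] at h
    rw [Polynomial.hermite_succ, Polynomial.sub_comp, Polynomial.mul_comp, Polynomial.X_comp, ih]
    have h2 : (Polynomial.derivative (Polynomial.hermite n)).comp (-Polynomial.X)
        = - ((-1) ^ n * Polynomial.derivative (Polynomial.hermite n)) := by
      rw [← h]; ring
    rw [h2]; ring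

theorem hermiteFun_even (n : ℕ) (x : ℝ) : hermiteFun (2 * n) (-x) = hermiteFun (2 * n) x := by
  have h := congrArg (Polynomial.aeval (2 * Real.sqrt Real.pi * x)) (hermite_comp_neg (2 * n))
  rw [Polynomial.aeval_comp] at h
  simp only [map_neg, Polynomial.aeval_X, pow_mul, neg_one_sq, one_pow, one_mul] at h
  unfold hermiteFun
  rw [mul_neg, h, neg_sq]

theorem memLp_pow_mul_gaussian (c : ℝ) (k : ℕ) :
    MemLp (fun x : ℝ => (c * x) ^ k * Real.exp (-Real.pi * x ^ 2)) 2 (volume : Measure ℝ) := by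
  rw [memLp_two_iff_integrable_sq (by fun_prop)]
  have h := integrable_rpow_mul_exp_neg_mul_sq (b := 2 * Real.pi) (by positivity)
    (s := ((2 * k : ℕ) : ℝ)) (lt_of_lt_of_le (by norm_num) (Nat.cast_nonneg _))
  refine (h.const_mul (c ^ (2 * k))).congr (Eventually.of_forall fun x => ?_)
  simp only [Real.rpow_natCast]
  rw [mul_pow, ← pow_mul, ← Real.exp_nat_mul, mul_pow]
  have : ((2 : ℕ) : ℝ) * (-Real.pi * x ^ 2) = -(2 * Real.pi) * x ^ 2 := by push_cast; ring
  rw [this, mul_comm k 2]; ring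

theorem memLp_hermiteFun (n : ℕ) : MemLp (hermiteFun n) 2 (volume : Measure ℝ) := by
  have key : ∀ p : Polynomial ℤ, MemLp (fun x : ℝ =>
      Polynomial.aeval (2 * Real.sqrt Real.pi * x) p * Real.exp (-Real.pi * x ^ 2)) 2
        (volume : Measure ℝ) := by
    intro p
    induction p using Polynomial.induction_on' with
    | add p q hp hq =>
      convert! hp.add hq using 2
      simp [add_mul]
    | monomial k a =>
      convert! (memLp_pow_mul_gaussian (2 * Real.sqrt Real.pi) k).const_mul (a : ℝ) using 2
      simp [Polynomial.aeval_monomial, mul_assoc]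
  have h := ((key (Polynomial.hermite n)).const_mul
    ((2 : ℝ) ^ (1 / 4 : ℝ) / Real.sqrt n.factorial)).ofReal (K := ℂ)
  convert! h using 2
  simp [hermiteFun, mul_assoc]

/-- The even Hermite function `h_{2n}` as a vector of `L²(ℝ)^ev`. -/
def hermiteVec (n : ℕ) : L2ev :=
  toL2ev (hermiteFun (2 * n)) (memLp_hermiteFun (2 * n)) (hermiteFun_even n)

/-! ### The measure `dm` and the polynomials `𝒫_n` -/

/-- `dm(s) = (2π)^{-3/2} |Γ(1/4 + is/2)|² ds`. -/
def dm : Measure ℝ :=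
  (volume : Measure ℝ).withDensity fun s => ENNReal.ofReal
    ((2 * Real.pi) ^ (-(3 / 2) : ℝ) * ‖Complex.Gamma (1 / 4 + Complex.I * s / 2)‖ ^ 2)

/-- `𝒫_n(s) = √((2n)!) ∑_{k=0}^n (-1)^k 2^{3k-n} / ((2k)! (n-k)!) ∏_{j<k} (j - is/2 + 1/4)`. -/
def polyP (n : ℕ) : Polynomial ℂ :=
  Polynomial.C ((Real.sqrt (2 * n).factorial : ℝ) : ℂ) *
    ∑ k ∈ Finset.range (n + 1),
      Polynomial.C ((-1) ^ k * (2 : ℂ) ^ (3 * (k : ℤ) - (n : ℤ)) /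
        (((2 * k).factorial : ℂ) * ((n - k).factorial : ℂ))) *
      ∏ j ∈ Finset.range k,
        (Polynomial.C ((j : ℂ) + 1 / 4) - Polynomial.C (Complex.I / 2) * Polynomial.X)

theorem norm_Gamma_le {z : ℂ} (hz : 0 < z.re) : ‖Complex.Gamma z‖ ≤ Real.Gamma z.re := by
  rw [Complex.Gamma_eq_integral hz, Real.Gamma_eq_integral hz, Complex.GammaIntegral]
  refine (norm_integral_le_integral_norm _).trans (le_of_eq ?_)
  refine setIntegral_congr_fun measurableSet_Ioi fun x hx => ?_
  simp only [norm_mul, Complex.norm_cpow_eq_rpow_re_of_pos hx, Complex.norm_real, Real.norm_eq_abs,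
    Real.abs_exp, Complex.sub_re, Complex.one_re]

theorem norm_pow_mul_norm_Gamma_le (n : ℕ) : ∀ {z : ℂ}, 0 < z.re →
    ‖z‖ ^ n * ‖Complex.Gamma z‖ ≤ Real.Gamma (z.re + n) := by
  induction n with
  | zero => intro z hz; simpa using norm_Gamma_le hz
  | succ n ih =>
    intro z hz
    have hz0 : z ≠ 0 := by rintro rfl; simp at hz
    have h1 : ‖z‖ ^ (n + 1) * ‖Complex.Gamma z‖ = ‖z‖ ^ n * ‖Complex.Gamma (z + 1)‖ := by
      rw [Complex.Gamma_add_one z hz0, norm_mul]; ring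
    have h2 : ‖z‖ ≤ ‖z + 1‖ := by
      rw [← sq_le_sq₀ (norm_nonneg _) (norm_nonneg _), Complex.sq_norm, Complex.sq_norm,
        Complex.normSq_apply, Complex.normSq_apply]
      simp only [Complex.add_re, Complex.one_re, Complex.add_im, Complex.one_im, add_zero]
      nlinarith
    rw [h1]
    have h3 := ih (z := z + 1) (by simp only [Complex.add_re, Complex.one_re]; linarith)
    have h4 : (z + 1).re + n = z.re + ((n + 1 : ℕ) : ℝ) := by
      simp only [Complex.add_re, Complex.one_re]; push_cast; ring
    rw [h4] at h3
    refine le_trans ?_ h3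
    gcongr

theorem abs_pow_mul_norm_Gamma_le (n : ℕ) (s : ℝ) :
    |s| ^ n * ‖Complex.Gamma (1 / 4 + Complex.I * s / 2)‖ ≤ 2 ^ n * Real.Gamma (1 / 4 + n) := by
  have hre : (1 / 4 + Complex.I * s / 2 : ℂ).re = 1 / 4 := by simp
  have him : (1 / 4 + Complex.I * s / 2 : ℂ).im = s / 2 := by simp
  have h := norm_pow_mul_norm_Gamma_le n (z := 1 / 4 + Complex.I * s / 2) (by rw [hre]; norm_num)
  rw [hre] at h
  have h1 : |s| ≤ 2 * ‖(1 / 4 + Complex.I * s / 2 : ℂ)‖ := by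
    have := Complex.abs_im_le_norm (1 / 4 + Complex.I * s / 2 : ℂ)
    rw [him, abs_div, abs_two] at this
    linarith
  calc |s| ^ n * ‖Complex.Gamma (1 / 4 + Complex.I * s / 2)‖
      ≤ (2 * ‖(1 / 4 + Complex.I * s / 2 : ℂ)‖) ^ n *
          ‖Complex.Gamma (1 / 4 + Complex.I * s / 2)‖ := by gcongr
    _ = 2 ^ n * (‖(1 / 4 + Complex.I * s / 2 : ℂ)‖ ^ n *
          ‖Complex.Gamma (1 / 4 + Complex.I * s / 2)‖) := by ring
    _ ≤ _ := by gcongr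

theorem continuous_Gamma_line :
    Continuous fun s : ℝ => Complex.Gamma (1 / 4 + Complex.I * s / 2) := by
  rw [continuous_iff_continuousAt]
  intro s
  have h : ContinuousAt Complex.Gamma (1 / 4 + Complex.I * s / 2) := by
    refine (Complex.differentiableAt_Gamma _ fun m hm => ?_).continuousAt
    have := congrArg Complex.re hm
    simp at this
    have h0 : (0 : ℝ) ≤ m := Nat.cast_nonneg m
    linarith
  exact ContinuousAt.comp (f := fun s : ℝ => (1 / 4 + Complex.I * s / 2 : ℂ)) h
    (by fun_prop)

theorem memLp_pow_dm (n : ℕ) : MemLp (fun s : ℝ => (s : ℂ) ^ n) 2 dm := by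
  rw [memLp_two_iff_integrable_sq_norm (by fun_prop)]
  have hc := continuous_Gamma_line
  have hm : Measurable fun s : ℝ => ENNReal.ofReal
      ((2 * Real.pi) ^ (-(3 / 2) : ℝ) * ‖Complex.Gamma (1 / 4 + Complex.I * s / 2)‖ ^ 2) :=
    (continuous_const.mul (hc.norm.pow 2)).measurable.ennreal_ofReal
  unfold dm
  rw [integrable_withDensity_iff_integrable_smul' hm (by simp)]
  set A := (2 * Real.pi) ^ (-(3 / 2) : ℝ)
  have hA : 0 ≤ A := by positivity
  set C := (2 ^ n * Real.Gamma (1 / 4 + n)) ^ 2 +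
    (2 ^ (n + 1) * Real.Gamma (1 / 4 + (n + 1 : ℕ))) ^ 2
  refine Integrable.mono' (integrable_inv_one_add_sq.const_mul (A * C))
    (Measurable.aestronglyMeasurable ?_) (Eventually.of_forall fun s => ?_)
  · exact hm.ennreal_toReal.smul (by fun_prop)
  set G := ‖Complex.Gamma (1 / 4 + Complex.I * s / 2)‖
  have h0 := pow_le_pow_left₀ (by positivity) (abs_pow_mul_norm_Gamma_le n s) 2
  have h1 := pow_le_pow_left₀ (by positivity) (abs_pow_mul_norm_Gamma_le (n + 1) s) 2
  have hs : |s| ^ 2 = s ^ 2 := sq_abs s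
  rw [ENNReal.toReal_ofReal (by positivity), smul_eq_mul,
    Real.norm_of_nonneg (by positivity), norm_pow, Complex.norm_real, Real.norm_eq_abs,
    ← div_eq_mul_inv, le_div_iff₀ (by positivity)]
  calc A * G ^ 2 * (|s| ^ n) ^ 2 * (1 + s ^ 2)
      = A * ((|s| ^ n * G) ^ 2 + (|s| ^ (n + 1) * G) ^ 2) := by rw [← hs]; ring
    _ ≤ A * C := by gcongr; exact add_le_add h0 h1

theorem memLp_polynomial_dm (p : Polynomial ℂ) : MemLp (fun s : ℝ => p.eval (s : ℂ)) 2 dm := by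
  induction p using Polynomial.induction_on' with
  | add p q hp hq =>
    convert! hp.add hq using 2
    simp
  | monomial k a =>
    convert! (memLp_pow_dm k).const_mul a using 2
    simp

/-- The polynomial `𝒫_n` as a vector of `L²(ℝ, dm)`. -/
def polyVec (n : ℕ) : Lp ℂ 2 dm := (memLp_polynomial_dm (polyP n)).toLp _

/-! ### Unbounded operators -/

section Operators

variable {E F : Type*} [NormedAddCommGroup E] [InnerProductSpace ℂ E]
  [NormedAddCommGroup F] [InnerProductSpace ℂ F]

/-- The unbounded operator `V ∘ T ∘ V*` for a unitary `V`. -/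
def conjBy (V : E ≃ₗᵢ[ℂ] F) (T : E →ₗ.[ℂ] E) : F →ₗ.[ℂ] F where
  domain := T.domain.comap (V.symm.toLinearEquiv : F →ₗ[ℂ] E)
  toFun := (V.toLinearEquiv : E →ₗ[ℂ] F) ∘ₗ T.toFun ∘ₗ
    ((V.symm.toLinearEquiv : F →ₗ[ℂ] E).restrict fun _ hx => hx)

/-- The graph of the diagonal operator `x ↦ ∑ c_n ⟨e_n, x⟩ e_n`. -/
def diagGraph (e : ℕ → E) (c : ℕ → ℂ) : Submodule ℂ (E × E) where
  carrier := {p | HasSum (fun n => (c n * ⟪e n, p.1⟫) • e n) p.2}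
  zero_mem' := by simp
  add_mem' := by
    intro p q hp hq
    change HasSum _ _
    convert! HasSum.add hp hq using 2
    simp [mul_add, add_smul]
  smul_mem' := by
    intro a p hp
    change HasSum _ _
    convert! HasSum.const_smul a hp using 2
    simp [smul_smul, mul_left_comm]

theorem diagGraph_functional (e : ℕ → E) (c : ℕ → ℂ) (p : E × E) (hp : p ∈ diagGraph e c)
    (h0 : p.1 = 0) : p.2 = 0 := by
  have h : HasSum (fun n => (c n * ⟪e n, p.1⟫) • e n) p.2 := hp
  rw [h0] at h
  simp only [inner_zero_right, mul_zero, zero_smul] at h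
  exact h.unique hasSum_zero

/-- The diagonal operator `x ↦ ∑ c_n ⟨e_n, x⟩ e_n` with domain all `x` for which the series
converges; for an orthonormal basis `e` it is the operator with `e_n ↦ c_n e_n`, on its maximal
domain. -/
def diagOp (e : ℕ → E) (c : ℕ → ℂ) : E →ₗ.[ℂ] E := (diagGraph e c).toLinearPMap

theorem mem_diagOp_graph (e : ℕ → E) (c : ℕ → ℂ) (p : E × E) :
    p ∈ (diagOp e c).graph ↔ HasSum (fun n => (c n * ⟪e n, p.1⟫) • e n) p.2 := by
  rw [diagOp, Submodule.toLinearPMap_graph_eq _ (diagGraph_functional e c)]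
  rfl

/-- The everywhere defined operator `1`. -/
def idOp : E →ₗ.[ℂ] E := (LinearMap.id : E →ₗ[ℂ] E).toPMap ⊤

end Operators

/-- The graph of the multiplication by `φ` in `L²(ℝ, μ)`. -/
def mulGraph (μ : Measure ℝ) (φ : ℝ → ℂ) : Submodule ℂ (Lp ℂ 2 μ × Lp ℂ 2 μ) where
  carrier := {p | ∀ᵐ s ∂μ, p.2 s = φ s * p.1 s}
  zero_mem' := by
    filter_upwards [Lp.coeFn_zero ℂ 2 μ] with s hs
    change (0 : Lp ℂ 2 μ) s = φ s * (0 : Lp ℂ 2 μ) s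
    rw [hs]; simp
  add_mem' := by
    intro p q hp hq
    filter_upwards [hp, hq, Lp.coeFn_add p.1 q.1, Lp.coeFn_add p.2 q.2] with s h1 h2 h3 h4
    change (p.2 + q.2 : Lp ℂ 2 μ) s = φ s * (p.1 + q.1 : Lp ℂ 2 μ) s
    rw [h3, h4, Pi.add_apply, Pi.add_apply, h1, h2]; ring
  smul_mem' := by
    intro c p hp
    filter_upwards [hp, Lp.coeFn_smul c p.1, Lp.coeFn_smul c p.2] with s h1 h3 h4
    change (c • p.2 : Lp ℂ 2 μ) s = φ s * (c • p.1 : Lp ℂ 2 μ) s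
    rw [h3, h4, Pi.smul_apply, Pi.smul_apply, h1, smul_eq_mul, smul_eq_mul]; ring

theorem mulGraph_functional (μ : Measure ℝ) (φ : ℝ → ℂ) (p : Lp ℂ 2 μ × Lp ℂ 2 μ)
    (hp : p ∈ mulGraph μ φ) (h0 : p.1 = 0) : p.2 = 0 := by
  have h : ∀ᵐ s ∂μ, p.2 s = φ s * p.1 s := hp
  rw [h0] at h
  rw [Lp.eq_zero_iff_ae_eq_zero]
  filter_upwards [h, Lp.coeFn_zero ℂ 2 μ] with s h1 h2
  rw [h1, h2]; simp

/-- The operator of multiplication by `φ` in `L²(ℝ, μ)`, with domain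
`{g | φ g ∈ L²(ℝ, μ)}`. -/
def mulOp (μ : Measure ℝ) (φ : ℝ → ℂ) : Lp ℂ 2 μ →ₗ.[ℂ] Lp ℂ 2 μ := (mulGraph μ φ).toLinearPMap

theorem mem_mulOp_graph (μ : Measure ℝ) (φ : ℝ → ℂ) (p : Lp ℂ 2 μ × Lp ℂ 2 μ) :
    p ∈ (mulOp μ φ).graph ↔ ∀ᵐ s ∂μ, p.2 s = φ s * p.1 s := by
  rw [mulOp, Submodule.toLinearPMap_graph_eq _ (mulGraph_functional μ φ)]
  rfl

/-- The tempered distribution attached to an even square integrable function. -/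
def toDist : L2ev →ₗ[ℂ] 𝓢'(ℝ, ℂ) :=
  (Lp.toTemperedDistributionCLM ℂ (volume : Measure ℝ) 2 : _ →ₗ[ℂ] 𝓢'(ℝ, ℂ)) ∘ₗ L2ev.subtype

/-- The pairs `(f, g)` in `L²(ℝ)^ev` with `A f = g` in the sense of distributions. -/
def distGraph (A : 𝓢'(ℝ, ℂ) →L[ℂ] 𝓢'(ℝ, ℂ)) : Submodule ℂ (L2ev × L2ev) :=
  LinearMap.eqLocus (toDist ∘ₗ LinearMap.snd ℂ L2ev L2ev)
    ((A : 𝓢'(ℝ, ℂ) →ₗ[ℂ] 𝓢'(ℝ, ℂ)) ∘ₗ toDist ∘ₗ LinearMap.fst ℂ L2ev L2ev)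

theorem distGraph_functional (A : 𝓢'(ℝ, ℂ) →L[ℂ] 𝓢'(ℝ, ℂ)) (p : L2ev × L2ev)
    (hp : p ∈ distGraph A) (h0 : p.1 = 0) : p.2 = 0 := by
  have h : toDist p.2 = A (toDist p.1) := hp
  rw [h0, map_zero, map_zero] at h
  have hk : ((p.2 : L2ev) : Lp ℂ 2 (volume : Measure ℝ)) ∈
      (Lp.toTemperedDistributionCLM ℂ (volume : Measure ℝ) 2).ker := h
  rw [Lp.ker_toTemperedDistributionCLM_eq_bot] at hk
  exact Subtype.ext hk

/-- The operator in `L²(ℝ)^ev` acting as `A` in the sense of distributions, with domain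
`{f | A f ∈ L²(ℝ)^ev}`. -/
def distOp (A : 𝓢'(ℝ, ℂ) →L[ℂ] 𝓢'(ℝ, ℂ)) : L2ev →ₗ.[ℂ] L2ev := (distGraph A).toLinearPMap

theorem mem_distOp_graph (A : 𝓢'(ℝ, ℂ) →L[ℂ] 𝓢'(ℝ, ℂ)) (p : L2ev × L2ev) :
    p ∈ (distOp A).graph ↔ toDist p.2 = A (toDist p.1) := by
  rw [distOp, Submodule.toLinearPMap_graph_eq _ (distGraph_functional A)]
  rfl

/-- The derivative `∂` of tempered distributions. -/
abbrev dd : 𝓢'(ℝ, ℂ) →L[ℂ] 𝓢'(ℝ, ℂ) := TemperedDistribution.derivCLM ℂ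

/-- Multiplication of tempered distributions by a real function of temperate growth. -/
abbrev mulDist (φ : ℝ → ℝ) : 𝓢'(ℝ, ℂ) →L[ℂ] 𝓢'(ℝ, ℂ) :=
  TemperedDistribution.smulLeftCLM ℂ fun x => (φ x : ℂ)

/-- The scaling operator `𝕊 = -i (x ∂ + 1/2)` in `L²(ℝ)^ev`. -/
def scalingOp : L2ev →ₗ.[ℂ] L2ev :=
  distOp ((-Complex.I) • (mulDist (fun x => x) ∘L dd + (1 / 2 : ℂ) • ContinuousLinearMap.id ℂ _))

/-- The operator `∂ (q² ∂)` in `L²(ℝ)^ev`. -/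
def eulerOp : L2ev →ₗ.[ℂ] L2ev := distOp (dd ∘L mulDist (fun q => q ^ 2) ∘L dd)

/-- The Hermite operator `-∂² + (2πq)²` in `L²(ℝ)^ev`. -/
def hermiteOp : L2ev →ₗ.[ℂ] L2ev :=
  distOp (-(dd ∘L dd) + mulDist (fun q => (2 * Real.pi * q) ^ 2))

/-- The prolate operator `W_λ = -∂ ((λ² - q²) ∂) + (2πλq)²` in `L²(ℝ)^ev`. It is the sum of
`∂ (q² ∂)` and `λ² (-∂² + (2πq)²)`, and its domain is the natural domain of this sum. -/
def prolateOp (lam : ℝ) : L2ev →ₗ.[ℂ] L2ev :=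
  (distOp (-(dd ∘L mulDist (fun q => lam ^ 2 - q ^ 2) ∘L dd) +
    mulDist (fun q => (2 * Real.pi * lam * q) ^ 2))).domRestrict
      (eulerOp.domain ⊓ hermiteOp.domain)

/-- The grading operator in `L²(ℝ, dm)`: `N 𝒫_n = n 𝒫_n`. -/
def gradingOp : Lp ℂ 2 dm →ₗ.[ℂ] Lp ℂ 2 dm := diagOp polyVec fun n => (n : ℂ)

end HardyTitchmarsh

end

open HardyTitchmarsh

noncomputable section

namespace HardyTitchmarsh

/-! Under `v = exp (2πt)` the Mellin integral on the line `1/2 - is` becomes a Fourier integral, so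
the transform is a unitary substitution (`exists_expEquiv`) followed by the Fourier transform of
`L²(ℝ)`. On absolutely convergent integrals the `L²` Fourier transform agrees with the integral
(`fourier_Lp_ae_eq`). The formula fixes the transform on even Hermite functions, whose completeness
(`eq_zero_of_inner_hermiteVec`) gives uniqueness.

Multiplying a Gaussian by `x²` shifts its Mellin transform by two, and the functional equation of
Gamma turns the shift into a linear factor. Hence the transform of `h_{2n}` is a polynomial times
that of `h_0`, and matching coefficients identifies the polynomial (`mellinU_hermiteGauss`). Since
`dm` has density `|U h_0|²`, division by `U h_0` is unitary onto `L²(dm)`, and the `𝒫_n` are, up to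
sign, the images of an orthonormal basis. Degree and parity follow from a recurrence, which is the
action of `x∂ + 1/2` on Hermite functions read after the transform.

Unbounded operators are compared through their graphs, so domains are handled together with values.
A distributional equation between even functions need only be tested on even Schwartz functions
(`toDist_eq_iff_inner`). For the dilation invariant operators `𝕊` and `∂q²∂ = (q∂ + 1/2)² - 1/4`,
testing on the dilates of one Gaussian already suffices: the result says that a Fourier transform
vanishes identically (`forall_inner_eq_iff`), so these operators become multiplications on their
maximal domains. For `-∂² + (2πq)²`, testing on the eigenfunctions and Parseval give a diagonal
operator on its maximal domain (`mem_hermiteOp_graph_iff_inner`). The domain of `W_λ` is the one on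
which both summands act separately (`mem_prolateOp_graph_iff`), which matches the domain of the sum
on the other side; `conjBy_prolateOp` assembles the pieces. -/

/-! ### Even Schwartz functions and distributional operators -/

/-- The inner product of `L²(ℝ)^ev`, given priority over the instance that Mathlib derives from
Hilbert C⋆-modules. -/
instance instInnerL2ev : Inner ℂ L2ev := InnerProductSpace.toInner

/-- The class in `L²(ℝ)^ev` of an even Schwartz function. -/
def schwartzVec (ψ : 𝓢(ℝ, ℂ)) (h : ∀ x, ψ (-x) = ψ x) : L2ev :=
  toL2ev ψ (ψ.memLp 2) h

theorem coeFn_toL2ev (f : ℝ → ℂ) (hf : MemLp f 2 (volume : Measure ℝ)) (hev : ∀ x, f (-x) = f x) :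
    ((toL2ev f hf hev : L2ev) : Lp ℂ 2 (volume : Measure ℝ)) =ᵐ[volume] f :=
  hf.coeFn_toLp

theorem coeFn_schwartzVec (ψ : 𝓢(ℝ, ℂ)) (h : ∀ x, ψ (-x) = ψ x) :
    ((schwartzVec ψ h : L2ev) : Lp ℂ 2 (volume : Measure ℝ)) =ᵐ[volume] ψ :=
  coeFn_toL2ev _ _ _

/-- Reflection `x ↦ -x` on Schwartz functions. -/
def schwartzReflect : 𝓢(ℝ, ℂ) →L[ℂ] 𝓢(ℝ, ℂ) :=
  SchwartzMap.compCLMOfContinuousLinearEquiv ℂ (ContinuousLinearEquiv.neg ℝ)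

theorem schwartzReflect_apply (φ : 𝓢(ℝ, ℂ)) (x : ℝ) : schwartzReflect φ x = φ (-x) := rfl

/-- Complex conjugation on Schwartz functions. -/
def schwartzConj (φ : 𝓢(ℝ, ℂ)) : 𝓢(ℝ, ℂ) :=
  SchwartzMap.postcompCLM (𝕜 := ℝ) (Complex.conjCLE : ℂ →L[ℝ] ℂ) φ

theorem schwartzConj_apply (φ : 𝓢(ℝ, ℂ)) (x : ℝ) :
    schwartzConj φ x = (starRingEnd ℂ) (φ x) := rfl

theorem schwartzConj_schwartzConj (φ : 𝓢(ℝ, ℂ)) : schwartzConj (schwartzConj φ) = φ := by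
  ext x; simp [schwartzConj_apply]

theorem toDist_apply (f : L2ev) (φ : 𝓢(ℝ, ℂ)) :
    toDist f φ = ∫ x, φ x * (f : Lp ℂ 2 (volume : Measure ℝ)) x :=
  Lp.toTemperedDistribution_apply _ _

/-- This invariance is what allows a test function to be replaced by its even part. -/
theorem toDist_schwartzReflect (f : L2ev) (φ : 𝓢(ℝ, ℂ)) :
    toDist f (schwartzReflect φ) = toDist f φ := by
  rw [toDist_apply, toDist_apply, ← integral_neg_eq_self]
  refine integral_congr_ae ?_
  have hf : ∀ᵐ x : ℝ, (f : Lp ℂ 2 (volume : Measure ℝ)) (-x) = (f : Lp ℂ 2 (volume : Measure ℝ)) x :=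
    f.2
  filter_upwards [hf] with x hx
  simp [schwartzReflect_apply, hx]

/-- The inner product is antilinear in its first slot and the distributional pairing is bilinear,
hence the conjugate. -/
theorem inner_schwartzVec (ψ : 𝓢(ℝ, ℂ)) (h : ∀ x, ψ (-x) = ψ x) (f : L2ev) :
    ⟪schwartzVec ψ h, f⟫ = toDist f (schwartzConj ψ) := by
  rw [toDist_apply, Submodule.coe_inner, L2.inner_def]
  refine integral_congr_ae ?_
  filter_upwards [coeFn_schwartzVec ψ h] with x hx
  rw [hx, RCLike.inner_apply, schwartzConj_apply, mul_comm]

theorem schwartzConj_even {ψ : 𝓢(ℝ, ℂ)} (h : ∀ x, ψ (-x) = ψ x) (x : ℝ) :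
    schwartzConj ψ (-x) = schwartzConj ψ x := by
  simp [schwartzConj_apply, h]

/-- A distributional equation between even square integrable functions can be tested on even
Schwartz functions. -/
theorem toDist_eq_iff_inner {A : 𝓢'(ℝ, ℂ) →L[ℂ] 𝓢'(ℝ, ℂ)} {At : 𝓢(ℝ, ℂ) →L[ℂ] 𝓢(ℝ, ℂ)}
    {A₀ : 𝓢(ℝ, ℂ) → 𝓢(ℝ, ℂ)}
    (hA : ∀ T φ, A T φ = T (At φ)) (hA₀ : ∀ φ, schwartzConj (A₀ φ) = At (schwartzConj φ))
    (hR : ∀ φ, At (schwartzReflect φ) = schwartzReflect (At φ))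
    (hev : ∀ φ : 𝓢(ℝ, ℂ), (∀ x, φ (-x) = φ x) → ∀ x, A₀ φ (-x) = A₀ φ x) (f g : L2ev) :
    toDist g = A (toDist f) ↔
      ∀ (ψ : 𝓢(ℝ, ℂ)) (h : ∀ x, ψ (-x) = ψ x),
        ⟪schwartzVec ψ h, g⟫ = ⟪schwartzVec (A₀ ψ) (hev ψ h), f⟫ := by
  constructor
  · intro H ψ h
    rw [inner_schwartzVec, inner_schwartzVec, H, hA, hA₀]
  · intro H
    ext φ
    rw [hA]
    -- Twice the even part of `φ`. Reflection invariance doubles both pairings, and the factor 2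
    -- cancels at the end.
    set φe : 𝓢(ℝ, ℂ) := φ + schwartzReflect φ with hφe
    have he : ∀ x, φe (-x) = φe x := by
      intro x
      simp [hφe, schwartzReflect_apply, add_comm]
    have h1 := H (schwartzConj φe) (schwartzConj_even he)
    rw [inner_schwartzVec, inner_schwartzVec, hA₀, schwartzConj_schwartzConj, hφe, map_add, map_add,
      map_add, hR, toDist_schwartzReflect, toDist_schwartzReflect, ← two_mul, ← two_mul] at h1
    exact mul_left_cancel₀ two_ne_zero h1

/-! ### Multiplication, differentiation and Euler operators on Schwartz functions -/

/-- Multiplication of Schwartz functions by a real function of temperate growth. -/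
abbrev mulSchwartz (φ : ℝ → ℝ) : 𝓢(ℝ, ℂ) →L[ℂ] 𝓢(ℝ, ℂ) :=
  SchwartzMap.smulLeftCLM ℂ fun x => (φ x : ℂ)

theorem mulSchwartz_apply {φ : ℝ → ℝ} (hφ : φ.HasTemperateGrowth) (ψ : 𝓢(ℝ, ℂ)) (x : ℝ) :
    mulSchwartz φ ψ x = (φ x : ℂ) * ψ x := by
  have : (fun x => (φ x : ℂ)).HasTemperateGrowth := by fun_prop
  simp [SchwartzMap.smulLeftCLM_apply_apply this]

/-- The derivative of Schwartz functions. -/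
abbrev derivSchwartz : 𝓢(ℝ, ℂ) →L[ℂ] 𝓢(ℝ, ℂ) := SchwartzMap.derivCLM ℂ ℂ

theorem derivSchwartz_schwartzConj (φ : 𝓢(ℝ, ℂ)) :
    derivSchwartz (schwartzConj φ) = schwartzConj (derivSchwartz φ) := by
  ext x
  exact ((Complex.conjCLE : ℂ →L[ℝ] ℂ).hasFDerivAt.comp_hasDerivAt x (φ.hasDerivAt x)).deriv

theorem derivSchwartz_schwartzReflect (φ : 𝓢(ℝ, ℂ)) :
    derivSchwartz (schwartzReflect φ) = -schwartzReflect (derivSchwartz φ) := by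
  ext x
  change deriv (fun y => φ (-y)) x = -deriv φ (-x)
  rw [deriv_comp_neg]

theorem mulSchwartz_schwartzConj {φ : ℝ → ℝ} (hφ : φ.HasTemperateGrowth) (ψ : 𝓢(ℝ, ℂ)) :
    mulSchwartz φ (schwartzConj ψ) = schwartzConj (mulSchwartz φ ψ) := by
  ext x
  rw [mulSchwartz_apply hφ, schwartzConj_apply, schwartzConj_apply, mulSchwartz_apply hφ]
  simp

theorem mulSchwartz_schwartzReflect_of_even {φ : ℝ → ℝ} (hφ : φ.HasTemperateGrowth)
    (he : ∀ x, φ (-x) = φ x) (ψ : 𝓢(ℝ, ℂ)) :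
    mulSchwartz φ (schwartzReflect ψ) = schwartzReflect (mulSchwartz φ ψ) := by
  ext x
  rw [mulSchwartz_apply hφ, schwartzReflect_apply, schwartzReflect_apply, mulSchwartz_apply hφ, he]

theorem mulSchwartz_id_schwartzReflect (ψ : 𝓢(ℝ, ℂ)) :
    mulSchwartz (fun x => x) (schwartzReflect ψ) =
      -schwartzReflect (mulSchwartz (fun x => x) ψ) := by
  have hφ : (fun x : ℝ => x).HasTemperateGrowth := by fun_prop
  ext x
  rw [neg_apply, mulSchwartz_apply hφ, schwartzReflect_apply, schwartzReflect_apply,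
    mulSchwartz_apply hφ]
  push_cast; ring

theorem schwartzConj_add (φ ψ : 𝓢(ℝ, ℂ)) :
    schwartzConj (φ + ψ) = schwartzConj φ + schwartzConj ψ := by
  ext x; simp [schwartzConj_apply]

theorem schwartzConj_neg (φ : 𝓢(ℝ, ℂ)) : schwartzConj (-φ) = -schwartzConj φ := by
  ext x; simp [schwartzConj_apply]

theorem schwartzConj_smul (c : ℂ) (φ : 𝓢(ℝ, ℂ)) :
    schwartzConj (c • φ) = (starRingEnd ℂ) c • schwartzConj φ := by
  ext x; simp [schwartzConj_apply]

theorem even_iff_schwartzReflect {φ : 𝓢(ℝ, ℂ)} :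
    (∀ x, φ (-x) = φ x) ↔ schwartzReflect φ = φ := by
  constructor
  · intro h; ext x; exact h x
  · intro h x; rw [← schwartzReflect_apply, h]

/-- The operator `x ∂ + 1/2` on Schwartz functions. -/
def eulerSchwartz : 𝓢(ℝ, ℂ) →L[ℂ] 𝓢(ℝ, ℂ) :=
  mulSchwartz (fun x => x) ∘L derivSchwartz + (1 / 2 : ℂ) • ContinuousLinearMap.id ℂ _

/-- The operator `∂ q² ∂` on Schwartz functions. -/
def eulerSqSchwartz : 𝓢(ℝ, ℂ) →L[ℂ] 𝓢(ℝ, ℂ) :=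
  derivSchwartz ∘L mulSchwartz (fun q => q ^ 2) ∘L derivSchwartz

/-- The operator `-∂² + (2πq)²` on Schwartz functions. -/
def hermiteOpSchwartz : 𝓢(ℝ, ℂ) →L[ℂ] 𝓢(ℝ, ℂ) :=
  -(derivSchwartz ∘L derivSchwartz) + mulSchwartz (fun q => (2 * Real.pi * q) ^ 2)

theorem eulerSchwartz_eq (φ : 𝓢(ℝ, ℂ)) : eulerSchwartz φ =
    mulSchwartz (fun x => x) (derivSchwartz φ) + (1 / 2 : ℂ) • φ := rfl

theorem eulerSqSchwartz_eq (φ : 𝓢(ℝ, ℂ)) : eulerSqSchwartz φ =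
    derivSchwartz (mulSchwartz (fun q => q ^ 2) (derivSchwartz φ)) := rfl

theorem hermiteOpSchwartz_eq (φ : 𝓢(ℝ, ℂ)) : hermiteOpSchwartz φ =
    -derivSchwartz (derivSchwartz φ) + mulSchwartz (fun q => (2 * Real.pi * q) ^ 2) φ := rfl

theorem eulerSchwartz_reflect (φ : 𝓢(ℝ, ℂ)) :
    eulerSchwartz (schwartzReflect φ) = schwartzReflect (eulerSchwartz φ) := by
  simp only [eulerSchwartz_eq, derivSchwartz_schwartzReflect, map_neg,
    mulSchwartz_id_schwartzReflect, map_add, map_smul, neg_neg]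

theorem eulerSqSchwartz_reflect (φ : 𝓢(ℝ, ℂ)) :
    eulerSqSchwartz (schwartzReflect φ) = schwartzReflect (eulerSqSchwartz φ) := by
  have h : (fun q : ℝ => q ^ 2).HasTemperateGrowth := by fun_prop
  simp only [eulerSqSchwartz_eq, derivSchwartz_schwartzReflect, map_neg,
    mulSchwartz_schwartzReflect_of_even h (fun x => neg_sq x), neg_neg]

theorem hermiteOpSchwartz_reflect (φ : 𝓢(ℝ, ℂ)) :
    hermiteOpSchwartz (schwartzReflect φ) = schwartzReflect (hermiteOpSchwartz φ) := by
  have h : (fun q : ℝ => (2 * Real.pi * q) ^ 2).HasTemperateGrowth := by fun_prop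
  simp only [hermiteOpSchwartz_eq, derivSchwartz_schwartzReflect, map_neg, map_add,
    mulSchwartz_schwartzReflect_of_even h (fun x => by ring), neg_neg]

theorem eulerSchwartz_even {φ : 𝓢(ℝ, ℂ)} (h : ∀ x, φ (-x) = φ x) (x : ℝ) :
    eulerSchwartz φ (-x) = eulerSchwartz φ x :=
  even_iff_schwartzReflect.2 (by
    rw [← eulerSchwartz_reflect, even_iff_schwartzReflect.1 h]) x

theorem eulerSqSchwartz_even {φ : 𝓢(ℝ, ℂ)} (h : ∀ x, φ (-x) = φ x) (x : ℝ) :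
    eulerSqSchwartz φ (-x) = eulerSqSchwartz φ x :=
  even_iff_schwartzReflect.2 (by
    rw [← eulerSqSchwartz_reflect, even_iff_schwartzReflect.1 h]) x

theorem hermiteOpSchwartz_even {φ : 𝓢(ℝ, ℂ)} (h : ∀ x, φ (-x) = φ x) (x : ℝ) :
    hermiteOpSchwartz φ (-x) = hermiteOpSchwartz φ x :=
  even_iff_schwartzReflect.2 (by
    rw [← hermiteOpSchwartz_reflect, even_iff_schwartzReflect.1 h]) x

theorem smul_eulerSchwartz_even (c : ℂ) {φ : 𝓢(ℝ, ℂ)} (h : ∀ x, φ (-x) = φ x) (x : ℝ) :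
    (c • eulerSchwartz φ) (-x) = (c • eulerSchwartz φ) x := by
  simp [eulerSchwartz_even h]

theorem eulerSchwartz_conj (φ : 𝓢(ℝ, ℂ)) :
    eulerSchwartz (schwartzConj φ) = schwartzConj (eulerSchwartz φ) := by
  have h : (fun q : ℝ => q).HasTemperateGrowth := by fun_prop
  simp [eulerSchwartz_eq, derivSchwartz_schwartzConj, mulSchwartz_schwartzConj h, schwartzConj_add,
    schwartzConj_smul, Complex.conj_ofNat]

theorem eulerSqSchwartz_conj (φ : 𝓢(ℝ, ℂ)) :
    eulerSqSchwartz (schwartzConj φ) = schwartzConj (eulerSqSchwartz φ) := by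
  have h : (fun q : ℝ => q ^ 2).HasTemperateGrowth := by fun_prop
  simp only [eulerSqSchwartz_eq, derivSchwartz_schwartzConj, mulSchwartz_schwartzConj h]

theorem hermiteOpSchwartz_conj (φ : 𝓢(ℝ, ℂ)) :
    hermiteOpSchwartz (schwartzConj φ) = schwartzConj (hermiteOpSchwartz φ) := by
  have h : (fun q : ℝ => (2 * Real.pi * q) ^ 2).HasTemperateGrowth := by fun_prop
  simp only [hermiteOpSchwartz_eq, derivSchwartz_schwartzConj, mulSchwartz_schwartzConj h,
    schwartzConj_add, schwartzConj_neg]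

/-- The commutation relation `[∂, x] = 1`, from which the identities between the Euler operators
follow. -/
theorem derivSchwartz_mul_id (φ : 𝓢(ℝ, ℂ)) :
    derivSchwartz (mulSchwartz (fun x => x) φ) =
      mulSchwartz (fun x => x) (derivSchwartz φ) + φ := by
  have h : (fun q : ℝ => q).HasTemperateGrowth := by fun_prop
  ext x
  have h1 : (mulSchwartz (fun x => x) φ : ℝ → ℂ) = fun x : ℝ => (x : ℂ) * φ x :=
    funext fun x => mulSchwartz_apply h φ x
  rw [add_apply, mulSchwartz_apply h]
  change deriv (mulSchwartz (fun x => x) φ : ℝ → ℂ) x = x * deriv φ x + φ x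
  have h2 : HasDerivAt (fun x : ℝ => (x : ℂ) * φ x) _ x :=
    (hasDerivAt_id x).ofReal_comp.mul (φ.hasDerivAt x)
  rw [h1, h2.deriv]
  simp; ring

theorem derivSchwartz_mul_sq (φ : 𝓢(ℝ, ℂ)) :
    derivSchwartz (mulSchwartz (fun x => x ^ 2) φ) =
      mulSchwartz (fun x => x) (derivSchwartz (mulSchwartz (fun x => x) φ)) +
        mulSchwartz (fun x => x) φ := by
  have h : (fun q : ℝ => q).HasTemperateGrowth := by fun_prop
  have h2 : (fun q : ℝ => q ^ 2).HasTemperateGrowth := by fun_prop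
  rw [← derivSchwartz_mul_id]
  congr 1
  ext x
  rw [mulSchwartz_apply h, mulSchwartz_apply h, mulSchwartz_apply h2]
  push_cast; ring

/-- `∂ q² ∂ = (q ∂ + 1/2)² - 1/4`. -/
theorem eulerSqSchwartz_eq_sq (φ : 𝓢(ℝ, ℂ)) :
    eulerSqSchwartz φ = eulerSchwartz (eulerSchwartz φ) - (1 / 4 : ℂ) • φ := by
  rw [eulerSqSchwartz_eq, derivSchwartz_mul_sq]
  simp only [eulerSchwartz_eq, map_add, map_smul]
  module

/-! ### Graphs of the operators, tested on even Schwartz functions -/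

theorem mem_scalingOp_graph_iff (f g : L2ev) :
    (f, g) ∈ scalingOp.graph ↔
      ∀ (ψ : 𝓢(ℝ, ℂ)) (h : ∀ x, ψ (-x) = ψ x),
        ⟪schwartzVec ψ h, g⟫ =
          ⟪schwartzVec ((-Complex.I) • eulerSchwartz ψ) (smul_eulerSchwartz_even _ h), f⟫ := by
  rw [scalingOp, mem_distOp_graph]
  -- The transpose of `x∂ + 1/2` is its negative, so `-i(x∂ + 1/2)` has transpose `i(x∂ + 1/2)`;
  -- conjugation brings the formal adjoint back to `-i(x∂ + 1/2)`.
  refine toDist_eq_iff_inner (At := Complex.I • eulerSchwartz)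
    (A₀ := fun ψ => (-Complex.I) • eulerSchwartz ψ) ?_ ?_ ?_
    (fun φ h => smul_eulerSchwartz_even _ h) f g
  · intro T φ
    change (-Complex.I) • (T (-derivSchwartz (mulSchwartz (fun x => x) φ)) + (1 / 2 : ℂ) • T φ) =
      T (Complex.I • eulerSchwartz φ)
    rw [derivSchwartz_mul_id, eulerSchwartz_eq]
    simp only [map_neg, map_add, map_smul, smul_eq_mul]
    ring
  · intro φ
    rw [schwartzConj_smul, ← eulerSchwartz_conj]
    simp
  · intro φ
    simp [eulerSchwartz_reflect]

theorem mem_eulerOp_graph_iff (f g : L2ev) :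
    (f, g) ∈ eulerOp.graph ↔
      ∀ (ψ : 𝓢(ℝ, ℂ)) (h : ∀ x, ψ (-x) = ψ x),
        ⟪schwartzVec ψ h, g⟫ = ⟪schwartzVec (eulerSqSchwartz ψ) (eulerSqSchwartz_even h), f⟫ := by
  rw [eulerOp, mem_distOp_graph]
  -- The signs of the two derivatives cancel and the coefficients are real, so transpose and formal
  -- adjoint both equal the operator.
  refine toDist_eq_iff_inner (At := eulerSqSchwartz)
    (A₀ := eulerSqSchwartz) ?_ ?_ ?_ (fun φ h => eulerSqSchwartz_even h) f g
  · intro T φ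
    change T (-derivSchwartz (mulSchwartz (fun q => q ^ 2) (-derivSchwartz φ))) =
      T (eulerSqSchwartz φ)
    simp [eulerSqSchwartz_eq]
  · exact fun φ => (eulerSqSchwartz_conj φ).symm
  · exact eulerSqSchwartz_reflect

theorem mem_hermiteOp_graph_iff (f g : L2ev) :
    (f, g) ∈ hermiteOp.graph ↔
      ∀ (ψ : 𝓢(ℝ, ℂ)) (h : ∀ x, ψ (-x) = ψ x),
        ⟪schwartzVec ψ h, g⟫ =
          ⟪schwartzVec (hermiteOpSchwartz ψ) (hermiteOpSchwartz_even h), f⟫ := by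
  rw [hermiteOp, mem_distOp_graph]
  refine toDist_eq_iff_inner (At := hermiteOpSchwartz)
    (A₀ := hermiteOpSchwartz) ?_ ?_ ?_ (fun φ h => hermiteOpSchwartz_even h) f g
  · intro T φ
    change -T (-derivSchwartz (-derivSchwartz φ)) +
      T (mulSchwartz (fun q => (2 * Real.pi * q) ^ 2) φ) = T (hermiteOpSchwartz φ)
    simp [hermiteOpSchwartz_eq]
  · exact fun φ => (hermiteOpSchwartz_conj φ).symm
  · exact hermiteOpSchwartz_reflect

/-! ### Schwartz functions in the domains; splitting of the prolate operator -/

theorem toDist_schwartzVec (ψ : 𝓢(ℝ, ℂ)) (h : ∀ x, ψ (-x) = ψ x) :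
    toDist (schwartzVec ψ h) = SchwartzMap.toTemperedDistributionCLM ℝ ℂ volume ψ :=
  Lp.toTemperedDistribution_toLp_eq ψ

theorem dd_schwartz (ψ : 𝓢(ℝ, ℂ)) :
    dd (SchwartzMap.toTemperedDistributionCLM ℝ ℂ volume ψ) =
      SchwartzMap.toTemperedDistributionCLM ℝ ℂ volume (derivSchwartz ψ) :=
  TemperedDistribution.derivCLM_toTemperedDistributionCLM_eq ℂ ψ

theorem mulDist_schwartz {φ : ℝ → ℝ} (hφ : φ.HasTemperateGrowth) (ψ : 𝓢(ℝ, ℂ)) :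
    mulDist φ (SchwartzMap.toTemperedDistributionCLM ℝ ℂ volume ψ) =
      SchwartzMap.toTemperedDistributionCLM ℝ ℂ volume (mulSchwartz φ ψ) := by
  ext u
  rw [TemperedDistribution.smulLeftCLM_apply_apply]
  refine (SchwartzMap.toTemperedDistributionCLM_apply_apply volume _ _).trans
    (Eq.trans ?_ (SchwartzMap.toTemperedDistributionCLM_apply_apply volume _ _).symm)
  refine integral_congr_ae (Eventually.of_forall fun x => ?_)
  have h1 := mulSchwartz_apply hφ u x
  have h2 := mulSchwartz_apply hφ ψ x
  simp only [h1, h2, smul_eq_mul]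
  ring

/-- An even Schwartz function is in the domain of `∂ q² ∂`, which acts on it as expected. -/
theorem schwartz_mem_eulerOp_graph (ψ : 𝓢(ℝ, ℂ)) (h : ∀ x, ψ (-x) = ψ x) :
    (schwartzVec ψ h, schwartzVec (eulerSqSchwartz ψ) (eulerSqSchwartz_even h)) ∈
      eulerOp.graph := by
  have hq : (fun q : ℝ => q ^ 2).HasTemperateGrowth := by fun_prop
  rw [eulerOp, mem_distOp_graph, toDist_schwartzVec, toDist_schwartzVec]
  simp only [ContinuousLinearMap.comp_apply, dd_schwartz, mulDist_schwartz hq]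
  rfl

/-- An even Schwartz function is in the domain of the Hermite operator, which acts on it as
expected. -/
theorem schwartz_mem_hermiteOp_graph (ψ : 𝓢(ℝ, ℂ)) (h : ∀ x, ψ (-x) = ψ x) :
    (schwartzVec ψ h, schwartzVec (hermiteOpSchwartz ψ) (hermiteOpSchwartz_even h)) ∈
      hermiteOp.graph := by
  have hq : (fun q : ℝ => (2 * Real.pi * q) ^ 2).HasTemperateGrowth := by fun_prop
  rw [hermiteOp, mem_distOp_graph, toDist_schwartzVec, toDist_schwartzVec, hermiteOpSchwartz_eq,
    map_add, map_neg, ← mulDist_schwartz hq, ← dd_schwartz, ← dd_schwartz]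
  rfl

theorem toDist_injective : Function.Injective toDist := by
  intro f g h
  -- The pair `(0, f - g)` lies in the graph of the zero operator, and functionality of that graph
  -- forces `f - g = 0`.
  have := distGraph_functional 0 (0, f - g) (by
    change toDist (f - g) = 0
    rw [map_sub, h, sub_self]) rfl
  exact sub_eq_zero.1 this

/-- Expansion of `-∂(λ² - q²)∂`. It holds for every tempered distribution, so no question of domain
arises here. -/
theorem prolate_dist_eq (lam : ℝ) (T : 𝓢'(ℝ, ℂ)) :
    (-(dd ∘L mulDist (fun q => lam ^ 2 - q ^ 2) ∘L dd) +
      mulDist (fun q => (2 * Real.pi * lam * q) ^ 2)) T =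
    (dd ∘L mulDist (fun q => q ^ 2) ∘L dd) T + ((lam ^ 2 : ℝ) : ℂ) •
      (-(dd ∘L dd) + mulDist (fun q => (2 * Real.pi * q) ^ 2)) T := by
  have hq : (fun q : ℝ => q ^ 2).HasTemperateGrowth := by fun_prop
  have hq2 : (fun q : ℝ => lam ^ 2 - q ^ 2).HasTemperateGrowth := by fun_prop
  have hq3 : (fun q : ℝ => (2 * Real.pi * lam * q) ^ 2).HasTemperateGrowth := by fun_prop
  have hq4 : (fun q : ℝ => (2 * Real.pi * q) ^ 2).HasTemperateGrowth := by fun_prop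
  have h1 (φ : 𝓢(ℝ, ℂ)) : mulSchwartz (fun q => lam ^ 2 - q ^ 2) φ =
      ((lam ^ 2 : ℝ) : ℂ) • φ - mulSchwartz (fun q => q ^ 2) φ := by
    ext x
    rw [mulSchwartz_apply hq2, sub_apply, smul_apply, mulSchwartz_apply hq]
    push_cast; simp only [smul_eq_mul]; ring
  have h2 (φ : 𝓢(ℝ, ℂ)) : mulSchwartz (fun q => (2 * Real.pi * lam * q) ^ 2) φ =
      ((lam ^ 2 : ℝ) : ℂ) • mulSchwartz (fun q => (2 * Real.pi * q) ^ 2) φ := by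
    ext x
    rw [mulSchwartz_apply hq3, smul_apply, mulSchwartz_apply hq4]
    push_cast; simp only [smul_eq_mul]; ring
  ext φ
  change -T (-derivSchwartz (mulSchwartz (fun q => lam ^ 2 - q ^ 2) (-derivSchwartz φ))) +
      T (mulSchwartz (fun q => (2 * Real.pi * lam * q) ^ 2) φ) =
    T (-derivSchwartz (mulSchwartz (fun q => q ^ 2) (-derivSchwartz φ))) + ((lam ^ 2 : ℝ) : ℂ) •
      (-T (-derivSchwartz (-derivSchwartz φ)) +
        T (mulSchwartz (fun q => (2 * Real.pi * q) ^ 2) φ))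
  rw [h1, h2]
  simp only [map_neg, map_sub, map_smul, smul_eq_mul]
  ring

/-- The prolate operator is `∂ q² ∂ + λ² (-∂² + (2πq)²)`, as an unbounded operator. -/
theorem mem_prolateOp_graph_iff (lam : ℝ) (f g : L2ev) :
    (f, g) ∈ (prolateOp lam).graph ↔
      ∃ e k : L2ev, (f, e) ∈ eulerOp.graph ∧ (f, k) ∈ hermiteOp.graph ∧
        g = e + ((lam ^ 2 : ℝ) : ℂ) • k := by
  constructor
  · intro h
    have h1 := LinearPMap.le_graph_of_le LinearPMap.domRestrict_le h
    rw [mem_distOp_graph] at h1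
    have h2 := LinearPMap.mem_domain_of_mem_graph h
    -- The restriction of the domain supplies `e` and `k` separately; the equation for the sum would
    -- not.
    obtain ⟨⟨h3, h4⟩, -⟩ := h2
    obtain ⟨e, he⟩ := LinearPMap.mem_domain_iff.1 h3
    obtain ⟨k, hk⟩ := LinearPMap.mem_domain_iff.1 h4
    refine ⟨e, k, he, hk, toDist_injective ?_⟩
    rw [eulerOp, mem_distOp_graph] at he
    rw [hermiteOp, mem_distOp_graph] at hk
    rw [map_add, map_smul, h1, he, hk]
    exact prolate_dist_eq lam _
  · rintro ⟨e, k, he, hk, rfl⟩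
    have h3 := LinearPMap.mem_domain_of_mem_graph he
    have h4 := LinearPMap.mem_domain_of_mem_graph hk
    have h1 : (f, e + ((lam ^ 2 : ℝ) : ℂ) • k) ∈
        (distOp (-(dd ∘L mulDist (fun q => lam ^ 2 - q ^ 2) ∘L dd) +
          mulDist (fun q => (2 * Real.pi * lam * q) ^ 2))).graph := by
      rw [mem_distOp_graph, map_add, map_smul]
      rw [eulerOp, mem_distOp_graph] at he
      rw [hermiteOp, mem_distOp_graph] at hk
      rw [he, hk]
      exact (prolate_dist_eq lam _).symm
    obtain ⟨y, hy, hy'⟩ := (LinearPMap.mem_graph_iff _).1 h1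
    refine (LinearPMap.mem_graph_iff _).2
      ⟨⟨f, ⟨h3, h4⟩, LinearPMap.mem_domain_of_mem_graph h1⟩, rfl, ?_⟩
    rw [← hy']
    exact LinearPMap.domRestrict_apply hy.symm

/-! ### Isometries given by weighted composition -/

section WeightedComposition

variable {X Y : Type*} [MeasurableSpace X] [MeasurableSpace Y] {μ : Measure X} {ν : Measure Y}

theorem eLpNorm_two_eq (f : X → ℂ) :
    eLpNorm f 2 μ = (∫⁻ x, ‖f x‖ₑ ^ 2 ∂μ) ^ (1 / 2 : ℝ) := by
  rw [eLpNorm_eq_lintegral_rpow_enorm_toReal two_ne_zero ENNReal.ofNat_ne_top]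
  simp

theorem enorm_mul_sq (a b : ℂ) : ‖a * b‖ₑ ^ 2 = ENNReal.ofReal (‖a‖ ^ 2) * ‖b‖ₑ ^ 2 := by
  rw [enorm_mul, mul_pow, ENNReal.ofReal_pow (norm_nonneg _), ofReal_norm]

/-- The weighted composition `f ↦ c · (f ∘ φ)` as a linear isometry into `L²`, on a space of
square integrable functions whose norm it preserves. -/
theorem exists_weightedComp {E : Type*} [NormedAddCommGroup E] [InnerProductSpace ℂ E]
    (ι : E →ₗᵢ[ℂ] Lp ℂ 2 μ) {φ : Y → X} {c : Y → ℂ}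
    (hφ : Measure.QuasiMeasurePreserving φ ν μ) (hc : AEStronglyMeasurable c ν)
    (hnorm : ∀ f : E, ∫⁻ y, ENNReal.ofReal (‖c y‖ ^ 2) * ‖ι f (φ y)‖ₑ ^ 2 ∂ν =
      ∫⁻ x, ‖ι f x‖ₑ ^ 2 ∂μ) :
    ∃ T : E →ₗᵢ[ℂ] Lp ℂ 2 ν, ∀ f, T f =ᵐ[ν] fun y => c y * ι f (φ y) := by
  have hn (f : E) : eLpNorm (fun y => c y * ι f (φ y)) 2 ν = eLpNorm (ι f) 2 μ := by
    rw [eLpNorm_two_eq, eLpNorm_two_eq, ← hnorm f]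
    simp only [enorm_mul_sq]
  -- Quasi-preservation of null sets makes composition meaningful on classes; below it also pulls
  -- the a.e. formulas for sums and multiples back along `φ`.
  have hm (f : E) : MemLp (fun y => c y * ι f (φ y)) 2 ν :=
    ⟨hc.mul ((Lp.aestronglyMeasurable (ι f)).comp_quasiMeasurePreserving hφ), by
      rw [hn]; exact Lp.eLpNorm_lt_top _⟩
  refine ⟨{ toFun := fun f => (hm f).toLp _, map_add' := ?_, map_smul' := ?_, norm_map' := ?_ },
    fun f => (hm f).coeFn_toLp⟩
  · intro f g
    ext1
    filter_upwards [(hm (f + g)).coeFn_toLp, (hm f).coeFn_toLp, (hm g).coeFn_toLp,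
      Lp.coeFn_add ((hm f).toLp _) ((hm g).toLp _), hφ.ae (Lp.coeFn_add (ι f) (ι g))]
      with y h1 h2 h3 h4 h5
    rw [h1, h4, Pi.add_apply, h2, h3, map_add, h5, Pi.add_apply, mul_add]
  · intro a f
    ext1
    filter_upwards [(hm (a • f)).coeFn_toLp, (hm f).coeFn_toLp,
      Lp.coeFn_smul a ((hm f).toLp _), hφ.ae (Lp.coeFn_smul a (ι f))] with y h1 h2 h3 h4
    rw [h1, RingHom.id_apply, h3, Pi.smul_apply, h2, map_smul, h4, Pi.smul_apply, smul_eq_mul,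
      smul_eq_mul]
    ring
  · intro f
    change ‖(hm f).toLp _‖ = ‖f‖
    rw [Lp.norm_toLp, hn, ← Lp.norm_def, ι.norm_map]

end WeightedComposition

/-! ### Fourier transform on `L¹ ∩ L²` -/

/-- Both sides define the same distribution: the `L²` transform by duality, the integral by Fubini.
Two locally integrable functions that agree against compactly supported smooth functions are equal
a.e. -/
theorem fourier_Lp_ae_eq (F : Lp ℂ 2 (volume : Measure ℝ)) (hF : Integrable F) :
    Lp.fourierTransformₗᵢ ℝ ℂ F =ᵐ[volume] FourierTransform.fourier (F : ℝ → ℂ) := by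
  have hcont : Continuous (FourierTransform.fourier (F : ℝ → ℂ)) :=
    VectorFourier.fourierIntegral_continuous Real.continuous_fourierChar
      (by exact continuous_inner) hF
  refine ae_eq_of_integral_contDiff_smul_eq
    ((Lp.memLp _).locallyIntegrable one_le_two) hcont.locallyIntegrable fun g hg hgc => ?_
  have hg₁ : HasCompactSupport (Complex.ofRealCLM ∘ g) := hgc.comp_left rfl
  have hg₂ : ContDiff ℝ ((⊤ : ℕ∞) : WithTop ℕ∞) (Complex.ofRealCLM ∘ g) := by fun_prop
  set ψ : 𝓢(ℝ, ℂ) := hg₁.toSchwartzMap hg₂ with hψ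
  have h1 := congrArg (fun T : 𝓢'(ℝ, ℂ) => T ψ) (Lp.fourier_toTemperedDistribution_eq F)
  simp only [TemperedDistribution.fourier_apply, Lp.toTemperedDistribution_apply] at h1
  have h2 := VectorFourier.integral_fourierIntegral_smul_eq_flip (μ := volume) (ν := volume)
    (L := innerₗ ℝ) Real.continuous_fourierChar (by exact continuous_inner)
    (f := (ψ : ℝ → ℂ)) (g := (F : ℝ → ℂ)) ψ.integrable hF
  rw [flip_innerₗ] at h2
  have h3 : ∫ x, g x • (Lp.fourierTransformₗᵢ ℝ ℂ F) x = ∫ x,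
      ψ x • (Lp.fourierTransformₗᵢ ℝ ℂ F) x := by
    simp [hψ]
  have h4 : ∫ x, g x • FourierTransform.fourier (F : ℝ → ℂ) x =
      ∫ x, ψ x • FourierTransform.fourier (F : ℝ → ℂ) x := by
    simp [hψ]
  rw [h3, h4]
  exact h1.symm.trans h2

/-- An `L¹ ∩ L²` function whose Fourier transform vanishes is zero. -/
theorem ae_eq_zero_of_fourier_eq_zero {G : ℝ → ℂ} (h1 : Integrable G) (h2 : MemLp G 2 volume)
    (h : ∀ ξ, FourierTransform.fourier G ξ = 0) : G =ᵐ[volume] 0 := by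
  have hG := h2.coeFn_toLp
  have h3 := fourier_Lp_ae_eq (h2.toLp G) (h1.congr hG.symm)
  have h4 : FourierTransform.fourier (h2.toLp G : ℝ → ℂ) = FourierTransform.fourier G := by
    ext ξ
    rw [Real.fourier_eq, Real.fourier_eq]
    refine integral_congr_ae ?_
    filter_upwards [hG] with x hx
    rw [hx]
  have h5 : Lp.fourierTransformₗᵢ ℝ ℂ (h2.toLp G) = 0 := by
    rw [Lp.eq_zero_iff_ae_eq_zero]
    filter_upwards [h3] with ξ hξ
    rw [hξ, h4, h]; rfl
  rw [map_eq_zero_iff _ (Lp.fourierTransformₗᵢ ℝ ℂ).injective, Lp.eq_zero_iff_ae_eq_zero] at h5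
  exact hG.symm.trans h5

/-! ### Exponential change of variables -/

theorem range_exp_two_pi : (fun t : ℝ => Real.exp (2 * Real.pi * t)) '' univ = Ioi 0 := by
  have h0 : (0 : ℝ) < 2 * Real.pi := by positivity
  ext x
  simp only [image_univ, mem_range, mem_Ioi]
  constructor
  · rintro ⟨t, rfl⟩; positivity
  · intro hx
    refine ⟨Real.log x / (2 * Real.pi), ?_⟩
    rw [mul_div_cancel₀ _ h0.ne', Real.exp_log hx]

theorem injOn_exp_two_pi : InjOn (fun t : ℝ => Real.exp (2 * Real.pi * t)) univ := by
  have h0 : (0 : ℝ) < 2 * Real.pi := by positivity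
  exact fun a _ b _ hab => mul_left_cancel₀ h0.ne' (Real.exp_injective hab)

theorem hasDerivWithinAt_exp_two_pi (t : ℝ) : HasDerivWithinAt
    (fun t : ℝ => Real.exp (2 * Real.pi * t)) (2 * Real.pi * Real.exp (2 * Real.pi * t)) univ t := by
  have h := ((hasDerivAt_id t).const_mul (2 * Real.pi)).exp
  simp only [id, mul_one] at h
  rw [mul_comm (2 * Real.pi) (Real.exp _)]
  exact h.hasDerivWithinAt

theorem lintegral_exp_comp (g : ℝ → ℝ≥0∞) :
    ∫⁻ t, ENNReal.ofReal (2 * Real.pi * Real.exp (2 * Real.pi * t)) *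
      g (Real.exp (2 * Real.pi * t)) = ∫⁻ x in Ioi 0, g x := by
  rw [← range_exp_two_pi, lintegral_image_eq_lintegral_abs_deriv_mul MeasurableSet.univ
    (fun t _ => hasDerivWithinAt_exp_two_pi t) injOn_exp_two_pi, Measure.restrict_univ]
  refine lintegral_congr fun t => ?_
  rw [abs_of_pos (by positivity)]

theorem lintegral_eq_two_mul_of_even {g : ℝ → ℝ≥0∞} (hg : ∀ᵐ x : ℝ, g (-x) = g x) :
    ∫⁻ x, g x = 2 * ∫⁻ x in Ioi 0, g x := by
  have h1 : ∫⁻ x in Iio 0, g x = ∫⁻ x in Ioi 0, g x := by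
    have := (Measure.measurePreserving_neg (volume : Measure ℝ)).setLIntegral_comp_preimage_emb
      (MeasurableEquiv.neg ℝ).measurableEmbedding g (Iio 0)
    rw [← this]
    simp only [neg_preimage, neg_Iio, neg_zero]
    exact lintegral_congr_ae (ae_restrict_of_ae hg)
  rw [← lintegral_add_compl g (measurableSet_Ioi (a := (0 : ℝ))), compl_Ioi,
    ← setLIntegral_congr (Iio_ae_eq_Iic (μ := volume) (a := (0 : ℝ))), h1, two_mul]

/-- Change of variables applied to the indicator of a null set: the Jacobian has no zero, so the
preimage is null. -/
theorem quasiMeasurePreserving_exp :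
    Measure.QuasiMeasurePreserving (fun t : ℝ => Real.exp (2 * Real.pi * t)) volume volume := by
  have hm : Measurable fun t : ℝ => Real.exp (2 * Real.pi * t) := by fun_prop
  refine ⟨hm, Measure.AbsolutelyContinuous.mk fun s hs h0 => ?_⟩
  rw [Measure.map_apply hm hs]
  have h1 := lintegral_exp_comp (s.indicator 1)
  have h2 : ∫⁻ x in Ioi 0, s.indicator (1 : ℝ → ℝ≥0∞) x = 0 := by
    rw [lintegral_indicator_one hs]
    exact le_antisymm ((Measure.restrict_apply_le _ _).trans h0.le) (zero_le)
  rw [h2, lintegral_eq_zero_iff (by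
    refine Measurable.mul (by fun_prop) ?_
    exact (measurable_one.indicator hs).comp hm)] at h1
  refine measure_mono_null ?_ h1
  intro t ht
  simp only [mem_ofPred_eq, mem_compl_iff, Pi.zero_apply, mul_eq_zero, not_or]
  refine ⟨by simp; positivity, ?_⟩
  rw [indicator_of_mem (by exact ht)]
  simp

/-- `Real.log` depends only on `|x|`, so the integrand is even and the half line counts twice. -/
theorem lintegral_comp_log (g : ℝ → ℝ≥0∞) (w : ℝ → ℝ≥0∞) (hw : ∀ x, w (-x) = w x) :
    ∫⁻ x, w x * g (Real.log x / (2 * Real.pi)) =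
      ∫⁻ t, 2 * (ENNReal.ofReal (2 * Real.pi * Real.exp (2 * Real.pi * t)) *
        (w (Real.exp (2 * Real.pi * t)) * g t)) := by
  have h0 : (2 * Real.pi) ≠ 0 := by positivity
  rw [lintegral_eq_two_mul_of_even (Eventually.of_forall fun x => by rw [Real.log_neg_eq_log, hw]),
    ← lintegral_exp_comp, lintegral_const_mul' _ _ ENNReal.ofNat_ne_top]
  simp only [Real.log_exp, mul_div_cancel_left₀ _ h0]

theorem quasiMeasurePreserving_log :
    Measure.QuasiMeasurePreserving (fun x : ℝ => Real.log x / (2 * Real.pi)) volume volume := by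
  have hm : Measurable fun x : ℝ => Real.log x / (2 * Real.pi) :=
    Real.measurable_log.div_const _
  refine ⟨hm, Measure.AbsolutelyContinuous.mk fun s hs h0 => ?_⟩
  rw [Measure.map_apply hm hs, ← lintegral_indicator_one (hm hs)]
  have h1 := lintegral_comp_log (s.indicator 1) 1 (fun _ => rfl)
  simp only [Pi.one_apply, one_mul] at h1
  have h2 : ∀ x : ℝ, ((fun x : ℝ => Real.log x / (2 * Real.pi)) ⁻¹' s).indicator (1 : ℝ → ℝ≥0∞) x =
    s.indicator 1 (Real.log x / (2 * Real.pi)) := fun x => rfl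
  simp only [h2]
  rw [h1, lintegral_eq_zero_iff (by
    refine Measurable.const_mul (Measurable.mul (by fun_prop) ?_) _
    exact measurable_one.indicator hs)]
  filter_upwards [measure_eq_zero_iff_ae_notMem.1 h0] with t ht
  simp [indicator_of_notMem ht]

/-! ### The unitary `U` -/

/-- The weight squares to `4π exp (2πt)`, twice the Jacobian; the factor 2 accounts for the negative
half line. -/
theorem exists_expComp : ∃ T : L2ev →ₗᵢ[ℂ] Lp ℂ 2 (volume : Measure ℝ), ∀ f, T f =ᵐ[volume]
    fun t : ℝ => ((Real.sqrt (4 * Real.pi) * Real.exp (Real.pi * t) : ℝ) : ℂ) *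
      (f : Lp ℂ 2 (volume : Measure ℝ)) (Real.exp (2 * Real.pi * t)) := by
  refine exists_weightedComp L2ev.subtypeₗᵢ quasiMeasurePreserving_exp (by fun_prop) ?_
  intro f
  change ∫⁻ t : ℝ, _ * ‖(f : Lp ℂ 2 (volume : Measure ℝ)) (Real.exp (2 * Real.pi * t))‖ₑ ^ 2 =
    ∫⁻ x, ‖(f : Lp ℂ 2 (volume : Measure ℝ)) x‖ₑ ^ 2
  have hf : ∀ᵐ x : ℝ, (f : Lp ℂ 2 (volume : Measure ℝ)) (-x) = (f : Lp ℂ 2 (volume : Measure ℝ)) x :=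
    f.2
  rw [lintegral_eq_two_mul_of_even (g := fun x => ‖(f : Lp ℂ 2 (volume : Measure ℝ)) x‖ₑ ^ 2)
    (hf.mono fun x hx => by rw [hx]), ← lintegral_exp_comp,
    ← lintegral_const_mul' _ _ ENNReal.ofNat_ne_top]
  refine lintegral_congr fun t => ?_
  rw [← mul_assoc]
  refine congrArg (· * _) ?_
  have h2 : (2 : ℝ≥0∞) = ENNReal.ofReal 2 := by simp
  rw [Complex.norm_real, Real.norm_of_nonneg (by positivity), mul_pow, Real.sq_sqrt (by positivity),
    ← Real.exp_nat_mul, h2, ← ENNReal.ofReal_mul (by norm_num)]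
  congr 1
  push_cast
  ring_nf

/-- The inverse substitution. It is needed only to produce preimages in `exists_expEquiv`. -/
theorem exists_logComp : ∃ T : Lp ℂ 2 (volume : Measure ℝ) →ₗᵢ[ℂ] Lp ℂ 2 (volume : Measure ℝ),
    ∀ g, T g =ᵐ[volume] fun x : ℝ => (((Real.sqrt (4 * Real.pi * |x|))⁻¹ : ℝ) : ℂ) *
      g (Real.log x / (2 * Real.pi)) := by
  refine exists_weightedComp LinearIsometry.id quasiMeasurePreserving_log
    (by fun_prop) ?_
  intro g
  change ∫⁻ x : ℝ, _ * ‖g (Real.log x / (2 * Real.pi))‖ₑ ^ 2 = ∫⁻ x, ‖g x‖ₑ ^ 2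
  rw [lintegral_comp_log (fun t => ‖g t‖ₑ ^ 2)
    (fun x => ENNReal.ofReal (‖(((Real.sqrt (4 * Real.pi * |x|))⁻¹ : ℝ) : ℂ)‖ ^ 2))
    (fun x => by rw [abs_neg])]
  refine lintegral_congr fun t => ?_
  rw [← mul_assoc, ← mul_assoc]
  refine (congrArg (· * _) ?_).trans (one_mul _)
  rw [Complex.norm_real, Real.norm_of_nonneg (by positivity), inv_pow, Real.sq_sqrt (by positivity),
    ← ENNReal.ofReal_ofNat, ← ENNReal.ofReal_mul (by norm_num), ← ENNReal.ofReal_mul (by positivity),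
    ENNReal.ofReal_eq_one, abs_of_pos (by positivity)]
  field_simp
  norm_num

/-- Exponential substitution as a unitary `L²(ℝ)^ev → L²(ℝ)`. -/
theorem exists_expEquiv : ∃ T : L2ev ≃ₗᵢ[ℂ] Lp ℂ 2 (volume : Measure ℝ), ∀ f, T f =ᵐ[volume]
    fun t : ℝ => ((Real.sqrt (4 * Real.pi) * Real.exp (Real.pi * t) : ℝ) : ℂ) *
      (f : Lp ℂ 2 (volume : Measure ℝ)) (Real.exp (2 * Real.pi * t)) := by
  obtain ⟨T, hT⟩ := exists_expComp
  obtain ⟨S, hS⟩ := exists_logComp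
  refine ⟨LinearIsometryEquiv.ofSurjective T fun g => ?_, hT⟩
  have hev : S g ∈ L2ev := by
    change ∀ᵐ x : ℝ, S g (-x) = S g x
    filter_upwards [hS g, (Measure.measurePreserving_neg
      (volume : Measure ℝ)).quasiMeasurePreserving.ae (hS g)] with x h1 h2
    rw [h1, h2, abs_neg, Real.log_neg_eq_log]
  refine ⟨⟨S g, hev⟩, ?_⟩
  ext1
  filter_upwards [hT ⟨S g, hev⟩, quasiMeasurePreserving_exp.ae (hS g)] with t h1 h2
  have h0 : (2 * Real.pi) ≠ 0 := by positivity
  rw [h1, h2, Real.log_exp, mul_div_cancel_left₀ _ h0, ← mul_assoc, ← Complex.ofReal_mul,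
    abs_of_pos (by positivity), Real.sqrt_mul (by positivity) (Real.exp _)]
  have h3 : Real.sqrt (Real.exp (2 * Real.pi * t)) = Real.exp (Real.pi * t) := by
    rw [Real.sqrt_eq_iff_mul_self_eq (by positivity) (by positivity), ← Real.exp_add]
    ring_nf
  rw [h3, mul_inv_cancel₀ (by positivity)]
  simp

/-- With `v = exp (2πt)` one has `dv/v = 2π dt` and `v^(1/2 - is) = exp (πt) exp (-2πits)`, while
`2π · π^(-1/2) = √(4π)`. The `2π` in the substitution matches the normalization of
`Real.fourierChar`. -/
theorem mellin_integrand_exp (f : ℝ → ℂ) (s t : ℝ) :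
    (Real.pi ^ (-(1 / 2) : ℝ) : ℝ) •
      (|2 * Real.pi * Real.exp (2 * Real.pi * t)| •
        ((Real.exp (2 * Real.pi * t) : ℂ) ^ ((1 / 2 - Complex.I * s : ℂ) - 1) •
          f (Real.exp (2 * Real.pi * t)))) =
    Real.fourierChar (-(inner ℝ t s)) •
      (((Real.sqrt (4 * Real.pi) * Real.exp (Real.pi * t) : ℝ) : ℂ) *
        f (Real.exp (2 * Real.pi * t))) := by
  have hpi := Real.pi_pos
  have h1 : Real.sqrt (4 * Real.pi) = Real.pi ^ (-(1 / 2) : ℝ) * (2 * Real.pi) := by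
    rw [Real.sqrt_mul (by norm_num), show (4 : ℝ) = 2 ^ 2 by norm_num, Real.sqrt_sq (by norm_num),
      Real.sqrt_eq_rpow]
    have : Real.pi ^ (-(1 / 2) : ℝ) * Real.pi = Real.pi ^ (1 / 2 : ℝ) := by
      nth_rewrite 2 [← Real.rpow_one Real.pi]
      rw [← Real.rpow_add hpi]
      norm_num
    rw [← this]; ring
  have h2 : (Real.exp (2 * Real.pi * t) : ℂ) ^ ((1 / 2 - Complex.I * s : ℂ) - 1) =
      Complex.exp (-(Real.pi * t) - 2 * Real.pi * Complex.I * t * s) := by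
    rw [Complex.cpow_def_of_ne_zero (by exact_mod_cast (Real.exp_pos _).ne'),
      ← Complex.ofReal_log (Real.exp_pos _).le, Real.log_exp]
    congr 1
    push_cast
    ring
  have hin : inner ℝ t s = t * s := by simp [mul_comm]
  rw [abs_of_pos (by positivity), Circle.smul_def, Real.fourierChar_apply, h1, h2, hin]
  simp only [Complex.real_smul, smul_eq_mul, ← mul_assoc]
  congr 1
  push_cast
  have h3 : Complex.exp (2 * Real.pi * t) * Complex.exp (-(Real.pi * t) -
      2 * Real.pi * Complex.I * t * s) = Complex.exp (2 * Real.pi * -(t * s) * Complex.I) *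
        Complex.exp (Real.pi * t) := by
    rw [← Complex.exp_add, ← Complex.exp_add]
    congr 1
    ring
  linear_combination ((Real.pi ^ (-(1 / 2) : ℝ) : ℝ) : ℂ) * (2 * Real.pi) * h3

theorem fourier_expComp (f : ℝ → ℂ) (s : ℝ) :
    FourierTransform.fourier (fun t : ℝ =>
      ((Real.sqrt (4 * Real.pi) * Real.exp (Real.pi * t) : ℝ) : ℂ) *
        f (Real.exp (2 * Real.pi * t))) s = mellinU f s := by
  rw [mellinU, mellin, ← range_exp_two_pi, integral_image_eq_integral_abs_deriv_smul
    MeasurableSet.univ (fun t _ => hasDerivWithinAt_exp_two_pi t) injOn_exp_two_pi,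
    Measure.restrict_univ, ← Complex.real_smul, ← integral_smul, Real.fourier_eq]
  simp only [mellin_integrand_exp]

theorem integrable_expComp {f : ℝ → ℂ} (hf : MellinConvergent f (1 / 2)) :
    Integrable (fun t : ℝ => ((Real.sqrt (4 * Real.pi) * Real.exp (Real.pi * t) : ℝ) : ℂ) *
      f (Real.exp (2 * Real.pi * t))) := by
  rw [MellinConvergent, ← range_exp_two_pi, integrableOn_image_iff_integrableOn_abs_deriv_smul
    MeasurableSet.univ (fun t _ => hasDerivWithinAt_exp_two_pi t) injOn_exp_two_pi,
    integrableOn_univ] at hf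
  refine (hf.smul (Real.pi ^ (-(1 / 2) : ℝ) : ℝ)).congr (Eventually.of_forall fun t => ?_)
  -- At `s = 0` the character is trivial, so the identity carries no phase.
  have h := mellin_integrand_exp f 0 t
  simp only [Complex.ofReal_zero, mul_zero, sub_zero, inner_zero_right, neg_zero,
    AddChar.map_zero_eq_one, one_smul] at h
  exact h

/-- Absolute convergence of the Mellin integral is integrability of the substituted function, which
is where the `L²` Fourier transform is given by an integral. -/
theorem exists_isGivenByMellin :
    ∃ U : L2ev ≃ₗᵢ[ℂ] Lp ℂ 2 (volume : Measure ℝ), IsGivenByMellin U := by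
  obtain ⟨T, hT⟩ := exists_expEquiv
  refine ⟨T.trans (Lp.fourierTransformₗᵢ ℝ ℂ), fun f hf => ?_⟩
  have h1 := fourier_Lp_ae_eq (T f) ((integrable_expComp hf).congr (hT f).symm)
  filter_upwards [h1] with s hs
  refine hs.trans ?_
  rw [← fourier_expComp, Real.fourier_eq, Real.fourier_eq]
  refine integral_congr_ae ?_
  filter_upwards [hT f] with x hx
  rw [hx]

/-! ### Hermite functions -/

/-- The function `p(x) exp(-π x²)`. -/
def polyGaussFun (p : Polynomial ℂ) (x : ℝ) : ℂ := p.eval (x : ℂ) * Complex.exp (-Real.pi * x ^ 2)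

theorem hasDerivAt_polyGaussFun (p : Polynomial ℂ) (x : ℝ) :
    HasDerivAt (polyGaussFun p)
      (polyGaussFun (Polynomial.derivative p - Polynomial.C (2 * Real.pi : ℂ) * Polynomial.X * p) x)
      x := by
  have h1 : HasDerivAt (fun x : ℝ => p.eval (x : ℂ)) _ x :=
    (p.hasDerivAt (x : ℂ)).comp_ofReal
  have h2 : HasDerivAt (fun x : ℝ => Complex.exp (-Real.pi * x ^ 2)) _ x :=
    (((hasDerivAt_id x).ofReal_comp.pow 2).const_mul (-Real.pi : ℂ)).cexp
  convert! h1.mul h2 using 1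
  simp [polyGaussFun]
  ring

/-- Stability under differentiation reduces the Schwartz estimates to the decay of the functions
themselves. -/
theorem iteratedDeriv_polyGaussFun (n : ℕ) : ∀ p : Polynomial ℂ,
    ∃ q : Polynomial ℂ, iteratedDeriv n (polyGaussFun p) = polyGaussFun q := by
  induction n with
  | zero => exact fun p => ⟨p, by simp⟩
  | succ n ih =>
    intro p
    obtain ⟨q, hq⟩ := ih
      (Polynomial.derivative p - Polynomial.C (2 * Real.pi : ℂ) * Polynomial.X * p)
    refine ⟨q, ?_⟩
    rw [iteratedDeriv_succ', ← hq]
    congr 1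
    exact funext fun x => (hasDerivAt_polyGaussFun p x).deriv

theorem norm_gauss (x : ℝ) :
    ‖Complex.exp (-Real.pi * x ^ 2)‖ = Real.exp (-Real.pi * x ^ 2) := by
  rw [Complex.norm_exp]
  congr 1
  norm_cast

theorem exists_pow_mul_gauss_le (m : ℕ) :
    ∃ C, ∀ x : ℝ, |x| ^ m * Real.exp (-Real.pi * x ^ 2) ≤ C := by
  -- A single term of the exponential series gives `(πx²)^m ≤ m! exp (πx²)`, and `|x|^m ≤ 1 +
  -- x^(2m)`.
  refine ⟨1 + m.factorial, fun x => ?_⟩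
  have h1 := Real.pow_div_factorial_le_exp (Real.pi * x ^ 2) (by positivity) m
  have hf : (0 : ℝ) < m.factorial := by positivity
  rw [div_le_iff₀ hf] at h1
  have h2 : (x ^ 2) ^ m ≤ (Real.pi * x ^ 2) ^ m := by
    refine pow_le_pow_left₀ (by positivity) ?_ m
    nlinarith [Real.pi_gt_three, sq_nonneg x]
  have h3 : |x| ^ m ≤ 1 + (x ^ 2) ^ m := by
    have : (x ^ 2) ^ m = (|x| ^ m) ^ 2 := by rw [← sq_abs]; ring
    rw [this]
    nlinarith [sq_nonneg (|x| ^ m - 1 / 2)]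
  have h4 : (1 : ℝ) ≤ Real.exp (Real.pi * x ^ 2) := Real.one_le_exp (by positivity)
  have h5 : -Real.pi * x ^ 2 = -(Real.pi * x ^ 2) := by ring
  rw [h5, Real.exp_neg, ← div_eq_mul_inv, div_le_iff₀ (Real.exp_pos _)]
  nlinarith

theorem exists_pow_mul_polyGaussFun_le (q : Polynomial ℂ) (k : ℕ) :
    ∃ C, ∀ x : ℝ, ‖x‖ ^ k * ‖polyGaussFun q x‖ ≤ C := by
  induction q using Polynomial.induction_on' with
  | add p q hp hq =>
    obtain ⟨C, hC⟩ := hp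
    obtain ⟨D, hD⟩ := hq
    refine ⟨C + D, fun x => ?_⟩
    have : polyGaussFun (p + q) x = polyGaussFun p x + polyGaussFun q x := by
      simp [polyGaussFun, add_mul]
    rw [this]
    calc _ ≤ ‖x‖ ^ k * (‖polyGaussFun p x‖ + ‖polyGaussFun q x‖) := by gcongr; exact norm_add_le _ _
      _ ≤ _ := by rw [mul_add]; exact add_le_add (hC x) (hD x)
  | monomial m a =>
    obtain ⟨C, hC⟩ := exists_pow_mul_gauss_le (k + m)
    refine ⟨‖a‖ * C, fun x => ?_⟩
    refine le_trans (le_of_eq ?_) (mul_le_mul_of_nonneg_left (hC x) (norm_nonneg a))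
    simp only [polyGaussFun, Polynomial.eval_monomial, norm_mul, norm_pow, norm_gauss,
      Complex.norm_real, Real.norm_eq_abs]
    ring

/-- The Schwartz function `p(x) exp(-π x²)`. -/
def polyGauss (p : Polynomial ℂ) : 𝓢(ℝ, ℂ) where
  toFun := polyGaussFun p
  smooth' := by
    unfold polyGaussFun
    refine ContDiff.mul ?_ ?_
    · have h : ContDiff ℝ ((⊤ : ℕ∞) : WithTop ℕ∞) fun z : ℂ => Polynomial.aeval z p :=
        (p.contDiff_aeval _).restrict_scalars ℝ
      have h2 := h.comp Complex.ofRealCLM.contDiff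
      simp only [Polynomial.coe_aeval_eq_eval] at h2
      exact h2
    · have : ContDiff ℝ ((⊤ : ℕ∞) : WithTop ℕ∞) fun x : ℝ => (x : ℂ) := Complex.ofRealCLM.contDiff
      fun_prop
  decay' k n := by
    obtain ⟨q, hq⟩ := iteratedDeriv_polyGaussFun n p
    obtain ⟨C, hC⟩ := exists_pow_mul_polyGaussFun_le q k
    refine ⟨C, fun x => ?_⟩
    rw [norm_iteratedFDeriv_eq_norm_iteratedDeriv, hq]
    exact hC x

theorem polyGauss_apply (p : Polynomial ℂ) (x : ℝ) :
    polyGauss p x = p.eval (x : ℂ) * Complex.exp (-Real.pi * x ^ 2) := rfl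

/-! ### Ladder relations and eigenvalues of the Hermite functions -/

theorem derivative_hermite_succ (n : ℕ) : Polynomial.derivative (Polynomial.hermite (n + 1)) =
    (n + 1 : ℕ) * Polynomial.hermite n := by
  induction n with
  | zero => simp
  | succ n ih =>
    rw [Polynomial.hermite_succ, Polynomial.derivative_sub, Polynomial.derivative_mul, ih,
      Polynomial.derivative_X, Polynomial.derivative_natCast_mul, one_mul]
    rw [Polynomial.hermite_succ n]
    push_cast
    ring

/-- The truncated `n - 1` is harmless at `n = 0` because of the factor `n`; the ladder relations
below rely on the same convention. -/
theorem derivative_hermite (n : ℕ) : Polynomial.derivative (Polynomial.hermite n) =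
    n * Polynomial.hermite (n - 1) := by
  cases n with
  | zero => simp
  | succ n => simpa using derivative_hermite_succ n

/-- The unnormalized Hermite function `He_n(2 √π x) exp(-π x²)`. -/
def hermiteGauss (n : ℕ) : 𝓢(ℝ, ℂ) :=
  polyGauss (((Polynomial.hermite n).map (Int.castRingHom ℂ)).comp
    (Polynomial.C ((2 * Real.sqrt Real.pi : ℝ) : ℂ) * Polynomial.X))

theorem hermiteGauss_apply (n : ℕ) (x : ℝ) : hermiteGauss n x =
    ((Polynomial.aeval (2 * Real.sqrt Real.pi * x) (Polynomial.hermite n) *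
      Real.exp (-Real.pi * x ^ 2) : ℝ) : ℂ) := by
  rw [hermiteGauss, polyGauss_apply, Polynomial.eval_comp, Polynomial.eval_map]
  push_cast
  congr 1
  rw [← Complex.coe_algebraMap, ← Polynomial.aeval_algebraMap_apply, Polynomial.aeval_def]
  simp

theorem four_pi_eq : (2 * Real.sqrt Real.pi : ℝ) * (2 * Real.sqrt Real.pi) = 4 * Real.pi := by
  linear_combination 4 * Real.mul_self_sqrt Real.pi_pos.le

/-- The recursion `He_{n+1} = x He_n - He_n'` with `He_n' = n He_{n-1}`, at the argument `2√π x`. -/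
theorem mul_hermiteGauss (n : ℕ) : mulSchwartz (fun x => x) (hermiteGauss n) =
    (((2 * Real.sqrt Real.pi)⁻¹ : ℝ) : ℂ) •
      (hermiteGauss (n + 1) + (n : ℂ) • hermiteGauss (n - 1)) := by
  ext x
  rw [mulSchwartz_apply (by fun_prop), smul_apply, add_apply, smul_apply, hermiteGauss_apply,
    hermiteGauss_apply, hermiteGauss_apply, Polynomial.hermite_succ, derivative_hermite]
  have h0 : (2 * Real.sqrt Real.pi) ≠ 0 := by positivity
  simp only [map_sub, map_mul, Polynomial.aeval_X, map_natCast, smul_eq_mul]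
  norm_cast
  field_simp
  ring

theorem deriv_hermiteGauss (n : ℕ) : derivSchwartz (hermiteGauss n) =
    ((Real.sqrt Real.pi : ℝ) : ℂ) •
      ((n : ℂ) • hermiteGauss (n - 1) - hermiteGauss (n + 1)) := by
  ext x
  have h2 := (((Polynomial.hermite n).hasDerivAt_aeval (2 * Real.sqrt Real.pi * x)).comp x
    ((hasDerivAt_id x).const_mul (2 * Real.sqrt Real.pi))).mul
      (((hasDerivAt_id x).pow 2).const_mul (-Real.pi)).exp
  have h3 : (hermiteGauss n : ℝ → ℂ) = fun x : ℝ => ((Polynomial.aeval (2 * Real.sqrt Real.pi * x)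
      (Polynomial.hermite n) * Real.exp (-Real.pi * x ^ 2) : ℝ) : ℂ) :=
    funext (hermiteGauss_apply n)
  rw [SchwartzMap.derivCLM_apply, h3]
  refine (HasDerivAt.ofReal_comp h2).deriv.trans ?_
  rw [smul_apply, sub_apply, smul_apply, hermiteGauss_apply, hermiteGauss_apply,
    Polynomial.hermite_succ, derivative_hermite]
  simp only [map_sub, map_mul, Polynomial.aeval_X, map_natCast, smul_eq_mul, id]
  norm_cast
  have h4 := four_pi_eq
  simp only [Function.comp, mul_one]
  norm_num
  linear_combination (Polynomial.aeval (2 * Real.sqrt Real.pi * x) (Polynomial.hermite n)) * (x / 2) *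
    Real.exp (-(Real.pi * x ^ 2)) * h4

/-- Applying each ladder relation twice, the terms of index `n - 2` and `n + 2` cancel between `-∂²`
and `(2πq)²`. -/
theorem hermiteOpSchwartz_hermiteGauss (n : ℕ) : hermiteOpSchwartz (hermiteGauss n) =
    ((2 * Real.pi * (2 * n + 1) : ℝ) : ℂ) • hermiteGauss n := by
  have h1 : mulSchwartz (fun q => (2 * Real.pi * q) ^ 2) (hermiteGauss n) =
      ((4 * Real.pi ^ 2 : ℝ) : ℂ) •
        mulSchwartz (fun x => x) (mulSchwartz (fun x => x) (hermiteGauss n)) := by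
    ext x
    rw [mulSchwartz_apply (by fun_prop), smul_apply, mulSchwartz_apply (by fun_prop),
      mulSchwartz_apply (by fun_prop), smul_eq_mul]
    push_cast; ring
  have h2 : (Real.sqrt Real.pi : ℂ) * Real.sqrt Real.pi = Real.pi := by
    exact_mod_cast Real.mul_self_sqrt Real.pi_pos.le
  have h3 : ((4 * Real.pi ^ 2 : ℝ) : ℂ) * ((((2 * Real.sqrt Real.pi)⁻¹ : ℝ) : ℂ) *
      (((2 * Real.sqrt Real.pi)⁻¹ : ℝ) : ℂ)) = Real.pi := by
    have h0 : (Real.sqrt Real.pi : ℂ) ≠ 0 := by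
      exact_mod_cast (Real.sqrt_pos.2 Real.pi_pos).ne'
    push_cast
    rw [← h2]
    field_simp
    norm_num
  have h4 : (((2 * Real.pi * (2 * n + 1) : ℝ)) : ℂ) = 2 * Real.pi * (2 * n + 1) := by push_cast; rfl
  rw [hermiteOpSchwartz_eq, h1, mul_hermiteGauss, deriv_hermiteGauss, h4]
  simp only [map_smul, map_sub, map_add, mul_hermiteGauss, deriv_hermiteGauss]
  generalize (((2 * Real.sqrt Real.pi)⁻¹ : ℝ) : ℂ) = b at h3 ⊢
  generalize ((4 * Real.pi ^ 2 : ℝ) : ℂ) = d at h3 ⊢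
  generalize ((Real.sqrt Real.pi : ℝ) : ℂ) = a at h2 ⊢
  -- `g₀, g₁, g₂` are the values at indices `n - 2, n, n + 2`, with `m = n` and `k = n - 1`. Only
  -- `a² = π` and `d b² = π` enter; in low degree the coefficient `m` or `k` is zero.
  have key (g₀ g₁ g₂ g₃ : ℂ) (m k : ℂ) : -(a * (m * (a * (k * g₀ - g₁)) -
      a * ((m + 1) * g₁ - g₂))) + d * (b * (b * (g₂ + (m + 1) * g₁) +
        m * (b * (g₁ + k * g₀)))) = 2 * Real.pi * (2 * m + 1) * g₁ + g₃ * 0 := by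
    linear_combination (-(m * (k * g₀ - g₁)) + (m + 1) * g₁ - g₂) * h2 +
      (g₂ + (m + 1) * g₁ + m * (g₁ + k * g₀)) * h3
  ext x
  simp only [add_apply, neg_apply, sub_apply, smul_apply, smul_eq_mul]
  cases n with
  | zero =>
    have := key 0 (hermiteGauss 0 x) (hermiteGauss 2 x) 0 0 0
    simpa using this
  | succ n =>
    have := key (hermiteGauss (n - 1) x) (hermiteGauss (n + 1) x) (hermiteGauss (n + 1 + 1 + 1) x)
      0 (n + 1 : ℕ) n
    simpa using this

theorem hermiteGauss_neg (n : ℕ) (x : ℝ) :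
    hermiteGauss n (-x) = (-1) ^ n * hermiteGauss n x := by
  rw [hermiteGauss_apply, hermiteGauss_apply]
  have h := congrArg (Polynomial.aeval (2 * Real.sqrt Real.pi * x)) (hermite_comp_neg n)
  rw [Polynomial.aeval_comp] at h
  simp only [map_neg, Polynomial.aeval_X, map_mul, map_pow, map_one] at h
  rw [mul_neg, h, neg_sq]
  push_cast
  ring

theorem hermiteGauss_even (n : ℕ) (x : ℝ) : hermiteGauss (2 * n) (-x) = hermiteGauss (2 * n) x := by
  rw [hermiteGauss_neg, pow_mul]; simp

/-- The normalization constant of the Hermite functions. -/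
def hermiteConst (n : ℕ) : ℝ := (2 : ℝ) ^ (1 / 4 : ℝ) / Real.sqrt n.factorial

theorem hermiteConst_pos (n : ℕ) : 0 < hermiteConst n := by unfold hermiteConst; positivity

theorem hermiteFun_eq (n : ℕ) (x : ℝ) :
    hermiteFun n x = ((hermiteConst n : ℂ) • hermiteGauss n) x := by
  rw [smul_apply, hermiteGauss_apply, hermiteFun, hermiteConst, smul_eq_mul, ← Complex.ofReal_mul]
  congr 1
  ring

/-- The normalized Hermite functions as Schwartz functions. -/
def hermiteSchwartz (n : ℕ) : 𝓢(ℝ, ℂ) := (hermiteConst n : ℂ) • hermiteGauss n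

theorem coe_hermiteSchwartz (n : ℕ) : (hermiteSchwartz n : ℝ → ℂ) = hermiteFun n :=
  funext fun x => (hermiteFun_eq n x).symm

theorem hermiteSchwartz_even (n : ℕ) (x : ℝ) :
    hermiteSchwartz (2 * n) (-x) = hermiteSchwartz (2 * n) x := by
  rw [coe_hermiteSchwartz]; exact hermiteFun_even n x

theorem hermiteVec_eq (n : ℕ) :
    hermiteVec n = schwartzVec (hermiteSchwartz (2 * n)) (hermiteSchwartz_even n) := by
  unfold hermiteVec schwartzVec
  congr 1
  exact (coe_hermiteSchwartz _).symm

theorem schwartzVec_smul (c : ℂ) (ψ : 𝓢(ℝ, ℂ)) (h : ∀ x, ψ (-x) = ψ x)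
    (h' : ∀ x, (c • ψ) (-x) = (c • ψ) x) : schwartzVec (c • ψ) h' = c • schwartzVec ψ h :=
  Subtype.ext (map_smul (SchwartzMap.toLpCLM ℂ ℂ 2 (volume : Measure ℝ)) c ψ)

theorem inner_smul_left_L2ev (c : ℂ) (f g : L2ev) : ⟪c • f, g⟫ = (starRingEnd ℂ) c * ⟪f, g⟫ :=
  inner_smul_left f g c

theorem inner_smul_right_L2ev (c : ℂ) (f g : L2ev) : ⟪f, c • g⟫ = c * ⟪f, g⟫ :=
  inner_smul_right f g c

theorem hermiteOpSchwartz_hermiteSchwartz (n : ℕ) : hermiteOpSchwartz (hermiteSchwartz n) =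
    ((2 * Real.pi * (2 * n + 1) : ℝ) : ℂ) • hermiteSchwartz n := by
  rw [hermiteSchwartz, map_smul, hermiteOpSchwartz_hermiteGauss, smul_comm]

theorem schwartzVec_hermiteOpSchwartz_hermiteSchwartz (n : ℕ) :
    schwartzVec (hermiteOpSchwartz (hermiteSchwartz (2 * n)))
      (hermiteOpSchwartz_even (hermiteSchwartz_even n)) =
        ((2 * Real.pi * (4 * n + 1) : ℝ) : ℂ) • hermiteVec n := by
  rw [hermiteVec_eq, ← schwartzVec_smul _ _ _ (by
    intro x; simp [hermiteSchwartz_even])]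
  congr 1
  rw [hermiteOpSchwartz_hermiteSchwartz]
  congr 2
  push_cast; ring

/-! ### Orthonormality of the even Hermite functions -/

/-- The weak equation tested on an eigenfunction. It applies to every `f` in the maximal domain. -/
theorem hermite_eigen (n : ℕ) (f g : L2ev) (h : (f, g) ∈ hermiteOp.graph) :
    ⟪hermiteVec n, g⟫ = ((2 * Real.pi * (4 * n + 1) : ℝ) : ℂ) * ⟪hermiteVec n, f⟫ := by
  have h1 := (mem_hermiteOp_graph_iff f g).1 h (hermiteSchwartz (2 * n)) (hermiteSchwartz_even n)
  rw [hermiteVec_eq, h1, schwartzVec_hermiteOpSchwartz_hermiteSchwartz, inner_smul_left_L2ev,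
    Complex.conj_ofReal, hermiteVec_eq]

theorem hermiteVec_mem_graph (n : ℕ) :
    (hermiteVec n, ((2 * Real.pi * (4 * n + 1) : ℝ) : ℂ) • hermiteVec n) ∈ hermiteOp.graph := by
  have h := schwartz_mem_hermiteOp_graph (hermiteSchwartz (2 * n)) (hermiteSchwartz_even n)
  rwa [schwartzVec_hermiteOpSchwartz_hermiteSchwartz, ← hermiteVec_eq] at h

/-- Eigenvectors of a formally symmetric operator for distinct real eigenvalues. -/
theorem inner_hermiteVec_of_ne {m n : ℕ} (hmn : m ≠ n) : ⟪hermiteVec m, hermiteVec n⟫ = 0 := by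
  have h := hermite_eigen m _ _ (hermiteVec_mem_graph n)
  rw [inner_smul_right_L2ev, ← sub_eq_zero, ← sub_mul, mul_eq_zero] at h
  refine h.resolve_left fun h0 => hmn ?_
  rw [sub_eq_zero, Complex.ofReal_inj] at h0
  have h1 := mul_left_cancel₀ (by positivity) h0
  have h2 : (n : ℝ) = m := by linarith
  exact_mod_cast h2.symm

/-- Induction on `n`: the derivative of `H_{n+1} H_n` has integral zero, and it equals `2√π ((n+1)
H_n² - H_{n+1}²)`. -/
theorem integral_hermiteGauss_sq (n : ℕ) :
    ∫ x, hermiteGauss n x * hermiteGauss n x = (n.factorial : ℂ) * ((Real.sqrt 2)⁻¹ : ℝ) := by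
  induction n with
  | zero =>
    have h1 (x : ℝ) : hermiteGauss 0 x * hermiteGauss 0 x =
        ((Real.exp (-(2 * Real.pi) * x ^ 2) : ℝ) : ℂ) := by
      rw [hermiteGauss_apply, ← Complex.ofReal_mul]
      congr 1
      simp only [Polynomial.hermite_zero, map_one, one_mul, ← Real.exp_add]
      ring_nf
    simp only [h1]
    rw [integral_complex_ofReal, integral_gaussian]
    norm_num
    rw [show Real.pi / (2 * Real.pi) = 2⁻¹ by field_simp, Real.sqrt_inv, Complex.ofReal_inv]
  | succ n ih =>
    have hb : (((2 * Real.sqrt Real.pi)⁻¹ : ℝ) : ℂ) ≠ 0 := by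
      exact_mod_cast (by positivity : (0:ℝ) < (2 * Real.sqrt Real.pi)⁻¹).ne'
    have hc : ((Real.sqrt Real.pi : ℝ) : ℂ) * (((2 * Real.sqrt Real.pi)⁻¹ : ℝ) : ℂ) = 1 / 2 := by
      have h0 : (Real.sqrt Real.pi : ℂ) ≠ 0 := by
        exact_mod_cast (Real.sqrt_pos.2 Real.pi_pos).ne'
      push_cast
      field_simp
    have hx (n : ℕ) (x : ℝ) : (x : ℂ) * hermiteGauss n x = (((2 * Real.sqrt Real.pi)⁻¹ : ℝ) : ℂ) *
        (hermiteGauss (n + 1) x + n * hermiteGauss (n - 1) x) := by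
      have := congrArg (fun φ : 𝓢(ℝ, ℂ) => φ x) (mul_hermiteGauss n)
      simpa only [mulSchwartz_apply (show (fun x : ℝ => x).HasTemperateGrowth by fun_prop),
        smul_apply, add_apply, smul_eq_mul] using this
    have hd (n : ℕ) (x : ℝ) : deriv (hermiteGauss n) x = ((Real.sqrt Real.pi : ℝ) : ℂ) *
        (n * hermiteGauss (n - 1) x - hermiteGauss (n + 1) x) := by
      have := congrArg (fun φ : 𝓢(ℝ, ℂ) => φ x) (deriv_hermiteGauss n)
      simpa only [SchwartzMap.derivCLM_apply, smul_apply, sub_apply, smul_eq_mul] using this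
    have h1 := SchwartzMap.integral_mul_deriv_eq_neg_deriv_mul (hermiteGauss (n + 1))
      (hermiteGauss n)
    have hi1 : Integrable fun x => hermiteGauss (n + 1) x * deriv (hermiteGauss n) x :=
      (SchwartzMap.pairing (ContinuousLinearMap.mul ℂ ℂ) (hermiteGauss (n + 1))
        (derivSchwartz (hermiteGauss n))).integrable
    have hi2 : Integrable fun x => deriv (hermiteGauss (n + 1)) x * hermiteGauss n x :=
      (SchwartzMap.pairing (ContinuousLinearMap.mul ℂ ℂ) (derivSchwartz (hermiteGauss (n + 1)))
        (hermiteGauss n)).integrable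
    have hi3 : Integrable fun x => hermiteGauss (n + 1) x * hermiteGauss (n + 1) x :=
      (SchwartzMap.pairing (ContinuousLinearMap.mul ℂ ℂ) (hermiteGauss (n + 1))
        (hermiteGauss (n + 1))).integrable
    have hi4 : Integrable fun x => hermiteGauss n x * hermiteGauss n x :=
      (SchwartzMap.pairing (ContinuousLinearMap.mul ℂ ℂ) (hermiteGauss n)
        (hermiteGauss n)).integrable
    have h2 : ∫ x, (hermiteGauss (n + 1) x * deriv (hermiteGauss n) x +
        deriv (hermiteGauss (n + 1)) x * hermiteGauss n x) = 0 := by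
      rw [integral_add hi1 hi2, h1, neg_add_cancel]
    have h3 (x : ℝ) : hermiteGauss (n + 1) x * deriv (hermiteGauss n) x +
        deriv (hermiteGauss (n + 1)) x * hermiteGauss n x = (2 * (Real.sqrt Real.pi : ℝ) : ℂ) *
          (((n + 1 : ℕ) : ℂ) * (hermiteGauss n x * hermiteGauss n x) -
            hermiteGauss (n + 1) x * hermiteGauss (n + 1) x) := by
      have e1 := hx n x
      have e2 := hx (n + 1) x
      -- Two ladder expansions of `x H_n H_{n+1}`, compared in order to eliminate `H_{n-1}` and
      -- `H_{n+2}`.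
      have e3 : (hermiteGauss (n + 1) x + n * hermiteGauss (n - 1) x) * hermiteGauss (n + 1) x =
          (hermiteGauss (n + 1 + 1) x + (n + 1 : ℕ) * hermiteGauss (n + 1 - 1) x) *
            hermiteGauss n x := by
        refine mul_left_cancel₀ hb ?_
        linear_combination hermiteGauss n x * e2 - hermiteGauss (n + 1) x * e1
      rw [hd, hd]
      simp only [Nat.add_sub_cancel] at e3 ⊢
      linear_combination ((Real.sqrt Real.pi : ℝ) : ℂ) * e3
    simp only [h3] at h2
    rw [integral_const_mul, integral_sub (hi4.const_mul _) hi3, integral_const_mul, ih,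
      mul_eq_zero, sub_eq_zero] at h2
    have h4 := h2.resolve_left (by
      exact_mod_cast (by positivity : (0:ℝ) < 2 * Real.sqrt Real.pi).ne')
    rw [← h4, Nat.factorial_succ]
    push_cast; ring

theorem inner_hermiteVec_self (n : ℕ) : ⟪hermiteVec n, hermiteVec n⟫ = 1 := by
  nth_rewrite 1 [hermiteVec_eq]
  rw [inner_schwartzVec, toDist_apply]
  have h1 : ∀ᵐ x : ℝ, schwartzConj (hermiteSchwartz (2 * n)) x *
      (hermiteVec n : Lp ℂ 2 (volume : Measure ℝ)) x =
        (hermiteConst (2 * n) : ℂ) ^ 2 * (hermiteGauss (2 * n) x * hermiteGauss (2 * n) x) := by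
    filter_upwards [coeFn_toL2ev _ (memLp_hermiteFun (2 * n)) (hermiteFun_even n)] with x hx
    have hx' : (hermiteVec n : Lp ℂ 2 (volume : Measure ℝ)) x = hermiteFun (2 * n) x := hx
    rw [hx', schwartzConj_apply, coe_hermiteSchwartz, hermiteFun_eq, smul_apply, smul_eq_mul,
      hermiteGauss_apply]
    simp only [map_mul, Complex.conj_ofReal]
    ring
  rw [integral_congr_ae h1, integral_const_mul, integral_hermiteGauss_sq]
  have h2 : hermiteConst (2 * n) ^ 2 * ((2 * n).factorial * (Real.sqrt 2)⁻¹) = 1 := by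
    have h3 : ((2 : ℝ) ^ (1 / 4 : ℝ)) ^ 2 = Real.sqrt 2 := by
      rw [← Real.rpow_natCast, ← Real.rpow_mul (by norm_num), Real.sqrt_eq_rpow]
      norm_num
    rw [hermiteConst, div_pow, h3, Real.sq_sqrt (by positivity)]
    field_simp
  exact_mod_cast h2

theorem orthonormal_hermiteVec : Orthonormal ℂ hermiteVec := by
  classical
  rw [orthonormal_iff_ite]
  intro m n
  split_ifs with h
  · rw [h, inner_hermiteVec_self]
  · exact inner_hermiteVec_of_ne h

/-! ### Completeness of the even Hermite functions -/

theorem mulSchwartz_pow_apply (k : ℕ) (φ : 𝓢(ℝ, ℂ)) (x : ℝ) :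
    (mulSchwartz (fun x => x) ^ k) φ x = (x : ℂ) ^ k * φ x := by
  induction k with
  | zero => simp
  | succ k ih =>
    rw [pow_succ', mul_apply_eq_comp, mulSchwartz_apply (by fun_prop), ih, pow_succ']
    ring

/-- Termwise integration of the exponential series, dominated by `exp (‖c‖ |x|) ‖G x‖`. -/
theorem integral_exp_mul_eq_zero_of_moments {G : ℝ → ℂ} (hG : AEStronglyMeasurable G)
    (hexp : ∀ c : ℝ, Integrable fun x => Real.exp (c * |x|) * ‖G x‖)
    (h : ∀ k : ℕ, ∫ x : ℝ, (x : ℂ) ^ k * G x = 0) (c : ℂ) :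
    ∫ x : ℝ, Complex.exp (c * x) * G x = 0 := by
  have h1 : HasSum (fun k : ℕ => ∫ x : ℝ, (c * x) ^ k / k.factorial * G x)
      (∫ x : ℝ, Complex.exp (c * x) * G x) := by
    refine hasSum_integral_of_dominated_convergence
      (fun k x => (‖c‖ * |x|) ^ k / k.factorial * ‖G x‖) (fun k => ?_) (fun k => ?_) ?_ ?_ ?_
    · exact (Continuous.aestronglyMeasurable (by fun_prop)).mul hG
    · refine Eventually.of_forall fun x => le_of_eq ?_
      simp
    · exact Eventually.of_forall fun x =>
        (Real.summable_pow_div_factorial (‖c‖ * |x|)).mul_right _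
    · refine (hexp ‖c‖).congr (Eventually.of_forall fun x => ?_)
      simp only
      rw [tsum_mul_right, Real.exp_eq_exp_ℝ, NormedSpace.exp_eq_tsum_div]
    · refine Eventually.of_forall fun x => HasSum.mul_right _ ?_
      rw [Complex.exp_eq_exp_ℂ]
      exact NormedSpace.expSeries_div_hasSum_exp _
  have h2 (k : ℕ) : ∫ x : ℝ, (c * x) ^ k / k.factorial * G x = 0 := by
    have : ∀ x : ℝ, (c * x) ^ k / k.factorial * G x =
        (c ^ k / k.factorial) * ((x : ℂ) ^ k * G x) := fun x => by rw [mul_pow]; ring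
    simp only [this]
    rw [integral_const_mul, h, mul_zero]
  simp only [h2] at h1
  exact h1.unique hasSum_zero

theorem memLp_exp_mul_gauss (c : ℝ) :
    MemLp (fun x : ℝ => Real.exp (c * |x|) * Real.exp (-Real.pi * x ^ 2)) 2 := by
  rw [memLp_two_iff_integrable_sq (by fun_prop)]
  refine Integrable.mono' ((integrable_exp_neg_mul_sq Real.pi_pos).const_mul
    (Real.exp (c ^ 2))) (by fun_prop) (Eventually.of_forall fun x => ?_)
  rw [Real.norm_of_nonneg (by positivity), ← Real.exp_add, ← Real.exp_nat_mul, ← Real.exp_add]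
  -- `2c|x| ≤ c² + x²` and `π ≥ 1` bound the exponent `2c|x| - 2πx²` by `c² - πx²`.
  refine Real.exp_le_exp.2 ?_
  have h1 : |x| ^ 2 = x ^ 2 := sq_abs x
  push_cast
  nlinarith [sq_nonneg (c - |x|), Real.pi_gt_three, sq_nonneg x]

/-- Odd Hermite functions pair to zero with `f` by parity. Multiplication by `x` preserves the span
of all Hermite functions, so every moment of `exp (-πx²) f` vanishes. Its Fourier transform is then
zero, hence so is the product, and the Gaussian has no zero. -/
theorem eq_zero_of_inner_hermiteVec (f : L2ev) (h : ∀ n, ⟪hermiteVec n, f⟫ = 0) : f = 0 := by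
  have h1 (n : ℕ) : toDist f (hermiteGauss n) = 0 := by
    rcases Nat.even_or_odd' n with ⟨m, rfl | rfl⟩
    · have h2 := h m
      rw [hermiteVec_eq, inner_schwartzVec] at h2
      have h3 : schwartzConj (hermiteSchwartz (2 * m)) =
          (hermiteConst (2 * m) : ℂ) • hermiteGauss (2 * m) := by
        ext x
        rw [schwartzConj_apply, hermiteSchwartz, smul_apply, hermiteGauss_apply]
        simp only [smul_eq_mul, map_mul, Complex.conj_ofReal]
      rw [h3, map_smul, smul_eq_mul, mul_eq_zero] at h2
      exact h2.resolve_left (by exact_mod_cast (hermiteConst_pos _).ne')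
    · have h2 : schwartzReflect (hermiteGauss (2 * m + 1)) = -hermiteGauss (2 * m + 1) := by
        ext x
        rw [schwartzReflect_apply, hermiteGauss_neg, neg_apply, pow_succ, pow_mul]
        simp
      have h3 := toDist_schwartzReflect f (hermiteGauss (2 * m + 1))
      rw [h2, map_neg] at h3
      exact self_eq_neg.1 h3.symm
  have h2 (k : ℕ) : ∀ n : ℕ, toDist f ((mulSchwartz (fun x => x) ^ k) (hermiteGauss n)) = 0 := by
    induction k with
    | zero => intro n; simpa using h1 n
    | succ k ih =>
      intro n
      rw [pow_succ, mul_apply_eq_comp, mul_hermiteGauss]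
      simp only [map_smul, map_add, ih, smul_zero, add_zero]
  have h3 (k : ℕ) : ∫ x : ℝ, (x : ℂ) ^ k *
      (Complex.exp (-Real.pi * x ^ 2) * (f : Lp ℂ 2 (volume : Measure ℝ)) x) = 0 := by
    have := h2 k 0
    rw [toDist_apply] at this
    rw [← this]
    refine integral_congr_ae (Eventually.of_forall fun x => ?_)
    simp only [mulSchwartz_pow_apply, hermiteGauss_apply]
    simp [mul_assoc]
  set G : ℝ → ℂ := fun x => Complex.exp (-Real.pi * x ^ 2) *
    (f : Lp ℂ 2 (volume : Measure ℝ)) x with hGdef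
  have hf := Lp.memLp (f : Lp ℂ 2 (volume : Measure ℝ))
  have hGm : AEStronglyMeasurable G := by
    exact (Continuous.aestronglyMeasurable (by fun_prop)).mul hf.1
  have hexp (c : ℝ) : Integrable fun x => Real.exp (c * |x|) * ‖G x‖ := by
    refine ((memLp_exp_mul_gauss c).integrable_mul hf.norm).congr (Eventually.of_forall fun x => ?_)
    simp only [hGdef, Pi.mul_apply, norm_mul, norm_gauss]
    ring
  have hG1 : Integrable G := by
    rw [← integrable_norm_iff hGm]
    simpa using hexp 0
  have hG2 : MemLp G 2 := by
    refine hf.mono hGm (Eventually.of_forall fun x => ?_)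
    rw [hGdef, norm_mul, norm_gauss]
    refine mul_le_of_le_one_left (norm_nonneg _) (Real.exp_le_one_iff.2 ?_)
    nlinarith [Real.pi_pos, sq_nonneg x, mul_nonneg Real.pi_pos.le (sq_nonneg x)]
  have h4 : G =ᵐ[volume] 0 := by
    refine ae_eq_zero_of_fourier_eq_zero hG1 hG2 fun ξ => ?_
    rw [Real.fourier_eq', ← integral_exp_mul_eq_zero_of_moments hGm hexp h3
      (-2 * Real.pi * Complex.I * ξ)]
    refine integral_congr_ae (Eventually.of_forall fun x => ?_)
    simp only [smul_eq_mul]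
    congr 2
    simp
    ring
  refine Subtype.ext ((Lp.eq_zero_iff_ae_eq_zero (f := (f : Lp ℂ 2 (volume : Measure ℝ)))).2 ?_)
  filter_upwards [h4] with x hx
  exact (mul_eq_zero.1 hx).resolve_left (Complex.exp_ne_zero _)

theorem hermiteVec_span_orthogonal : (Submodule.span ℂ (Set.range hermiteVec))ᗮ = ⊥ := by
  rw [Submodule.eq_bot_iff]
  intro f hf
  refine eq_zero_of_inner_hermiteVec f fun n => ?_
  exact (Submodule.mem_orthogonal _ _).1 hf _ (Submodule.subset_span ⟨n, rfl⟩)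

/-- Completeness is transported from `L²(ℝ)` along the exponential substitution. -/
instance : CompleteSpace L2ev := by
  obtain ⟨T, -⟩ := exists_expEquiv
  exact T.toIsometryEquiv.completeSpace

/-- The even Hermite functions as a Hilbert basis of `L²(ℝ)^ev`. -/
def hermiteBasis : HilbertBasis ℕ ℂ L2ev :=
  HilbertBasis.mkOfOrthogonalEqBot orthonormal_hermiteVec hermiteVec_span_orthogonal

theorem coe_hermiteBasis : (hermiteBasis : ℕ → L2ev) = hermiteVec :=
  HilbertBasis.coe_mkOfOrthogonalEqBot _ _

/-- The spectral description of the Hermite operator. -/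
theorem mem_hermiteOp_graph_iff_inner (f g : L2ev) : (f, g) ∈ hermiteOp.graph ↔
    ∀ n, ⟪hermiteVec n, g⟫ = ((2 * Real.pi * (4 * n + 1) : ℝ) : ℂ) * ⟪hermiteVec n, f⟫ := by
  refine ⟨fun h n => hermite_eigen n f g h, fun h => ?_⟩
  rw [mem_hermiteOp_graph_iff]
  intro ψ hψ
  rw [← HilbertBasis.tsum_inner_mul_inner hermiteBasis,
    ← HilbertBasis.tsum_inner_mul_inner hermiteBasis]
  refine tsum_congr fun n => ?_
  -- The Schwartz test function is itself in the domain, so its coefficients satisfy the same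
  -- relation; the eigenvalues being real, the two Parseval sums agree term by term.
  have h1 := hermite_eigen n _ _ (schwartz_mem_hermiteOp_graph ψ hψ)
  rw [coe_hermiteBasis, h n, ← inner_conj_symm (schwartzVec (hermiteOpSchwartz ψ) _), h1, map_mul,
    Complex.conj_ofReal]
  have h2 : (starRingEnd ℂ) ⟪hermiteVec n, schwartzVec ψ hψ⟫ = ⟪schwartzVec ψ hψ, hermiteVec n⟫ :=
    inner_conj_symm _ _
  rw [h2]
  ring

/-! ### Mellin transforms of Schwartz functions -/

theorem mellinConvergent_schwartz (ψ : 𝓢(ℝ, ℂ)) {z : ℂ} (hz : 0 < z.re) :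
    MellinConvergent ψ z := by
  refine mellinConvergent_of_isBigO_rpow (a := z.re + 1) (b := 0)
    (ψ.continuous.locallyIntegrable.locallyIntegrableOn _) ?_ (by linarith) ?_ hz
  · have h := (ψ.isBigO_cocompact_rpow (-(z.re + 1))).mono atTop_le_cocompact
    refine h.trans (Asymptotics.IsBigO.of_bound 1 ?_)
    filter_upwards [eventually_gt_atTop (0 : ℝ)] with x hx
    rw [Real.norm_of_nonneg hx.le, one_mul]
  · simp only [neg_zero, Real.rpow_zero]
    exact (ψ.continuous.tendsto 0).mono_left nhdsWithin_le_nhds |>.isBigO_one ℝ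

theorem mellin_congr_ae {f g : ℝ → ℂ} (h : f =ᵐ[volume] g) (z : ℂ) : mellin f z = mellin g z := by
  refine integral_congr_ae ?_
  filter_upwards [ae_restrict_of_ae h] with x hx
  rw [hx]

theorem MellinConvergent.congr_ae {f g : ℝ → ℂ} {z : ℂ} (hf : MellinConvergent f z)
    (h : f =ᵐ[volume] g) : MellinConvergent g z := by
  refine Integrable.congr hf ?_
  filter_upwards [ae_restrict_of_ae h] with x hx
  rw [hx]

theorem line_re (s : ℝ) : (1 / 2 - Complex.I * s : ℂ).re = 1 / 2 := by simp

theorem unitary_schwartzVec {U : L2ev ≃ₗᵢ[ℂ] Lp ℂ 2 (volume : Measure ℝ)} (hU : IsGivenByMellin U)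
    (ψ : 𝓢(ℝ, ℂ)) (h : ∀ x, ψ (-x) = ψ x) :
    U (schwartzVec ψ h) =ᵐ[volume] mellinU ψ := by
  have h1 := coeFn_schwartzVec ψ h
  have h2 := hU (schwartzVec ψ h)
    (MellinConvergent.congr_ae (mellinConvergent_schwartz ψ (by norm_num)) h1.symm)
  filter_upwards [h2] with s hs
  rw [hs, mellinU, mellinU, mellin_congr_ae h1]

/-- Integration by parts on the half line. The boundary term vanishes at `0` because `Re z > 0`, and
at infinity by rapid decay. -/
theorem mellin_mul_deriv_schwartz (ψ : 𝓢(ℝ, ℂ)) {z : ℂ} (hz : 0 < z.re) :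
    mellin (fun x : ℝ => (x : ℂ) * deriv ψ x) z = -z * mellin ψ z := by
  have hz0 : z ≠ 0 := by rintro rfl; simp at hz
  have hc1 : MellinConvergent (derivSchwartz ψ) (z + 1) :=
    mellinConvergent_schwartz _ (by simp; linarith)
  have hc2 := mellinConvergent_schwartz ψ hz
  have key := integral_Ioi_mul_deriv_eq_deriv_mul (a := 0) (a' := 0) (b' := 0)
    (u := fun x : ℝ => (x : ℂ) ^ z) (u' := fun x : ℝ => z * (x : ℂ) ^ (z - 1)) (v := ψ)
    (v' := deriv ψ) (fun x hx => by
      simpa using (((hasDerivAt_id (x : ℂ)).cpow_const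
        (Complex.ofReal_mem_slitPlane.2 hx)).comp_ofReal : HasDerivAt _ _ x))
    (fun x _ => ψ.hasDerivAt x) ?_ ?_ ?_ ?_
  · have h1 : mellin (fun x : ℝ => (x : ℂ) * deriv ψ x) z =
        ∫ x in Ioi (0 : ℝ), (x : ℂ) ^ z * deriv ψ x := by
      refine setIntegral_congr_fun measurableSet_Ioi fun x hx => ?_
      have hx0 : (x : ℂ) ≠ 0 := Complex.ofReal_ne_zero.2 (ne_of_gt hx)
      simp only [smul_eq_mul]
      rw [Complex.cpow_sub _ _ hx0, Complex.cpow_one]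
      field_simp
    rw [h1, key, mellin]
    simp only [mul_assoc, smul_eq_mul]
    rw [integral_const_mul]
    ring
  · refine Integrable.congr hc1 (Eventually.of_forall fun x => ?_)
    simp [SchwartzMap.derivCLM_apply]
  · refine Integrable.congr (hc2.const_mul z) (Eventually.of_forall fun x => ?_)
    simp [mul_assoc]
  · have h1 : Tendsto (fun x : ℝ => (x : ℂ) ^ z) (𝓝 0) (𝓝 0) := by
      have := (Complex.continuousAt_ofReal_cpow_const 0 z (Or.inl hz)).tendsto
      rwa [Complex.ofReal_zero, Complex.zero_cpow hz0] at this
    have h2 := (h1.mul (ψ.continuous.tendsto 0)).mono_left (nhdsWithin_le_nhds (s := Ioi 0))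
    rwa [zero_mul] at h2
  · have h := (ψ.isBigO_cocompact_rpow (-(z.re + 1))).mono atTop_le_cocompact
    have h2 : (fun x : ℝ => (x : ℂ) ^ z) =O[atTop] fun x => x ^ z.re := by
      refine Asymptotics.IsBigO.of_bound 1 ?_
      filter_upwards [eventually_gt_atTop (0 : ℝ)] with x hx
      rw [Complex.norm_cpow_eq_rpow_re_of_pos hx, one_mul]
      exact Real.le_norm_self _
    refine (h2.mul h).trans_tendsto (tendsto_inv_atTop_zero.congr' ?_)
    filter_upwards [eventually_gt_atTop (0 : ℝ)] with x hx
    rw [Real.norm_of_nonneg hx.le, ← Real.rpow_add hx, ← Real.rpow_neg_one]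
    congr 1
    ring

/-- At `z = 1/2 - is` one has `-z + 1/2 = is`: the constant `1/2` of the operator cancels the
abscissa of the line. -/
theorem mellinU_eulerSchwartz (ψ : 𝓢(ℝ, ℂ)) (s : ℝ) :
    mellinU (eulerSchwartz ψ) s = Complex.I * s * mellinU ψ s := by
  have hz : 0 < (1 / 2 - Complex.I * s : ℂ).re := by rw [line_re]; norm_num
  have h1 : (eulerSchwartz ψ : ℝ → ℂ) = fun x : ℝ => (x : ℂ) * deriv ψ x + (1 / 2 : ℂ) • ψ x := by
    ext x
    rw [eulerSchwartz_eq, add_apply, mulSchwartz_apply (by fun_prop)]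
    rfl
  have h2 : MellinConvergent (fun x : ℝ => (x : ℂ) * deriv ψ x) (1 / 2 - Complex.I * s) := by
    refine MellinConvergent.congr_ae
      (mellinConvergent_schwartz (mulSchwartz (fun x => x) (derivSchwartz ψ)) hz)
      (Eventually.of_forall fun x => ?_)
    rw [mulSchwartz_apply (by fun_prop)]
    rfl
  have h3 := mellinConvergent_schwartz ψ hz
  rw [mellinU, mellinU, h1, (hasMellin_add h2 (h3.const_smul (1 / 2 : ℂ))).2,
    mellin_const_smul, mellin_mul_deriv_schwartz ψ hz, smul_eq_mul]
  ring

theorem mellinU_add (φ ψ : 𝓢(ℝ, ℂ)) (s : ℝ) :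
    mellinU (φ + ψ : 𝓢(ℝ, ℂ)) s = mellinU φ s + mellinU ψ s := by
  have hz : 0 < (1 / 2 - Complex.I * s : ℂ).re := by rw [line_re]; norm_num
  rw [mellinU, mellinU, mellinU, ← mul_add]
  congr 1
  exact (hasMellin_add (mellinConvergent_schwartz φ hz) (mellinConvergent_schwartz ψ hz)).2

theorem mellinU_smul (c : ℂ) (ψ : 𝓢(ℝ, ℂ)) (s : ℝ) :
    mellinU (c • ψ : 𝓢(ℝ, ℂ)) s = c * mellinU ψ s := by
  rw [mellinU, mellinU, mul_left_comm]
  congr 1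
  exact mellin_const_smul ψ _ c

theorem mellinU_eulerSqSchwartz (ψ : 𝓢(ℝ, ℂ)) (s : ℝ) :
    mellinU (eulerSqSchwartz ψ) s = -((s : ℂ) ^ 2 + 1 / 4) * mellinU ψ s := by
  rw [eulerSqSchwartz_eq_sq, sub_eq_add_neg, ← neg_smul, mellinU_add, mellinU_smul,
    mellinU_eulerSchwartz, mellinU_eulerSchwartz]
  linear_combination (s : ℂ) ^ 2 * mellinU ψ s * Complex.I_sq

/-! ### Mellin transforms of Hermite functions -/

theorem mellin_gauss {z : ℂ} (hz : 0 < z.re) :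
    mellin (fun x : ℝ => Complex.exp (-Real.pi * x ^ 2)) z = 1 / 2 * Complex.Gammaℝ z := by
  have h1 : (fun x : ℝ => Complex.exp (-Real.pi * x ^ 2)) =
      fun x : ℝ => (fun u : ℝ => (fun v : ℝ => ((Real.exp (-v) : ℝ) : ℂ)) (Real.pi * u))
        (x ^ (2 : ℝ)) := by
    ext x
    simp
  rw [h1, mellin_comp_rpow (fun u : ℝ => (fun v : ℝ => ((Real.exp (-v) : ℝ) : ℂ)) (Real.pi * u)),
    mellin_comp_mul_left (fun v : ℝ => ((Real.exp (-v) : ℝ) : ℂ)) _ Real.pi_pos,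
    ← Complex.GammaIntegral_eq_mellin, Complex.Gammaℝ_def, Complex.Gamma_eq_integral (by simpa)]
  simp [neg_div]

/-- The factor `x^(2k)` shifts `z` by `2k`, and each step of length two contributes `(j + z/2)/π`
through the functional equation of `Complex.Gammaℝ`. -/
theorem mellin_pow_mul_gauss (k : ℕ) {z : ℂ} (hz : 0 < z.re) :
    mellin (fun x : ℝ => (x : ℂ) ^ (2 * k) * Complex.exp (-Real.pi * x ^ 2)) z =
      ((Real.pi : ℂ) ^ k)⁻¹ * (∏ j ∈ Finset.range k, ((j : ℂ) + z / 2)) *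
        mellin (fun x : ℝ => Complex.exp (-Real.pi * x ^ 2)) z := by
  have hpi : (Real.pi : ℂ) ≠ 0 := Complex.ofReal_ne_zero.2 Real.pi_ne_zero
  have h1 (k : ℕ) : mellin (fun x : ℝ => (x : ℂ) ^ (2 * k) * Complex.exp (-Real.pi * x ^ 2)) z =
      1 / 2 * Complex.Gammaℝ (z + (2 * k : ℕ)) := by
    rw [← mellin_gauss (by simp; positivity), ← mellin_cpow_smul]
    simp only [Complex.cpow_natCast, smul_eq_mul]
  rw [h1, mellin_gauss hz]
  induction k with
  | zero => simp
  | succ k ih =>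
    have h2 : z + ((2 * (k + 1) : ℕ) : ℂ) = z + ((2 * k : ℕ) : ℂ) + 2 := by push_cast; ring
    have h3 : z + ((2 * k : ℕ) : ℂ) ≠ 0 := by
      intro h
      have h4 := congrArg Complex.re h
      simp at h4
      have : (0 : ℝ) ≤ 2 * k := by positivity
      linarith
    rw [h2, Complex.Gammaℝ_add_two h3, Finset.prod_range_succ, pow_succ]
    have h5 : 1 / 2 * (Complex.Gammaℝ (z + ((2 * k : ℕ) : ℂ)) * (z + ((2 * k : ℕ) : ℂ)) / 2 /
        Real.pi) = (1 / 2 * Complex.Gammaℝ (z + ((2 * k : ℕ) : ℂ))) * (k + z / 2) / Real.pi := by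
      push_cast; ring
    rw [h5, ih]
    generalize ∏ j ∈ Finset.range k, ((j : ℂ) + z / 2) = p
    field_simp

theorem hermite_even_eq_sum (n : ℕ) : (Polynomial.hermite (2 * n)).map (Int.castRingHom ℂ) =
    ∑ k ∈ Finset.range (n + 1), Polynomial.C ((-1) ^ (n - k) * (2 * n).factorial /
      ((2 * k).factorial * (n - k).factorial * 2 ^ (n - k)) : ℂ) * Polynomial.X ^ (2 * k) := by
  ext i
  rw [Polynomial.coeff_map, Polynomial.finsetSum_coeff]
  simp only [Polynomial.coeff_C_mul, Polynomial.coeff_X_pow]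
  rcases Nat.even_or_odd' i with ⟨m, rfl | rfl⟩
  · by_cases hm : m ≤ n
    · rw [Finset.sum_eq_single m]
      · obtain ⟨l, rfl⟩ := Nat.exists_eq_add_of_le hm
        have h1 := Polynomial.coeff_hermite_explicit l (2 * m)
        rw [show 2 * (m + l) = 2 * l + 2 * m by ring, h1]
        -- Turns the double factorial of the explicit coefficient into factorials; at `l = 0` the
        -- truncated `2 * l - 1` is `0`, with double factorial `1`.
        have h2 : (2 * l - 1).doubleFactorial * (2 ^ l * l.factorial) = (2 * l).factorial := by
          cases l with
          | zero => simp
          | succ l =>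
            rw [show 2 * (l + 1) - 1 = 2 * l + 1 by omega, ← Nat.doubleFactorial_two_mul (l + 1),
              show 2 * (l + 1) = 2 * l + 1 + 1 by ring, mul_comm,
              ← Nat.factorial_eq_mul_doubleFactorial]
        have h3 := Nat.add_choose_mul_factorial_mul_factorial (2 * l) (2 * m)
        have h4 : (((2 * l - 1).doubleFactorial : ℕ) : ℂ) * (2 ^ l * l.factorial) =
            (2 * l).factorial := by exact_mod_cast h2
        have h5 : ((2 * l + 2 * m).choose (2 * m) : ℂ) * (2 * l).factorial * (2 * m).factorial =
            (2 * l + 2 * m).factorial := by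
          exact_mod_cast h3
        have h6 : ((2 * m).factorial : ℂ) ≠ 0 := by exact_mod_cast (Nat.factorial_ne_zero _)
        have h7 : (l.factorial : ℂ) ≠ 0 := by exact_mod_cast (Nat.factorial_ne_zero _)
        simp only [add_tsub_cancel_left, if_true, mul_one]
        rw [eq_div_iff (mul_ne_zero (mul_ne_zero h6 h7) (by simp)), ← h5, ← h4]
        simp only [map_mul, map_pow, map_neg, map_one, map_natCast]
        ring
      · intro k _ hk
        rw [if_neg (by omega), mul_zero]
      · intro h
        simp at h
        omega
    · rw [Polynomial.coeff_hermite_of_lt (by omega), map_zero, Finset.sum_eq_zero]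
      intro k hk
      rw [Finset.mem_range] at hk
      rw [if_neg (by omega), mul_zero]
  · rw [Polynomial.coeff_hermite_of_odd_add ⟨n + m, by ring⟩, map_zero, Finset.sum_eq_zero]
    intro k _
    rw [if_neg (by omega), mul_zero]

theorem mellinU_sum {ι : Type*} (t : Finset ι) (φ : ι → 𝓢(ℝ, ℂ)) (s : ℝ) :
    mellinU (∑ i ∈ t, φ i : 𝓢(ℝ, ℂ)) s = ∑ i ∈ t, mellinU (φ i) s := by
  classical
  induction t using Finset.induction_on with
  | empty =>
    have := mellinU_smul 0 0 s
    simpa using this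
  | insert a t ha ih => rw [Finset.sum_insert ha, Finset.sum_insert ha, mellinU_add, ih]

theorem mellinU_hermiteGauss_zero (s : ℝ) : mellinU (hermiteGauss 0) s =
    ((Real.pi ^ (-(1 / 2) : ℝ) : ℝ) : ℂ) * (1 / 2 * Complex.Gammaℝ (1 / 2 - Complex.I * s)) := by
  rw [mellinU, ← mellin_gauss (by rw [line_re]; norm_num)]
  congr 2
  ext x
  rw [hermiteGauss_apply]
  simp

theorem mellinU_hermiteGauss_zero_ne (s : ℝ) : mellinU (hermiteGauss 0) s ≠ 0 := by
  rw [mellinU_hermiteGauss_zero]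
  refine mul_ne_zero (Complex.ofReal_ne_zero.2 (Real.rpow_pos_of_pos Real.pi_pos _).ne')
    (mul_ne_zero (by norm_num) (Complex.Gammaℝ_ne_zero_of_re_pos ?_))
  rw [line_re]; norm_num

theorem mellinU_hermiteFun (n : ℕ) (s : ℝ) :
    mellinU (hermiteFun n) s = hermiteConst n * mellinU (hermiteGauss n) s := by
  rw [← coe_hermiteSchwartz, hermiteSchwartz, mellinU_smul]

theorem hermiteConst_zero : hermiteConst 0 = 2 ^ (1 / 4 : ℝ) := by simp [hermiteConst]

theorem hermiteConst_mul_sqrt (n : ℕ) :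
    hermiteConst n * Real.sqrt n.factorial = hermiteConst 0 := by
  rw [hermiteConst_zero, hermiteConst, div_mul_cancel₀]
  positivity

/-- The transform of `h_0`. -/
theorem mellinU_hermiteFun_zero (s : ℝ) : mellinU (hermiteFun 0) s =
    (((2 : ℝ) ^ (-(3 / 4) : ℝ) * Real.pi ^ (-(1 / 2) : ℝ) : ℝ) : ℂ) *
      Complex.Gammaℝ (1 / 2 - Complex.I * s) := by
  rw [mellinU_hermiteFun, mellinU_hermiteGauss_zero, hermiteConst_zero]
  have h : (2 : ℝ) ^ (-(3 / 4) : ℝ) = 2 ^ (1 / 4 : ℝ) * (1 / 2) := by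
    rw [show (-(3 / 4) : ℝ) = 1 / 4 + (-1) by norm_num, Real.rpow_add two_pos, Real.rpow_neg_one]
    norm_num
  rw [h]
  push_cast
  ring

theorem mellinU_hermiteFun_zero_ne (s : ℝ) : mellinU (hermiteFun 0) s ≠ 0 := by
  rw [mellinU_hermiteFun]
  exact mul_ne_zero (Complex.ofReal_ne_zero.2 (hermiteConst_pos 0).ne')
    (mellinU_hermiteGauss_zero_ne s)

theorem mellinU_polyGauss (k : ℕ) (s : ℝ) : mellinU (polyGauss (Polynomial.X ^ (2 * k))) s =
    ((Real.pi : ℂ) ^ k)⁻¹ * (∏ j ∈ Finset.range k, ((j : ℂ) + (1 / 2 - Complex.I * s) / 2)) *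
      mellinU (hermiteGauss 0) s := by
  have h1 : (polyGauss (Polynomial.X ^ (2 * k)) : ℝ → ℂ) =
      fun x : ℝ => (x : ℂ) ^ (2 * k) * Complex.exp (-Real.pi * x ^ 2) := by
    ext x; simp [polyGauss_apply]
  have h2 : (hermiteGauss 0 : ℝ → ℂ) = fun x : ℝ => Complex.exp (-Real.pi * x ^ 2) := by
    ext x; rw [hermiteGauss_apply]; simp
  rw [mellinU, mellinU, h1, h2, mellin_pow_mul_gauss k (by rw [line_re]; norm_num)]
  ring

theorem hermiteGauss_even_eq_sum (n : ℕ) : hermiteGauss (2 * n) =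
    ∑ k ∈ Finset.range (n + 1), ((-1) ^ (n - k) * (2 * n).factorial /
      ((2 * k).factorial * (n - k).factorial * 2 ^ (n - k)) * (4 ^ k * (Real.pi : ℂ) ^ k) : ℂ) •
        polyGauss (Polynomial.X ^ (2 * k)) := by
  have h0 : (((2 * Real.sqrt Real.pi : ℝ) : ℂ)) ^ 2 = 4 * Real.pi := by
    have := four_pi_eq
    rw [← pow_two] at this
    exact_mod_cast this
  ext x
  rw [hermiteGauss, polyGauss_apply, Polynomial.eval_comp, hermite_even_eq_sum,
    Polynomial.eval_finsetSum, Finset.sum_mul, sum_apply]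
  refine Finset.sum_congr rfl fun k _ => ?_
  rw [smul_apply, polyGauss_apply]
  simp only [Polynomial.eval_mul, Polynomial.eval_C, Polynomial.eval_pow, Polynomial.eval_X,
    smul_eq_mul]
  rw [mul_pow, pow_mul (((2 * Real.sqrt Real.pi : ℝ) : ℂ)), h0, mul_pow]
  ring

/-- Term by term, the `(4π)^k` from the argument `2√π x` meets the `π^(-k)` of the Mellin transform,
and `4^k / 2^(n-k) = 2^(3k-n)`. -/
theorem mellinU_hermiteGauss (n : ℕ) (s : ℝ) : mellinU (hermiteGauss (2 * n)) s =
    (-1) ^ n * (Real.sqrt (2 * n).factorial : ℂ) * (polyP n).eval (s : ℂ) *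
      mellinU (hermiteGauss 0) s := by
  rw [hermiteGauss_even_eq_sum, mellinU_sum, polyP, Polynomial.eval_mul, Polynomial.eval_C,
    Polynomial.eval_finsetSum]
  have h0 : (Real.sqrt (2 * n).factorial : ℂ) * (Real.sqrt (2 * n).factorial : ℂ) =
      (2 * n).factorial := by
    exact_mod_cast Real.mul_self_sqrt (Nat.cast_nonneg _)
  have h1 (S : ℂ) : (-1) ^ n * (Real.sqrt (2 * n).factorial : ℂ) *
      ((Real.sqrt (2 * n).factorial : ℂ) * S) * mellinU (hermiteGauss 0) s =
      S * ((-1) ^ n * (2 * n).factorial * mellinU (hermiteGauss 0) s) := by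
    rw [← h0]; ring
  rw [h1, Finset.sum_mul]
  refine Finset.sum_congr rfl fun k hk => ?_
  rw [Finset.mem_range_succ_iff] at hk
  obtain ⟨l, rfl⟩ := Nat.exists_eq_add_of_le hk
  rw [mellinU_smul, mellinU_polyGauss]
  simp only [Polynomial.eval_mul, Polynomial.eval_C, Polynomial.eval_prod, Polynomial.eval_sub,
    Polynomial.eval_X, add_tsub_cancel_left]
  have h2 : ∀ j : ℕ, (j : ℂ) + 1 / 4 - Complex.I / 2 * s =
      (j : ℂ) + (1 / 2 - Complex.I * s) / 2 := fun j => by ring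
  simp only [h2]
  generalize ∏ j ∈ Finset.range k, ((j : ℂ) + (1 / 2 - Complex.I * s) / 2) = p
  generalize mellinU (hermiteGauss 0) s = w
  have h3 : (2 : ℂ) ^ (3 * (k : ℤ) - ((k + l : ℕ) : ℤ)) = 4 ^ k / 2 ^ l := by
    rw [show (3 * (k : ℤ) - ((k + l : ℕ) : ℤ)) = ((2 * k : ℕ) : ℤ) - (l : ℤ) by push_cast; ring,
      zpow_sub₀ two_ne_zero, zpow_natCast, zpow_natCast, pow_mul]
    norm_num
  have hpi : (Real.pi : ℂ) ≠ 0 := Complex.ofReal_ne_zero.2 Real.pi_ne_zero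
  have h4 : ((-1 : ℂ)) ^ k * (-1) ^ (k + l) = (-1) ^ l := by
    rw [pow_add, ← mul_assoc, ← pow_add, ← two_mul, pow_mul]; simp
  rw [h3, ← h4]
  have h6 : ((2 * k).factorial : ℂ) ≠ 0 := by exact_mod_cast (Nat.factorial_ne_zero _)
  have h7 : (l.factorial : ℂ) ≠ 0 := by exact_mod_cast (Nat.factorial_ne_zero _)
  field_simp

/-- The transform of `h_{2n}`. -/
theorem mellinU_hermiteFun_even (n : ℕ) (s : ℝ) : mellinU (hermiteFun (2 * n)) s =
    (-1) ^ n * (polyP n).eval (s : ℂ) * mellinU (hermiteFun 0) s := by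
  rw [mellinU_hermiteFun, mellinU_hermiteFun, mellinU_hermiteGauss, ← hermiteConst_mul_sqrt (2 * n)]
  push_cast
  ring

/-! ### Recurrence, degree and parity of `𝒫_n` -/

/-- The ladder relations make `x∂` shift the index by `0` or `±2`; its diagonal part is `-1/2`,
which the constant term of the operator removes. -/
theorem eulerSchwartz_hermiteGauss (n : ℕ) : eulerSchwartz (hermiteGauss n) =
    (1 / 2 : ℂ) • (((n : ℂ) * (n - 1 : ℕ)) • hermiteGauss (n - 1 - 1) - hermiteGauss (n + 2)) := by
  have hc : ((Real.sqrt Real.pi : ℝ) : ℂ) * (((2 * Real.sqrt Real.pi)⁻¹ : ℝ) : ℂ) = 1 / 2 := by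
    have h0 : (Real.sqrt Real.pi : ℂ) ≠ 0 := by
      exact_mod_cast (Real.sqrt_pos.2 Real.pi_pos).ne'
    push_cast
    field_simp
  rw [eulerSchwartz_eq, deriv_hermiteGauss, map_smul, map_sub, map_smul, mul_hermiteGauss,
    mul_hermiteGauss, smul_comm (n : ℂ) ((((2 * Real.sqrt Real.pi)⁻¹ : ℝ) : ℂ)),
    ← smul_sub, smul_smul, hc]
  cases n with
  | zero => simp
  | succ n =>
    simp only [Nat.add_sub_cancel]
    push_cast
    module

/-- The polynomials `(-1)^n √((2n)!) 𝒫_n`. -/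
def polyQ (n : ℕ) : Polynomial ℂ :=
  Polynomial.C ((-1) ^ n * (Real.sqrt (2 * n).factorial : ℂ)) * polyP n

theorem polyQ_eval (n : ℕ) (s : ℝ) :
    mellinU (hermiteGauss (2 * n)) s = (polyQ n).eval (s : ℂ) * mellinU (hermiteGauss 0) s := by
  rw [mellinU_hermiteGauss, polyQ, Polynomial.eval_mul, Polynomial.eval_C]

theorem polynomial_eq_of_eval_real {p q : Polynomial ℂ}
    (h : ∀ s : ℝ, p.eval (s : ℂ) = q.eval (s : ℂ)) : p = q := by
  refine Polynomial.eq_of_infinite_eval_eq p q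
    (Set.Infinite.mono (s := Set.range ((↑) : ℝ → ℂ)) ?_ ?_)
  · rintro _ ⟨s, rfl⟩; exact h s
  · exact Set.infinite_range_of_injective Complex.ofReal_injective

/-- The transform of `eulerSchwartz_hermiteGauss`, where the operator becomes multiplication by
`is`; the transform of the Gaussian has no zero and can be divided out. -/
theorem polyQ_recurrence (n : ℕ) : polyQ (n + 2) =
    Polynomial.C ((2 * n + 2) * (2 * n + 1) : ℂ) * polyQ n -
      Polynomial.C (2 * Complex.I) * (Polynomial.X * polyQ (n + 1)) := by
  refine polynomial_eq_of_eval_real fun s => ?_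
  have h1 := mellinU_eulerSchwartz (hermiteGauss (2 * (n + 1))) s
  rw [eulerSchwartz_hermiteGauss, mellinU_smul, sub_eq_add_neg, mellinU_add, mellinU_smul,
    ← neg_one_smul ℂ (hermiteGauss _), mellinU_smul,
    show 2 * (n + 1) - 1 - 1 = 2 * n by omega, show 2 * (n + 1) - 1 = 2 * n + 1 by omega,
    show 2 * (n + 1) + 2 = 2 * (n + 2) by ring, polyQ_eval, polyQ_eval, polyQ_eval] at h1
  refine mul_right_cancel₀ (mellinU_hermiteGauss_zero_ne s) ?_
  simp only [Polynomial.eval_sub, Polynomial.eval_mul, Polynomial.eval_C, Polynomial.eval_X]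
  push_cast at h1
  linear_combination -2 * h1

theorem polyQ_zero : polyQ 0 = 1 := by
  refine polynomial_eq_of_eval_real fun s => ?_
  refine mul_right_cancel₀ (mellinU_hermiteGauss_zero_ne s) ?_
  rw [← polyQ_eval]; simp

theorem polyQ_one : polyQ 1 = Polynomial.C (-2 * Complex.I) * Polynomial.X := by
  refine polynomial_eq_of_eval_real fun s => ?_
  refine mul_right_cancel₀ (mellinU_hermiteGauss_zero_ne s) ?_
  have h1 := mellinU_eulerSchwartz (hermiteGauss (2 * 0)) s
  rw [eulerSchwartz_hermiteGauss, mellinU_smul, sub_eq_add_neg, mellinU_add, mellinU_smul,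
    ← neg_one_smul ℂ (hermiteGauss _), mellinU_smul,
    show 2 * 0 + 2 = 2 * 1 by ring, polyQ_eval, polyQ_eval, polyQ_zero] at h1
  simp only [Polynomial.eval_mul, Polynomial.eval_C, Polynomial.eval_X]
  simp at h1
  linear_combination -2 * h1

/-- The recurrence reaches back two steps, so two consecutive indices are carried together. The
leading term comes from `X * polyQ (n + 1)`. -/
theorem polyQ_natDegree_parity (n : ℕ) :
    ((polyQ n).natDegree = n ∧ (polyQ n).comp (-Polynomial.X) = (-1) ^ n * polyQ n) ∧
      (polyQ (n + 1)).natDegree = n + 1 ∧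
        (polyQ (n + 1)).comp (-Polynomial.X) = (-1) ^ (n + 1) * polyQ (n + 1) := by
  have hI : (-2 * Complex.I) ≠ 0 := by simp
  induction n with
  | zero =>
    rw [zero_add, polyQ_zero, polyQ_one, Polynomial.natDegree_C_mul_X _ hI]
    simp
  | succ n ih =>
    obtain ⟨⟨hd0, hp0⟩, hd1, hp1⟩ := ih
    refine ⟨⟨hd1, hp1⟩, ?_, ?_⟩
    · rw [polyQ_recurrence]
      have h0 : polyQ (n + 1) ≠ 0 := by
        intro h; rw [h] at hd1; simp at hd1
      have h1 : (Polynomial.C (2 * Complex.I) * (Polynomial.X * polyQ (n + 1))).natDegree =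
          n + 1 + 1 := by
        rw [Polynomial.natDegree_C_mul (by simp), Polynomial.natDegree_X_mul h0, hd1]
      rw [Polynomial.natDegree_sub_eq_right_of_natDegree_lt, h1]
      rw [h1]
      exact (Polynomial.natDegree_C_mul_le _ _).trans_lt (by omega)
    · rw [polyQ_recurrence]
      simp only [Polynomial.sub_comp, Polynomial.mul_comp, Polynomial.C_comp, Polynomial.X_comp,
        hp0, hp1]
      ring

theorem polyP_eq (n : ℕ) : ∃ c : ℂ, c ≠ 0 ∧ polyP n = Polynomial.C c * polyQ n := by
  have h : ((-1) ^ n * (Real.sqrt (2 * n).factorial : ℂ)) ≠ 0 :=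
    mul_ne_zero (by simp) (Complex.ofReal_ne_zero.2 (by positivity))
  refine ⟨((-1) ^ n * (Real.sqrt (2 * n).factorial : ℂ))⁻¹, inv_ne_zero h, ?_⟩
  rw [polyQ, ← mul_assoc, ← Polynomial.C_mul, inv_mul_cancel₀ h, Polynomial.C_1, one_mul]

theorem natDegree_polyP (n : ℕ) : (polyP n).natDegree = n := by
  obtain ⟨c, hc, h⟩ := polyP_eq n
  rw [h, Polynomial.natDegree_C_mul hc, (polyQ_natDegree_parity n).1.1]

theorem polyP_comp_neg (n : ℕ) : (polyP n).comp (-Polynomial.X) = (-1) ^ n * polyP n := by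
  obtain ⟨c, hc, h⟩ := polyP_eq n
  rw [h, Polynomial.mul_comp, Polynomial.C_comp, (polyQ_natDegree_parity n).1.2]
  ring

/-! ### Dilation invariant operators as multiplication operators -/

/-- The modulus of `v^(1/2 - is)` does not depend on `s`. Boundedness keeps products with `L²`
functions in `L²`. -/
theorem exists_norm_mellinU_le (ψ : 𝓢(ℝ, ℂ)) : ∃ C, ∀ s, ‖mellinU ψ s‖ ≤ C := by
  refine ⟨‖((Real.pi ^ (-(1 / 2) : ℝ) : ℝ) : ℂ)‖ *
    ∫ x in Ioi (0 : ℝ), x ^ (-(1 / 2) : ℝ) * ‖ψ x‖, fun s => ?_⟩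
  rw [mellinU, norm_mul]
  refine mul_le_mul_of_nonneg_left ?_ (norm_nonneg _)
  refine (norm_integral_le_integral_norm _).trans (le_of_eq ?_)
  refine setIntegral_congr_fun measurableSet_Ioi fun x hx => ?_
  rw [norm_smul, Complex.norm_cpow_eq_rpow_re_of_pos hx, Complex.sub_re, line_re]
  norm_num

/-- Dilation `ψ ↦ ψ (a ·)` of Schwartz functions. -/
def schwartzDilate (a : ℝ) (ha : a ≠ 0) : 𝓢(ℝ, ℂ) →L[ℂ] 𝓢(ℝ, ℂ) :=
  SchwartzMap.compCLMOfContinuousLinearEquiv ℂ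
    (LinearEquiv.smulOfNeZero ℝ ℝ a ha).toContinuousLinearEquiv

theorem schwartzDilate_apply (a : ℝ) (ha : a ≠ 0) (ψ : 𝓢(ℝ, ℂ)) (x : ℝ) :
    schwartzDilate a ha ψ x = ψ (a * x) := rfl

theorem mellinU_schwartzDilate {a : ℝ} (ha : 0 < a) (ψ : 𝓢(ℝ, ℂ)) (s : ℝ) :
    mellinU (schwartzDilate a ha.ne' ψ) s = (a : ℂ) ^ (-(1 / 2 - Complex.I * s)) * mellinU ψ s := by
  have h : (schwartzDilate a ha.ne' ψ : ℝ → ℂ) = fun x => ψ (a * x) := rfl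
  rw [mellinU, mellinU, h, mellin_comp_mul_left ψ _ ha, smul_eq_mul]
  ring

section

variable {U : L2ev ≃ₗᵢ[ℂ] Lp ℂ 2 (volume : Measure ℝ)}

theorem inner_schwartzVec_eq_integral (hU : IsGivenByMellin U)
    (ψ : 𝓢(ℝ, ℂ)) (h : ∀ x, ψ (-x) = ψ x) (f : L2ev) :
    ⟪schwartzVec ψ h, f⟫ = ∫ s, (starRingEnd ℂ) (mellinU ψ s) * U f s := by
  have h1 : ⟪schwartzVec ψ h, f⟫ = ⟪U (schwartzVec ψ h), U f⟫ := (U.inner_map_map _ _).symm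
  rw [h1, L2.inner_def]
  refine integral_congr_ae ?_
  filter_upwards [unitary_schwartzVec hU ψ h] with s hs
  rw [hs, RCLike.inner_apply, mul_comm]

theorem memLp_mellinU (hU : IsGivenByMellin U) (ψ : 𝓢(ℝ, ℂ)) (h : ∀ x, ψ (-x) = ψ x) :
     MemLp (mellinU ψ) 2 :=
  (memLp_congr_ae (unitary_schwartzVec hU ψ h)).1 (Lp.memLp _)

theorem integrable_conj_mellinU_mul (hU : IsGivenByMellin U) (ψ : 𝓢(ℝ, ℂ)) (h : ∀ x, ψ (-x) = ψ x)
    (F : Lp ℂ 2 (volume : Measure ℝ)) :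
    Integrable fun s => (starRingEnd ℂ) (mellinU ψ s) * F s :=
  (memLp_mellinU hU ψ h).star.integrable_mul (Lp.memLp F)

theorem memLp_conj_mellinU_mul (hU : IsGivenByMellin U) (ψ : 𝓢(ℝ, ℂ)) (h : ∀ x, ψ (-x) = ψ x)
    (F : Lp ℂ 2 (volume : Measure ℝ)) :
    MemLp (fun s => (starRingEnd ℂ) (mellinU ψ s) * F s) 2 := by
  obtain ⟨C, hC⟩ := exists_norm_mellinU_le ψ
  refine MemLp.of_le_mul (c := C) (Lp.memLp F)
    ((memLp_mellinU hU ψ h).star.1.mul (Lp.aestronglyMeasurable F))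
    (Eventually.of_forall fun s => ?_)
  rw [norm_mul, RCLike.norm_conj]
  exact mul_le_mul_of_nonneg_right (hC s) (norm_nonneg _)

/-- A symmetric operator which acts on even Schwartz functions as multiplication by `m` after the
Mellin transform has the multiplication by `m` as adjoint. -/
theorem forall_inner_eq_iff (hU : IsGivenByMellin U) {A₀ : 𝓢(ℝ, ℂ) → 𝓢(ℝ, ℂ)} {m : ℝ → ℝ}
    (hA : ∀ ψ s, mellinU (A₀ ψ) s = (m s : ℂ) * mellinU ψ s)
    (hev : ∀ φ : 𝓢(ℝ, ℂ), (∀ x, φ (-x) = φ x) → ∀ x, A₀ φ (-x) = A₀ φ x) (f g : L2ev) :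
    (∀ (ψ : 𝓢(ℝ, ℂ)) (h : ∀ x, ψ (-x) = ψ x),
      ⟪schwartzVec ψ h, g⟫ = ⟪schwartzVec (A₀ ψ) (hev ψ h), f⟫) ↔
        ∀ᵐ s, U g s = (m s : ℂ) * U f s := by
  constructor
  · intro H
    have he := hermiteGauss_even 0
    -- The Gaussian serves as the only test function, up to dilation; its transform has no zero,
    -- which permits the final division.
    set w : 𝓢(ℝ, ℂ) := hermiteGauss (2 * 0) with hw
    set G : ℝ → ℂ := fun s => (starRingEnd ℂ) (mellinU w s) * U g s -
      (starRingEnd ℂ) (mellinU (A₀ w) s) * U f s with hG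
    have h0 : G =ᵐ[volume] 0 := by
      refine ae_eq_zero_of_fourier_eq_zero
        ((integrable_conj_mellinU_mul hU _ he _).sub
          (integrable_conj_mellinU_mul hU _ (hev _ he) _))
        ((memLp_conj_mellinU_mul hU _ he _).sub (memLp_conj_mellinU_mul hU _ (hev _ he) _))
        fun ξ => ?_
      -- Dilation by `a` multiplies the transform by `a^(-1/2 + is)`, with conjugate `exp (-πξ) exp
      -- (-2πisξ)`. The tested equation is thus the Fourier transform of `G` at `ξ`, up to a nonzero
      -- factor.
      set a := Real.exp (2 * Real.pi * ξ) with ha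
      have ha0 : 0 < a := Real.exp_pos _
      have he' : ∀ x, schwartzDilate a ha0.ne' w (-x) = schwartzDilate a ha0.ne' w x := by
        intro x
        rw [schwartzDilate_apply, schwartzDilate_apply, mul_neg, he]
      have h1 := H _ he'
      rw [inner_schwartzVec_eq_integral hU, inner_schwartzVec_eq_integral hU, ← sub_eq_zero,
        ← integral_sub (integrable_conj_mellinU_mul hU _ he' _)
          (integrable_conj_mellinU_mul hU _ (hev _ he') _)] at h1
      have h2 (s : ℝ) : (starRingEnd ℂ) ((a : ℂ) ^ (-(1 / 2 - Complex.I * s))) =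
          (Real.exp (-(Real.pi * ξ)) : ℂ) * Complex.exp (↑(-2 * Real.pi * s * ξ) * Complex.I) := by
        rw [Complex.cpow_def_of_ne_zero (Complex.ofReal_ne_zero.2 ha0.ne'), ← Complex.exp_conj,
          ← Complex.ofReal_log ha0.le, ha, Real.log_exp, Complex.ofReal_exp, ← Complex.exp_add]
        congr 1
        simp [Complex.conj_ofNat]
        ring
      have h3 (s : ℝ) : (starRingEnd ℂ) (mellinU (schwartzDilate a ha0.ne' w) s) * U g s -
          (starRingEnd ℂ) (mellinU (A₀ (schwartzDilate a ha0.ne' w)) s) * U f s =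
          (Real.exp (-(Real.pi * ξ)) : ℂ) *
            (Complex.exp (↑(-2 * Real.pi * s * ξ) * Complex.I) * G s) := by
        rw [hA, mellinU_schwartzDilate ha0, hG]
        simp only [hA, map_mul, h2]
        ring
      simp only [h3] at h1
      rw [integral_const_mul, mul_eq_zero] at h1
      have h4 := h1.resolve_left (Complex.ofReal_ne_zero.2 (Real.exp_pos _).ne')
      rw [Real.fourier_eq', ← h4]
      refine integral_congr_ae (Eventually.of_forall fun s => ?_)
      simp only [smul_eq_mul]
      congr 3
      simp
      ring
    filter_upwards [h0] with s hs
    have h5 : (starRingEnd ℂ) (mellinU w s) * (U g s - m s * U f s) = 0 := by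
      have hs' : G s = 0 := hs
      rw [← hs', hG]
      simp only [hA, map_mul, Complex.conj_ofReal]
      ring
    exact sub_eq_zero.1 ((mul_eq_zero.1 h5).resolve_left
      ((map_ne_zero _).2 (mellinU_hermiteGauss_zero_ne s)))
  · intro H ψ h
    rw [inner_schwartzVec_eq_integral hU, inner_schwartzVec_eq_integral hU]
    refine integral_congr_ae ?_
    filter_upwards [H] with s hs
    rw [hs, hA, map_mul, Complex.conj_ofReal]
    ring

theorem mem_scalingOp_graph_iff_ae (hU : IsGivenByMellin U) (f g : L2ev) :
    (f, g) ∈ scalingOp.graph ↔ ∀ᵐ s : ℝ, U g s = (s : ℂ) * U f s := by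
  rw [mem_scalingOp_graph_iff]
  refine forall_inner_eq_iff hU (A₀ := fun ψ => (-Complex.I) • eulerSchwartz ψ) (m := fun s => s)
    (fun ψ s => ?_) _ f g
  rw [mellinU_smul, mellinU_eulerSchwartz]
  linear_combination -(s : ℂ) * mellinU ψ s * Complex.I_sq

theorem mem_eulerOp_graph_iff_ae (hU : IsGivenByMellin U) (f g : L2ev) :
    (f, g) ∈ eulerOp.graph ↔ ∀ᵐ s : ℝ, U g s = -((s : ℂ) ^ 2 + 1 / 4) * U f s := by
  rw [mem_eulerOp_graph_iff]
  have := forall_inner_eq_iff hU (A₀ := eulerSqSchwartz) (m := fun s => -(s ^ 2 + 1 / 4))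
    (fun ψ s => by rw [mellinU_eulerSqSchwartz]; push_cast; ring)
    (fun φ h => eulerSqSchwartz_even h) f g
  rw [this]
  push_cast
  rfl

end

/-- The unitary given by the Mellin formula is unique. -/
theorem IsGivenByMellin.unique {U U' : L2ev ≃ₗᵢ[ℂ] Lp ℂ 2 (volume : Measure ℝ)}
    (hU : IsGivenByMellin U) (hU' : IsGivenByMellin U') : U = U' := by
  have h1 (n : ℕ) : U (hermiteVec n) = U' (hermiteVec n) := by
    ext1
    rw [hermiteVec_eq]
    exact (unitary_schwartzVec hU _ _).trans (unitary_schwartzVec hU' _ _).symm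
  ext1 f
  have h2 : U'.symm (U f) - f = 0 := by
    refine eq_zero_of_inner_hermiteVec _ fun n => ?_
    have h3 : ⟪hermiteVec n, U'.symm (U f)⟫ = ⟪hermiteVec n, f⟫ := by
      have h4 : ⟪hermiteVec n, U'.symm (U f)⟫ = ⟪U' (hermiteVec n), U' (U'.symm (U f))⟫ :=
        (U'.inner_map_map _ _).symm
      rw [h4, U'.apply_symm_apply, ← h1]
      exact U.inner_map_map _ _
    rw [← sub_eq_zero] at h3
    exact (inner_sub_right _ _ _).trans h3
  rw [sub_eq_zero] at h2
  rw [← h2, U'.apply_symm_apply, h2]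

/-! ### The measure `dm` and the unitary `M` -/

/-- `Γ((1/2 - is)/2)` is the conjugate of `Γ(1/4 + is/2)`, and the constants combine as `(2^(-3/4)
π^(-1/2) π^(-1/4))² = (2π)^(-3/2)`. -/
theorem norm_sq_mellinU_hermiteFun_zero (s : ℝ) : ‖mellinU (hermiteFun 0) s‖ ^ 2 =
    (2 * Real.pi) ^ (-(3 / 2) : ℝ) * ‖Complex.Gamma (1 / 4 + Complex.I * s / 2)‖ ^ 2 := by
  have h1 : Complex.Gamma ((1 / 2 - Complex.I * s) / 2) =
      (starRingEnd ℂ) (Complex.Gamma (1 / 4 + Complex.I * s / 2)) := by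
    rw [← Complex.Gamma_conj]
    congr 1
    simp [Complex.conj_ofNat]
    ring
  have h2 : ‖(Real.pi : ℂ) ^ (-(1 / 2 - Complex.I * s) / 2)‖ = Real.pi ^ (-(1 / 4) : ℝ) := by
    rw [Complex.norm_cpow_eq_rpow_re_of_pos Real.pi_pos]
    congr 1
    simp
    norm_num
  rw [mellinU_hermiteFun_zero, Complex.Gammaℝ_def, norm_mul, norm_mul, h1, h2, RCLike.norm_conj,
    Complex.norm_real, Real.norm_of_nonneg (by positivity), mul_pow, mul_pow, mul_pow, ← mul_assoc,
    Real.mul_rpow (by norm_num) Real.pi_pos.le]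
  simp only [← Real.rpow_mul_natCast Real.pi_pos.le, ← Real.rpow_mul_natCast two_pos.le]
  rw [mul_assoc _ (Real.pi ^ _) (Real.pi ^ _), ← Real.rpow_add Real.pi_pos]
  norm_num

theorem dm_eq_withDensity : dm = (volume : Measure ℝ).withDensity fun s =>
    ENNReal.ofReal (‖mellinU (hermiteFun 0) s‖ ^ 2) := by
  simp only [norm_sq_mellinU_hermiteFun_zero]
  rfl

theorem unitary_hermiteVec {U : L2ev ≃ₗᵢ[ℂ] Lp ℂ 2 (volume : Measure ℝ)} (hU : IsGivenByMellin U)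
    (n : ℕ) : U (hermiteVec n) =ᵐ[volume] mellinU (hermiteFun (2 * n)) := by
  rw [hermiteVec_eq, ← coe_hermiteSchwartz]
  exact unitary_schwartzVec hU _ _

theorem memLp_mellinU_hermiteFun_zero : MemLp (mellinU (hermiteFun 0)) 2 := by
  obtain ⟨U, hU⟩ := exists_isGivenByMellin
  exact (memLp_congr_ae (unitary_hermiteVec hU 0)).1 (Lp.memLp _)

theorem aemeasurable_density :
    AEMeasurable fun s => ENNReal.ofReal (‖mellinU (hermiteFun 0) s‖ ^ 2) :=
  (memLp_mellinU_hermiteFun_zero.1.norm.aemeasurable.pow_const 2).ennreal_ofReal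

theorem dm_absolutelyContinuous : dm ≪ volume := by
  rw [dm_eq_withDensity]
  exact withDensity_absolutelyContinuous _ _

theorem absolutelyContinuous_dm : (volume : Measure ℝ) ≪ dm := by
  rw [dm_eq_withDensity]
  refine withDensity_absolutelyContinuous' aemeasurable_density (Eventually.of_forall fun s => ?_)
  rw [ne_eq, ENNReal.ofReal_eq_zero, not_le]
  have := norm_pos_iff.2 (mellinU_hermiteFun_zero_ne s)
  positivity

theorem lintegral_dm {g : ℝ → ℝ≥0∞} (hg : AEMeasurable g) : ∫⁻ s, g s ∂dm =
    ∫⁻ s, ENNReal.ofReal (‖mellinU (hermiteFun 0) s‖ ^ 2) * g s := by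
  rw [dm_eq_withDensity, lintegral_withDensity_eq_lintegral_mul₀ aemeasurable_density hg]
  rfl

/-- The total mass is `‖U h_0‖² = ‖h_0‖²`, so no Gamma integral is evaluated. -/
theorem isProbabilityMeasure_dm : IsProbabilityMeasure dm := by
  obtain ⟨U, hU⟩ := exists_isGivenByMellin
  have h1 : ‖U (hermiteVec 0)‖ = 1 := by rw [U.norm_map]; exact orthonormal_hermiteVec.1 0
  rw [Lp.norm_def, ENNReal.toReal_eq_one_iff, eLpNorm_congr_ae (unitary_hermiteVec hU 0),
    eLpNorm_two_eq] at h1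
  have h2 := congrArg (· ^ (2 : ℝ)) h1
  simp only [← ENNReal.rpow_mul, ENNReal.one_rpow] at h2
  norm_num at h2
  refine ⟨?_⟩
  rw [dm_eq_withDensity, withDensity_apply _ MeasurableSet.univ, setLIntegral_univ, ← h2]
  refine lintegral_congr fun s => ?_
  rw [ENNReal.ofReal_pow (norm_nonneg _), ofReal_norm]

theorem quasiMeasurePreserving_id_of_ac {X : Type*} [MeasurableSpace X] {μ ν : Measure X}
    (h : ν ≪ μ) : Measure.QuasiMeasurePreserving id ν μ :=
  ⟨measurable_id, by rwa [Measure.map_id]⟩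

/-- Division by the transform of the Gaussian is unitary onto `L²(ℝ, dm)`. -/
theorem exists_divEquiv : ∃ M : Lp ℂ 2 (volume : Measure ℝ) ≃ₗᵢ[ℂ] Lp ℂ 2 dm,
    ∀ f, M f =ᵐ[dm] fun s => (mellinU (hermiteFun 0) s)⁻¹ * f s := by
  have hw := memLp_mellinU_hermiteFun_zero.1
  have hne (s : ℝ) : ‖mellinU (hermiteFun 0) s‖ ≠ 0 :=
    norm_ne_zero_iff.2 (mellinU_hermiteFun_zero_ne s)
  have hm {F : ℝ → ℂ} (hF : AEStronglyMeasurable F volume) :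
      AEMeasurable (fun s => ‖F s‖ₑ ^ 2) volume := hF.enorm.pow_const 2
  obtain ⟨T, hT⟩ := exists_weightedComp (LinearIsometry.id (R := ℂ)
      (E := Lp ℂ 2 (volume : Measure ℝ)))
    (quasiMeasurePreserving_id_of_ac dm_absolutelyContinuous)
    (c := fun s => (mellinU (hermiteFun 0) s)⁻¹)
    (hw.aemeasurable.inv.aestronglyMeasurable.mono_ac dm_absolutelyContinuous) fun f => by
      have hi : AEMeasurable fun s => (mellinU (hermiteFun 0) s)⁻¹ := hw.aemeasurable.inv
      refine (lintegral_dm (g := fun s => ENNReal.ofReal (‖(mellinU (hermiteFun 0) s)⁻¹‖ ^ 2) *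
        ‖f s‖ₑ ^ 2) ((hi.norm.pow_const 2).ennreal_ofReal.mul
          (hm (Lp.aestronglyMeasurable f)))).trans ?_
      refine lintegral_congr fun s => ?_
      rw [← mul_assoc, ← ENNReal.ofReal_mul (by positivity), norm_inv, ← mul_pow,
        mul_inv_cancel₀ (hne s)]
      simp
  obtain ⟨T', hT'⟩ := exists_weightedComp (LinearIsometry.id (R := ℂ) (E := Lp ℂ 2 dm))
    (quasiMeasurePreserving_id_of_ac absolutelyContinuous_dm)
    (c := fun s => mellinU (hermiteFun 0) s) hw fun f =>
      (lintegral_dm (g := fun s => ‖f s‖ₑ ^ 2)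
        (hm ((Lp.aestronglyMeasurable f).mono_ac absolutelyContinuous_dm))).symm
  refine ⟨LinearIsometryEquiv.ofSurjective T fun F => ⟨T' F, ?_⟩, hT⟩
  ext1
  filter_upwards [hT (T' F), dm_absolutelyContinuous.ae_le (hT' F)] with s h1 h2
  rw [h1]
  exact (congrArg _ h2).trans (inv_mul_cancel_left₀ (mellinU_hermiteFun_zero_ne s) _)

theorem ae_dm_iff {p : ℝ → Prop} : (∀ᵐ s ∂dm, p s) ↔ ∀ᵐ s, p s :=
  ⟨fun h => absolutelyContinuous_dm.ae_le h, fun h => dm_absolutelyContinuous.ae_le h⟩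

/-! ### Orthonormality and completeness of the polynomials -/

/-- `M` is the division by the transform of the Gaussian. -/
def IsDivision (M : Lp ℂ 2 (volume : Measure ℝ) ≃ₗᵢ[ℂ] Lp ℂ 2 dm) : Prop :=
  ∀ f, ∀ᵐ s, M f s = (mellinU (hermiteFun 0) s)⁻¹ * f s

theorem isDivision_iff {U : L2ev ≃ₗᵢ[ℂ] Lp ℂ 2 (volume : Measure ℝ)} (hU : IsGivenByMellin U)
    (M : Lp ℂ 2 (volume : Measure ℝ) ≃ₗᵢ[ℂ] Lp ℂ 2 dm) :
    (∀ f, ∀ᵐ s ∂dm, M f s = (U (hermiteVec 0) s)⁻¹ * f s) ↔ IsDivision M := by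
  refine forall_congr' fun f => ?_
  rw [ae_dm_iff]
  refine eventually_congr ?_
  filter_upwards [unitary_hermiteVec hU 0] with s hs
  rw [hs]

theorem exists_isDivision : ∃ M, IsDivision M := by
  obtain ⟨M, hM⟩ := exists_divEquiv
  exact ⟨M, fun f => ae_dm_iff.1 (hM f)⟩

theorem IsDivision.unique {M M' : Lp ℂ 2 (volume : Measure ℝ) ≃ₗᵢ[ℂ] Lp ℂ 2 dm}
    (h : IsDivision M) (h' : IsDivision M') : M = M' := by
  ext1 f
  ext1
  refine ae_dm_iff.2 ?_
  filter_upwards [h f, h' f] with s h1 h2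
  rw [h1, h2]

theorem transform_hermiteVec {U : L2ev ≃ₗᵢ[ℂ] Lp ℂ 2 (volume : Measure ℝ)}
    (hU : IsGivenByMellin U) {M : Lp ℂ 2 (volume : Measure ℝ) ≃ₗᵢ[ℂ] Lp ℂ 2 dm}
    (hM : IsDivision M) (n : ℕ) : M (U (hermiteVec n)) = (-1 : ℂ) ^ n • polyVec n := by
  ext1
  filter_upwards [ae_dm_iff.2 (hM (U (hermiteVec n))), ae_dm_iff.2 (unitary_hermiteVec hU n),
    Lp.coeFn_smul ((-1 : ℂ) ^ n) (polyVec n), (memLp_polynomial_dm (polyP n)).coeFn_toLp]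
    with s h1 h2 h3 h4
  rw [h1, h2, h3, Pi.smul_apply, polyVec, h4, mellinU_hermiteFun_even, smul_eq_mul]
  field_simp [mellinU_hermiteFun_zero_ne s]

theorem polyVec_eq {V : L2ev ≃ₗᵢ[ℂ] Lp ℂ 2 dm}
    (hV : ∀ n, V (hermiteVec n) = (-1 : ℂ) ^ n • polyVec n) (n : ℕ) :
    polyVec n = (-1 : ℂ) ^ n • V (hermiteVec n) := by
  rw [hV, smul_smul, ← mul_pow]
  simp

theorem inner_polyVec {V : L2ev ≃ₗᵢ[ℂ] Lp ℂ 2 dm}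
    (hV : ∀ n, V (hermiteVec n) = (-1 : ℂ) ^ n • polyVec n) (n : ℕ) (f : L2ev) :
    ⟪polyVec n, V f⟫ = (-1 : ℂ) ^ n * ⟪hermiteVec n, f⟫ := by
  have h : ⟪V (hermiteVec n), V f⟫ = ⟪hermiteVec n, f⟫ := V.inner_map_map _ _
  rw [polyVec_eq hV, inner_smul_left, h]
  simp

/-- Orthonormality and completeness of the polynomials refer to no particular unitary; this provides
one to carry them over. -/
theorem exists_transform : ∃ V : L2ev ≃ₗᵢ[ℂ] Lp ℂ 2 dm,
    ∀ n, V (hermiteVec n) = (-1 : ℂ) ^ n • polyVec n := by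
  obtain ⟨U, hU⟩ := exists_isGivenByMellin
  obtain ⟨M, hM⟩ := exists_isDivision
  exact ⟨U.trans M, transform_hermiteVec hU hM⟩

theorem orthonormal_polyVec : Orthonormal ℂ polyVec := by
  obtain ⟨V, hV⟩ := exists_transform
  refine ⟨fun n => ?_, fun m n hmn => ?_⟩
  · rw [polyVec_eq hV, norm_smul, V.norm_map]
    simpa using orthonormal_hermiteVec.1 n
  · have h : ⟪hermiteVec m, hermiteVec n⟫ = 0 := orthonormal_hermiteVec.2 hmn
    change ⟪polyVec m, polyVec n⟫ = 0
    rw [polyVec_eq hV n, inner_smul_right, inner_polyVec hV, h]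
    simp

theorem polyVec_span_orthogonal : (Submodule.span ℂ (Set.range polyVec))ᗮ = ⊥ := by
  obtain ⟨V, hV⟩ := exists_transform
  rw [Submodule.eq_bot_iff]
  intro F hF
  have h : V.symm F = 0 := by
    refine eq_zero_of_inner_hermiteVec _ fun n => ?_
    have h1 := (Submodule.mem_orthogonal _ _).1 hF _ (Submodule.subset_span ⟨n, rfl⟩)
    rw [← V.apply_symm_apply F, inner_polyVec hV] at h1
    exact (mul_eq_zero.1 h1).resolve_left (by simp)
  rw [← V.apply_symm_apply F, h, map_zero]

/-- The polynomials `𝒫_n` as a Hilbert basis. -/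
def polyBasis : HilbertBasis ℕ ℂ (Lp ℂ 2 dm) :=
  HilbertBasis.mkOfOrthogonalEqBot orthonormal_polyVec polyVec_span_orthogonal

theorem coe_polyBasis : (polyBasis : ℕ → Lp ℂ 2 dm) = polyVec :=
  HilbertBasis.coe_mkOfOrthogonalEqBot _ _

/-- Pairing the defining series with `𝒫_n` isolates one term; conversely the basis expansion of `G`
is that series, so summability needs no separate condition. -/
theorem mem_gradingOp_graph_iff_inner (F G : Lp ℂ 2 dm) : (F, G) ∈ gradingOp.graph ↔
    ∀ n, ⟪polyVec n, G⟫ = n * ⟪polyVec n, F⟫ := by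
  rw [gradingOp, mem_diagOp_graph]
  constructor
  · intro h n
    have h1 := h.mapL (innerSL ℂ (polyVec n))
    have h2 := hasSum_single (f := fun m : ℕ => (innerSL ℂ (polyVec n))
      (((m : ℂ) * ⟪polyVec m, F⟫) • polyVec m)) n fun m hm => by
        rw [innerSL_apply_apply, inner_smul_right, orthonormal_polyVec.2 hm.symm, mul_zero]
    have h3 := h1.unique h2
    rw [innerSL_apply_apply, innerSL_apply_apply, inner_smul_right,
      inner_self_eq_norm_sq_to_K, orthonormal_polyVec.1] at h3
    simpa using h3
  · intro h
    have h1 := polyBasis.hasSum_repr G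
    simp only [HilbertBasis.repr_apply_apply, coe_polyBasis, h] at h1
    exact h1

/-! ### Conjugation of unbounded operators -/

section

variable {E F : Type*} [NormedAddCommGroup E] [InnerProductSpace ℂ E]
  [NormedAddCommGroup F] [InnerProductSpace ℂ F]

theorem mem_conjBy_graph (V : E ≃ₗᵢ[ℂ] F) (T : E →ₗ.[ℂ] E) (x y : F) :
    (x, y) ∈ (conjBy V T).graph ↔ (V.symm x, V.symm y) ∈ T.graph := by
  simp only [LinearPMap.mem_graph_iff]
  constructor
  · rintro ⟨⟨z, hz⟩, rfl, rfl⟩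
    exact ⟨⟨V.symm z, hz⟩, rfl, (V.symm_apply_apply _).symm⟩
  · rintro ⟨⟨z, hz⟩, h1, h2⟩
    obtain rfl : z = V.symm x := h1
    exact ⟨⟨x, hz⟩, rfl, (congrArg V h2).trans (V.apply_symm_apply y)⟩

/-- A scalar multiple keeps its domain even when the scalar is `0`, so membership in the domain of
`N` is still required when `c = 0`, which is the case `λ = 0`. -/
theorem mem_graph_combination (A N : E →ₗ.[ℂ] E) (c d e : ℂ) (x y : E) :
    (x, y) ∈ (-A + c • (d • N + idOp) - e • idOp).graph ↔
      ∃ a b, (x, a) ∈ A.graph ∧ (x, b) ∈ N.graph ∧ y = -a + c • (d • b + x) - e • x := by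
  simp only [LinearPMap.mem_graph_iff]
  constructor
  · rintro ⟨⟨z, hz⟩, rfl, rfl⟩
    exact ⟨A ⟨z, hz.1.1⟩, N ⟨z, hz.1.2.1⟩, ⟨_, rfl, rfl⟩, ⟨_, rfl, rfl⟩, rfl⟩
  · rintro ⟨a, b, ⟨⟨z, hz⟩, h1, rfl⟩, ⟨⟨z', hz'⟩, h2, rfl⟩, rfl⟩
    subst h1
    subst h2
    exact ⟨⟨_, ⟨⟨hz, hz', trivial⟩, trivial⟩⟩, rfl, rfl⟩

end

/-! ### The transforms of the scaling and prolate operators -/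

section

variable {U : L2ev ≃ₗᵢ[ℂ] Lp ℂ 2 (volume : Measure ℝ)}
  {M : Lp ℂ 2 (volume : Measure ℝ) ≃ₗᵢ[ℂ] Lp ℂ 2 dm}

theorem IsDivision.ae_mul_iff (hM : IsDivision M) (f g : Lp ℂ 2 (volume : Measure ℝ))
    (φ : ℝ → ℂ) : (∀ᵐ s, g s = φ s * f s) ↔ (M f, M g) ∈ (mulOp dm φ).graph := by
  rw [mem_mulOp_graph, ae_dm_iff]
  refine eventually_congr ?_
  filter_upwards [hM f, hM g] with s h1 h2
  simp only [h1, h2]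
  rw [mul_left_comm, mul_right_inj' (inv_ne_zero (mellinU_hermiteFun_zero_ne s))]

theorem conjBy_scalingOp (hU : IsGivenByMellin U) (hM : IsDivision M) :
    conjBy (U.trans M) scalingOp = mulOp dm (fun s => (s : ℂ)) := by
  refine LinearPMap.eq_of_eq_graph (Submodule.ext fun ⟨F, G⟩ => ?_)
  rw [mem_conjBy_graph, mem_scalingOp_graph_iff_ae hU, hM.ae_mul_iff]
  have h (H : Lp ℂ 2 dm) : M (U ((U.trans M).symm H)) = H := (U.trans M).apply_symm_apply H
  rw [h, h]

theorem mem_eulerOp_graph_iff_mulOp (hU : IsGivenByMellin U) (hM : IsDivision M) (f g : L2ev) :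
    (f, g) ∈ eulerOp.graph ↔
      (M (U f), -M (U g) - (1 / 4 : ℂ) • M (U f)) ∈ (mulOp dm fun s => (s : ℂ) ^ 2).graph := by
  rw [mem_eulerOp_graph_iff_ae hU, ← map_neg M, ← map_smul M, ← map_sub M, ← hM.ae_mul_iff]
  refine eventually_congr ?_
  filter_upwards [Lp.coeFn_sub (-U g) ((1 / 4 : ℂ) • U f), Lp.coeFn_neg (U g),
    Lp.coeFn_smul (1 / 4 : ℂ) (U f)] with s h1 h2 h3
  rw [h1, Pi.sub_apply, h2, h3, Pi.neg_apply, Pi.smul_apply, smul_eq_mul]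
  constructor
  · intro h
    rw [h]
    ring
  · intro h
    linear_combination -h

/-- The eigenvalue `2π(4n + 1)` inverts to `n = (H/(2π) - 1)/4`, applied coefficient by coefficient;
the signs `(-1)^n` occur on both sides. -/
theorem mem_hermiteOp_graph_iff_gradingOp {V : L2ev ≃ₗᵢ[ℂ] Lp ℂ 2 dm}
    (hV : ∀ n, V (hermiteVec n) = (-1 : ℂ) ^ n • polyVec n) (f g : L2ev) :
    (f, g) ∈ hermiteOp.graph ↔
      (V f, (1 / 4 : ℂ) • ((((2 * Real.pi)⁻¹ : ℝ) : ℂ) • V g - V f)) ∈ gradingOp.graph := by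
  rw [mem_hermiteOp_graph_iff_inner, mem_gradingOp_graph_iff_inner]
  refine forall_congr' fun n => ?_
  have h1 : (Real.pi : ℂ) ≠ 0 := Complex.ofReal_ne_zero.2 Real.pi_ne_zero
  rw [inner_smul_right, inner_sub_right, inner_smul_right, inner_polyVec hV, inner_polyVec hV]
  push_cast
  constructor
  · intro h
    field_simp
    linear_combination h
  · intro h
    field_simp at h
    linear_combination h

theorem conjBy_prolateOp (hU : IsGivenByMellin U) (hM : IsDivision M) (lam : ℝ) :
    conjBy (U.trans M) (prolateOp lam) =
      -mulOp dm (fun s => (s : ℂ) ^ 2) +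
        ((2 * Real.pi * lam ^ 2 : ℝ) : ℂ) • ((4 : ℂ) • gradingOp + idOp) -
        (1 / 4 : ℂ) • idOp := by
  have hV : ∀ n, (U.trans M) (hermiteVec n) = (-1 : ℂ) ^ n • polyVec n :=
    transform_hermiteVec hU hM
  have he (f g : L2ev) : (f, g) ∈ eulerOp.graph ↔ (U.trans M f, -U.trans M g -
    (1 / 4 : ℂ) • U.trans M f) ∈ (mulOp dm fun s => (s : ℂ) ^ 2).graph :=
    mem_eulerOp_graph_iff_mulOp hU hM f g
  generalize U.trans M = V at hV he ⊢
  have hπ : (Real.pi : ℂ) ≠ 0 := Complex.ofReal_ne_zero.2 Real.pi_ne_zero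
  refine LinearPMap.eq_of_eq_graph (Submodule.ext fun ⟨F, G⟩ => ?_)
  obtain ⟨f, rfl⟩ := V.surjective F
  obtain ⟨g, rfl⟩ := V.surjective G
  rw [mem_conjBy_graph, mem_graph_combination, mem_prolateOp_graph_iff, V.symm_apply_apply,
    V.symm_apply_apply]
  simp only [he, mem_hermiteOp_graph_iff_gradingOp hV]
  constructor
  · rintro ⟨e, k, h1, h2, rfl⟩
    refine ⟨_, _, h1, h2, ?_⟩
    have h3 : V (e + ((lam ^ 2 : ℝ) : ℂ) • k) = V e + ((lam ^ 2 : ℝ) : ℂ) • V k :=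
      (V.map_add _ _).trans (congrArg _ (V.map_smul _ _))
    rw [h3]
    push_cast
    match_scalars <;> field_simp
    ring
  · rintro ⟨a, b, h1, h2, h3⟩
    -- Solves `a = -V e - (1/4) V f` and `b = (1/4)((2π)⁻¹ V k - V f)` for `e` and `k`.
    refine ⟨V.symm (-a - (1 / 4 : ℂ) • V f),
      V.symm (((2 * Real.pi : ℝ) : ℂ) • ((4 : ℂ) • b + V f)), ?_, ?_, ?_⟩
    · rw [V.apply_symm_apply]
      convert! h1 using 2
      module
    · rw [V.apply_symm_apply]
      convert! h2 using 2
      push_cast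
      match_scalars <;> field_simp
      ring
    · apply V.injective
      refine Eq.trans ?_ ((V.map_add _ _).trans (congrArg _ (V.map_smul _ _))).symm
      rw [V.apply_symm_apply, V.apply_symm_apply, h3]
      push_cast
      module

end

theorem polyVec_mem_gradingOp_graph (n : ℕ) :
    (polyVec n, (n : ℂ) • polyVec n) ∈ gradingOp.graph := by
  rw [mem_gradingOp_graph_iff_inner]
  intro m
  rw [inner_smul_right]
  rcases eq_or_ne m n with rfl | h
  · rfl
  · rw [orthonormal_polyVec.2 h, mul_zero, mul_zero]

/-- The prolate operator acts on even Schwartz functions as the differential operator. -/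
theorem exists_mem_prolateOp_graph_schwartz (lam : ℝ) (ψ : 𝓢(ℝ, ℂ)) (h : ∀ x, ψ (-x) = ψ x) :
    ∃ f g : L2ev, (f, g) ∈ (prolateOp lam).graph ∧
      (∀ᵐ q : ℝ, (f : Lp ℂ 2 (volume : Measure ℝ)) q = ψ q) ∧
      ∀ᵐ q : ℝ, (g : Lp ℂ 2 (volume : Measure ℝ)) q =
        -deriv (fun x : ℝ => ((lam : ℂ) ^ 2 - (x : ℂ) ^ 2) * deriv ψ x) q +
          (2 * Real.pi * lam * q : ℂ) ^ 2 * ψ q := by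
  refine ⟨schwartzVec ψ h, schwartzVec (eulerSqSchwartz ψ) (eulerSqSchwartz_even h) +
    ((lam ^ 2 : ℝ) : ℂ) • schwartzVec (hermiteOpSchwartz ψ) (hermiteOpSchwartz_even h),
    (mem_prolateOp_graph_iff _ _ _).2 ⟨_, _, schwartz_mem_eulerOp_graph ψ h,
      schwartz_mem_hermiteOp_graph ψ h, rfl⟩, coeFn_schwartzVec ψ h, ?_⟩
  filter_upwards [coeFn_schwartzVec (eulerSqSchwartz ψ) (eulerSqSchwartz_even h),
    coeFn_schwartzVec (hermiteOpSchwartz ψ) (hermiteOpSchwartz_even h),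
    Lp.coeFn_add (schwartzVec (eulerSqSchwartz ψ) (eulerSqSchwartz_even h) :
      Lp ℂ 2 (volume : Measure ℝ)) (((lam ^ 2 : ℝ) : ℂ) •
      schwartzVec (hermiteOpSchwartz ψ) (hermiteOpSchwartz_even h) :
      Lp ℂ 2 (volume : Measure ℝ)),
    Lp.coeFn_smul ((lam ^ 2 : ℝ) : ℂ) (schwartzVec (hermiteOpSchwartz ψ)
      (hermiteOpSchwartz_even h) : Lp ℂ 2 (volume : Measure ℝ))] with q h1 h2 h3 h4
  refine h3.trans ?_
  rw [Pi.add_apply, h4, Pi.smul_apply, h1, h2, eulerSqSchwartz_eq, hermiteOpSchwartz_eq]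
  have hd (φ : 𝓢(ℝ, ℂ)) (x : ℝ) : derivSchwartz φ x = deriv φ x := rfl
  have hd1 : (fun x : ℝ => ((lam : ℂ) ^ 2 - (x : ℂ) ^ 2) * deriv ψ x) =
      fun x => (lam : ℂ) ^ 2 * derivSchwartz ψ x - mulSchwartz (fun q => q ^ 2)
        (derivSchwartz ψ) x := by
    funext x
    rw [mulSchwartz_apply (by fun_prop)]
    push_cast
    rw [hd]
    ring
  rw [hd1, deriv_fun_sub ((SchwartzMap.differentiableAt _).const_mul _)
    (SchwartzMap.differentiableAt _), deriv_const_mul _ (SchwartzMap.differentiableAt _),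
    hd, add_apply, neg_apply, hd,
    mulSchwartz_apply (φ := fun q => (2 * Real.pi * q) ^ 2) (by fun_prop)]
  push_cast
  rw [smul_eq_mul]
  ring

end HardyTitchmarsh

end

theorem mainTheorem3 :
    -- `U` is a well-defined unitary
    (∃! U : L2ev ≃ₗᵢ[ℂ] Lp ℂ 2 (volume : Measure ℝ), IsGivenByMellin U) ∧
    ∀ U : L2ev ≃ₗᵢ[ℂ] Lp ℂ 2 (volume : Measure ℝ), IsGivenByMellin U →
    -- (i) the transform of `h_0`
    ((∀ᵐ s : ℝ, U (hermiteVec 0) s = mellinU (hermiteFun 0) s) ∧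
      ∀ s : ℝ, MellinConvergent (hermiteFun 0) (1 / 2 - Complex.I * s) ∧
        mellinU (hermiteFun 0) s =
          (((2 : ℝ) ^ (-(3 / 4) : ℝ) * Real.pi ^ (-(1 / 2) : ℝ) : ℝ) : ℂ) *
            Complex.Gammaℝ (1 / 2 - Complex.I * s)) ∧
    -- (ii) the transform of `h_{2n}` and the orthonormal polynomials `𝒫_n`
    ((∀ n : ℕ,
        (∀ᵐ s : ℝ, U (hermiteVec n) s =
          (-1) ^ n * (polyP n).eval (s : ℂ) * U (hermiteVec 0) s) ∧
        ∀ s : ℝ, MellinConvergent (hermiteFun (2 * n)) (1 / 2 - Complex.I * s) ∧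
          mellinU (hermiteFun (2 * n)) s =
            (-1) ^ n * (polyP n).eval (s : ℂ) * mellinU (hermiteFun 0) s) ∧
      (∀ n : ℕ, (polyP n).natDegree = n ∧
        (polyP n).comp (-Polynomial.X) = (-1) ^ n * polyP n) ∧
      IsProbabilityMeasure dm ∧
      Orthonormal ℂ polyVec ∧
      (Submodule.span ℂ (Set.range polyVec)).topologicalClosure = ⊤) ∧
    -- (iii) `M` is a well-defined unitary
    (∃! M : Lp ℂ 2 (volume : Measure ℝ) ≃ₗᵢ[ℂ] Lp ℂ 2 dm,
      ∀ f : Lp ℂ 2 (volume : Measure ℝ), ∀ᵐ s ∂dm,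
        M f s = (U (hermiteVec 0) s)⁻¹ * f s) ∧
    ∀ M : Lp ℂ 2 (volume : Measure ℝ) ≃ₗᵢ[ℂ] Lp ℂ 2 dm,
      (∀ f : Lp ℂ 2 (volume : Measure ℝ), ∀ᵐ s ∂dm,
        M f s = (U (hermiteVec 0) s)⁻¹ * f s) →
    -- (iv) the images of `h_{2n}` and of the scaling operator
    ((∀ n : ℕ, M (U (hermiteVec n)) = (-1 : ℂ) ^ n • polyVec n) ∧
      conjBy (U.trans M) scalingOp = mulOp dm (fun s => (s : ℂ))) ∧
    -- (v) the image of the prolate operator; its domain contains the even Schwartz functions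
    (∀ n : ℕ, (polyVec n, (n : ℂ) • polyVec n) ∈ gradingOp.graph) ∧
    ∀ lam : ℝ,
      conjBy (U.trans M) (prolateOp lam) =
        -mulOp dm (fun s => (s : ℂ) ^ 2) +
          ((2 * Real.pi * lam ^ 2 : ℝ) : ℂ) • ((4 : ℂ) • gradingOp + idOp) -
          (1 / 4 : ℂ) • idOp ∧
      ∀ ψ : 𝓢(ℝ, ℂ), (∀ x, ψ (-x) = ψ x) →
        ∃ f g : L2ev, (f, g) ∈ (prolateOp lam).graph ∧
          (∀ᵐ q : ℝ, (f : Lp ℂ 2 (volume : Measure ℝ)) q = ψ q) ∧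
          ∀ᵐ q : ℝ, (g : Lp ℂ 2 (volume : Measure ℝ)) q =
            -deriv (fun x : ℝ => ((lam : ℂ) ^ 2 - (x : ℂ) ^ 2) * deriv ψ x) q +
              (2 * Real.pi * lam * q : ℂ) ^ 2 * ψ q := by
  have hconv (n : ℕ) (s : ℝ) : MellinConvergent (hermiteFun n) (1 / 2 - Complex.I * s) := by
    rw [← coe_hermiteSchwartz]
    exact mellinConvergent_schwartz _ (by rw [line_re]; norm_num)
  obtain ⟨U₀, hU₀⟩ := exists_isGivenByMellin
  refine ⟨⟨U₀, hU₀, fun U hU => hU.unique hU₀⟩, fun U hU => ⟨⟨unitary_hermiteVec hU 0,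
    fun s => ⟨hconv 0 s, mellinU_hermiteFun_zero s⟩⟩, ⟨fun n => ⟨?_, fun s => ⟨hconv _ s,
      mellinU_hermiteFun_even n s⟩⟩, fun n => ⟨natDegree_polyP n, polyP_comp_neg n⟩,
      isProbabilityMeasure_dm, orthonormal_polyVec,
      Submodule.topologicalClosure_eq_top_iff.2 polyVec_span_orthogonal⟩, ?_, fun M hM => ?_⟩⟩
  · filter_upwards [unitary_hermiteVec hU n, unitary_hermiteVec hU 0] with s h1 h2
    rw [h1, h2, mellinU_hermiteFun_even]
  · obtain ⟨M, hM⟩ := exists_isDivision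
    exact ⟨M, (isDivision_iff hU M).2 hM, fun M' hM' => ((isDivision_iff hU M').1 hM').unique hM⟩
  · rw [isDivision_iff hU] at hM
    exact ⟨⟨transform_hermiteVec hU hM, conjBy_scalingOp hU hM⟩, polyVec_mem_gradingOp_graph,
      fun lam => ⟨conjBy_prolateOp hU hM lam, exists_mem_prolateOp_graph_schwartz lam⟩⟩
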